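/- **Setting.** $M$ clients minimise $F=\frac1M\sum_{i=1}^M F_i$ on $\mathbb R^d$, where $F_i(x)=\mathbb E_z\,\ell_i(x,z)$ and $z$ is a sample of client $i$: either a uniformly random element of a local dataset of size $n$ (the same $n$ for all clients), or, in the online scenario ($n=\infty$), a sample of a local distribution $\mathcal D_i$. Each $\ell_i(\cdot,z)$ is differentiable. For a batch $B$ of samples let $f_i(x,B)=\frac1{|B|}\sum_{z\in B}\ell_i(x,z)$; batches are drawn uniformly without replacement from a finite dataset and i.i.d. in the online scenario. Assume, for constants $L>0$, $\sigma\ge0$, $L_\sigma\ge 0$, for all clients $i$, all $v,w\in\mathbb R^d$ and all batch sizes $|B|\le n$ (no bound online): 1. $F_i$ is differentiable and $\|\nabla F_i(v)-\nabla F_i(w)\|\le L\|v-w\|$; 2. $\mathbb E_B\|\nabla f_i(v,B)-\nabla F_i(v)\|^2\le \sigma^2/|B|$; 3. $\mathbb E_B\|(\nabla f_i(v,B)-\nabla f_i(w,B))-(\nabla F_i(v)-\nabla F_i(w))\|^2\le \frac{L_\sigma^2}{|B|}\|v-w\|^2$; 4. $F$ is bounded below, with infimum $F_*$. **Algorithm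 (FedAMD with constant probability $p$).** Start at $x_0$ with $v_0^{(i)}=\nabla f_i(x_0,B_i)$, $|B_i|=b$, for all $i$. In round $t=0,1,\dots$ a uniformly random set $\mathcal A$ of $A\le M$ clients participates; put $g_t=\frac1M\sum_i v_t^{(i)}$. Independently, each $i\in\mathcal A$ is an *anchor* with probability $p$ and a *miner* otherwise. An anchor sets $v_{t+1}^{(i)}=\nabla f_i(x_t,B)$ with a fresh batch of size $b$; for all other clients $v_{t+1}^{(i)}=v_t^{(i)}$. A miner sets $x^{-1}=x^0=x_t$, $g^0=g_t$ and, for $k=0,\dots,K-1$ with a fresh batch $B_k$ of size $b'$, $g^{k+1}=g^k-\nabla f_i(x^{k-1},B_k)+\nabla f_i(x^k,B_k)$ and $x^{k+1}=x^k-\eta_l g^{k+1}$; it returns $\Delta^{(i)}=x_t-x^K$. Finally $x_{t+1}=x_t-\eta_s\cdot(\text{average of }\Delta^{(i)}\text{ over the miners})$, or $x_{t+1}=x_t$ if there is no miner. The cumulative gradient complexity after $T$ rounds is the total number of samples in all batches called by the clients, including the initial ones. **Parameters.** Let $1\le A\le M$, $c\ge1$, $p=\frac1c\left(\frac2{A+2}\right)^{1/A}$,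 $K\ge\max\left(1,\frac{2L_\sigma^2}{L^2}\right)$, $b'=1$, $\eta_l=\frac1{2\sqrt6KL}$, $\eta_s=\frac{2\sqrt6A}{A+3Mc}$, and, for $\varepsilon>0$ and a constant $\theta\ge1$, $b=\min\left(\left\lceil\frac{\theta\sigma^2}{M\varepsilon}\right\rceil,n\right)$, where $b>b'$. **Claim.** There is an absolute constant $\kappa\ge1$ such that the following holds, where $c$, $L$, $\theta$ and an upper bound of $F(x_0)-F_*$ are treated as constants: there is $C_1$ depending only on these, such that for every integer $T\ge C_1\frac{M}{A\varepsilon}$ $$\min_{0\le t<T}\mathbb E\|\nabla F(x_t)\|^2\le\begin{cases}\varepsilon,& b=n,\\ \max\left(1,\frac\kappa\theta\right)\varepsilon,& b<n.\end{cases}$$ So after $T=O\left(\frac M{A\varepsilon}\right)$ rounds the accuracy is $O(\varepsilon)$ for the batch size with $\theta=1$, and it is at most $\varepsilon$ if $\theta\geq\kappa$ or $b=n$. Moreover, in the online scenario, for $\varepsilon$ in any bounded range $(0,\varepsilon_0]$, the cumulative gradient complexity after $T=\left\lceil C_1\frac M{A\varepsilon}\right\rceil$ rounds is almost surely at most $C_2\left(\frac{\sigma^2}{\varepsilon^2}+\frac{MK}\varepsilon\right)$,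 where $C_2$ depends only on the constants above and on $\varepsilon_0$. -/

import Mathlib

open MeasureTheory ProbabilityTheory
open scoped ENNReal Gradient

noncomputable section

namespace FedAMD

universe u

/-- The model space `ℝ^d` with the Euclidean norm. -/
abbrev Vec (d : ℕ) : Type := EuclideanSpace ℝ (Fin d)

/-- The local training data of `M` clients. Either every client holds a finite dataset of the same
size `n`, or the setting is online (streaming) and client `i` draws fresh samples from a
distribution `D i`. -/
inductive LocalData (Z : Type u) [MeasurableSpace Z] (M : ℕ) : Type u
  | dataset (n : ℕ) (pts : Fin M → Fin n → Z) : LocalData Z M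
  | online (D : Fin M → ProbabilityMeasure Z) : LocalData Z M

namespace LocalData

variable {Z : Type u} [MeasurableSpace Z] {M : ℕ}

/-- The size `n` of the local datasets, infinite in the online scenario. -/
def size : LocalData Z M → ℕ∞
  | dataset n _ => (n : ℕ∞)
  | online _ => ⊤

/-- The online scenario. -/
def IsOnline : LocalData Z M → Prop
  | dataset _ _ => False
  | online _ => True

/-- The law of one sample of client `i`. -/
def sampleLaw : LocalData Z M → Fin M → Measure Z
  | dataset n pts, i => (uniformOn (Set.univ : Set (Fin n))).map (pts i)
  | online D, i => (D i : Measure Z)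

/-- The law of a batch of `s` samples of client `i`: `s` data points drawn uniformly without
replacement from a finite dataset, `s` independent samples in the online scenario. -/
def batchLaw : LocalData Z M → Fin M → (s : ℕ) → Measure (Fin s → Z)
  | dataset n pts, i, s =>
      (uniformOn {j : Fin s → Fin n | Function.Injective j}).map (fun j r => pts i (j r))
  | online D, i, _ => Measure.pi (fun _ => (D i : Measure Z))

/-- The large batch size `min (a, n)` (rounded up to an integer). -/
def largeBatch : LocalData Z M → ℝ → ℕ
  | dataset n _, a => min ⌈a⌉₊ n
  | online _, a => ⌈a⌉₊

end LocalData

/-- A federated learning problem: the loss `loss i x z` of client `i` at the model `x` on the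
sample `z`, and the local data. -/
structure Problem (Z : Type u) [MeasurableSpace Z] (d M : ℕ) : Type u where
  loss : Fin M → Vec d → Z → ℝ
  data : LocalData Z M

namespace Problem

variable {Z : Type u} [MeasurableSpace Z] {d M : ℕ} (P : Problem Z d M)

/-- The local objective `F_i`. -/
def localObj (i : Fin M) (x : Vec d) : ℝ := ∫ z, P.loss i x z ∂(P.data.sampleLaw i)

/-- The global objective `F = (1/M) ∑ F_i`. -/
def obj (x : Vec d) : ℝ := (M : ℝ)⁻¹ * ∑ i, P.localObj i x

/-- The empirical loss `f_i(x, B)` on a batch `B` of `s` samples. -/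
def batchLoss (i : Fin M) {s : ℕ} (B : Fin s → Z) (x : Vec d) : ℝ :=
  (s : ℝ)⁻¹ * ∑ r, P.loss i x (B r)

/-- The batch gradient `∇ f_i(x, B)`. -/
def batchGrad (i : Fin M) {s : ℕ} (B : Fin s → Z) (x : Vec d) : Vec d :=
  ∇ (P.batchLoss i B) x

/-- The standing regularity that makes the objectives and the stochastic gradients meaningful. -/
structure Regular : Prop where
  differentiable_loss : ∀ i z, Differentiable ℝ (fun x => P.loss i x z)
  measurable_loss : ∀ i x, Measurable (P.loss i x)
  measurable_grad : ∀ i, Measurable (fun q : Vec d × Z => ∇ (fun y => P.loss i y q.2) q.1)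
  integrable_loss : ∀ i x, Integrable (P.loss i x) (P.data.sampleLaw i)

/-- The local objectives are `L`-smooth. -/
def Smooth (L : ℝ) : Prop :=
  ∀ i, Differentiable ℝ (P.localObj i) ∧
    ∀ v w, ‖∇ (P.localObj i) v - ∇ (P.localObj i) w‖ ≤ L * ‖v - w‖

/-- Bounded noise: `E ‖∇ f_i(v, B) - ∇ F_i(v)‖² ≤ σ² / |B|`. -/
def BoundedNoise (σ : ℝ) : Prop :=
  ∀ i (s : ℕ), 1 ≤ s → (s : ℕ∞) ≤ P.data.size → ∀ v,
    ∫⁻ B, ‖P.batchGrad i B v - ∇ (P.localObj i) v‖ₑ ^ 2 ∂(P.data.batchLaw i s)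
      ≤ ENNReal.ofReal (σ ^ 2 / s)

/-- Average smoothness:
`E ‖(∇ f_i(v, B) - ∇ f_i(w, B)) - (∇ F_i(v) - ∇ F_i(w))‖² ≤ (Lσ² / |B|) ‖v - w‖²`. -/
def AverageSmooth (Lσ : ℝ) : Prop :=
  ∀ i (s : ℕ), 1 ≤ s → (s : ℕ∞) ≤ P.data.size → ∀ v w,
    ∫⁻ B, ‖(P.batchGrad i B v - P.batchGrad i B w)
        - (∇ (P.localObj i) v - ∇ (P.localObj i) w)‖ₑ ^ 2 ∂(P.data.batchLaw i s)
      ≤ ENNReal.ofReal (Lσ ^ 2 / s * ‖v - w‖ ^ 2)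

end Problem

/-- The hyperparameters of the algorithm: number `A` of participants per round, number `K` of local
updates, large batch size `b`, small batch size `b'`, constant probability `p` of being an anchor,
local and global learning rates. -/
structure Params where
  A : ℕ
  K : ℕ
  b : ℕ
  b' : ℕ
  p : ℝ
  ηl : ℝ
  ηs : ℝ

/-- The server state at the start of a round: the global model `x_t`, the caching gradients
`v_t^(i)`, and the number of samples called so far by all clients. -/
abbrev State (d M : ℕ) : Type := Vec d × (Fin M → Vec d) × ℕ

/-- The randomness of one round: the participating clients, the coin of each client (`true` for
anchor), the large batch of each client, and the small batches of each client. -/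
abbrev Seed (Z : Type u) (M : ℕ) (H : Params) : Type u :=
  (Fin M → Bool) × (Fin M → Bool) × (Fin M → Fin H.b → Z) ×
    (Fin M → Fin H.K → Fin H.b' → Z)

/-- The law of the participants: a uniformly random set of `A` clients. -/
def participantLaw (M A : ℕ) : Measure (Fin M → Bool) :=
  uniformOn {s | (Finset.univ.filter (fun i => s i = true)).card = A}

/-- The Bernoulli law with parameter `p`. -/
def coinLaw (p : ℝ) : Measure Bool :=
  ENNReal.ofReal p • Measure.dirac true + ENNReal.ofReal (1 - p) • Measure.dirac false

section Algorithm

variable {Z : Type u} [MeasurableSpace Z] {d M : ℕ} (P : Problem Z d M) (H : Params)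

/-- The law of the randomness of one round: participants, coins and batches are independent. -/
def seedLaw : Measure (Seed Z M H) :=
  (participantLaw M H.A).prod <|
    (Measure.pi (fun _ : Fin M => coinLaw H.p)).prod <|
      (Measure.pi (fun i => P.data.batchLaw i H.b)).prod
        (Measure.pi (fun i => Measure.pi (fun _ : Fin H.K => P.data.batchLaw i H.b')))

/-- The local updates of a miner `i` that starts at the model `x` with direction `g`:
`minerRun … k B` is the triple `(x^{k-1}, x^k, g^k)` after `k` updates with small batches `B`,
where `x^{-1} = x^0 = x`, `g^0 = g`,
`g^{k+1} = g^k - ∇ f_i(x^{k-1}, B_k) + ∇ f_i(x^k, B_k)` and `x^{k+1} = x^k - ηl g^{k+1}`. -/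
def minerRun (ηl : ℝ) (i : Fin M) (x g : Vec d) {s : ℕ} :
    (k : ℕ) → (Fin k → Fin s → Z) → Vec d × Vec d × Vec d
  | 0, _ => (x, x, g)
  | k + 1, B =>
      let r := minerRun ηl i x g k (fun j => B j.castSucc)
      let g' := r.2.2 - P.batchGrad i (B (Fin.last k)) r.1
        + P.batchGrad i (B (Fin.last k)) r.2.1
      (r.2.1, r.2.1 - ηl • g', g')

/-- One round of the algorithm. -/
def step (st : State d M) (w : Seed Z M H) : State d M :=
  let x := st.1
  let v := st.2.1
  let g : Vec d := (M : ℝ)⁻¹ • ∑ i, v i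
  let anchors := Finset.univ.filter (fun i => w.1 i = true ∧ w.2.1 i = true)
  let miners := Finset.univ.filter (fun i => w.1 i = true ∧ w.2.1 i = false)
  let v' : Fin M → Vec d := fun i =>
    if w.1 i = true ∧ w.2.1 i = true then P.batchGrad i (w.2.2.1 i) x else v i
  let Δ : Fin M → Vec d := fun i => x - (minerRun P H.ηl i x g H.K (w.2.2.2 i)).2.1
  let x' : Vec d :=
    if miners.card = 0 then x else x - H.ηs • ((miners.card : ℝ)⁻¹ • ∑ i ∈ miners, Δ i)
  (x', v', st.2.2 + anchors.card * H.b + miners.card * (H.K * H.b'))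

/-- The initial state for the initial large batches `B`: `v_0^(i) = ∇ f_i(x_0, B_i)`. -/
def initState (x₀ : Vec d) (B : Fin M → Fin H.b → Z) : State d M :=
  (x₀, fun i => P.batchGrad i (B i) x₀, M * H.b)

/-- The law of the state after `t` rounds, started at the model `x₀`. Each round uses fresh
randomness, independent of the past. -/
def law (x₀ : Vec d) : ℕ → Measure (State d M)
  | 0 => (Measure.pi (fun i => P.data.batchLaw i H.b)).map (initState P H x₀)
  | t + 1 => ((law x₀ t).prod (seedLaw P H)).map (fun q => step P H q.1 q.2)

/-- The expected squared gradient norm `E ‖∇ F(x_t)‖²`. -/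
def gradSq (x₀ : Vec d) (t : ℕ) : ℝ≥0∞ :=
  ∫⁻ st, ‖∇ P.obj st.1‖ₑ ^ 2 ∂(law P H x₀ t)

end Algorithm

/-- The parameters of the constant probability setting: `p = (1/c) (2/(A+2))^{1/A}`, `b' = 1`,
`ηl = 1/(2√6 K L)`, `ηs = 2√6 A/(A + 3 M c)`. -/
def constantParams (M A K b : ℕ) (c L : ℝ) : Params where
  A := A
  K := K
  b := b
  b' := 1
  p := 1 / c * (2 / ((A : ℝ) + 2)) ^ (1 / (A : ℝ))
  ηl := 1 / (2 * √6 * K * L)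
  ηs := 2 * √6 * A / (A + 3 * M * c)

end FedAMD

end

/-! Write `γ` for the effective step size `ηs K ηl`, `g` for the mean of the cached gradients, `h`
for `∇F(x_t)`, `q = pA/M` for the probability that a given client is an anchor, and `m = 1 - p^A`
for the probability that there is a miner. Let `y_i` be the model at which client `i` last refreshed
its cache, and `S` a bound for the variance of a large-batch gradient. The proof is a one-step
decrease of the potential `F(x) - F_* + ν‖g‖² + μ·(mean of ‖x - y_i‖²)`; the term in `g` is what
pays for the local drift of the miners.

Miners (`expLE_minerRun`): up to a martingale, the direction of miner `i` after `k` updates is `g +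
∇F_i(x^{k-1}) - ∇F_i(x_t)`. The local step size keeps the drift and the martingale below a small
multiple of `‖g‖²`, so no bound on the heterogeneity of the clients is needed. The averaged
direction `u` thus costs at most `7/16‖g‖² + 3/5‖g - h‖²` in the descent inequality.

Anchors (`expLE_potential`): the expected change of `‖g‖²` has main term `2q⟨g, h - g⟩ = q(‖h‖² -
‖g‖² - ‖g - h‖²)`. With `νq = 7/16 mγ` it cancels the miners' `‖g‖²` exactly and leaves `7/16 - 1/2
= -1/16` of `mγ‖h‖²`. What remains is `‖g - h‖²` and the individual cache errors; both are at most
staleness times `L²` plus the sampling errors `v_i - ∇F_i(y_i)`. The anchors shrink the staleness by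
the factor `1 - q/2(1 + q)` after Young's inequality, and `μ` is chosen so that this gain balances
the staleness terms (`potential_bound`).

Sampling errors (`expLE_augLaw_cacheError`): although the caches become dependent, both `E‖Σ e_i‖²`
and `E Σ‖e_i‖²` stay at most `M S` forever. Each round therefore adds only `O(mγ S/M)` to the
potential.

Parameters (`exists_rates`): the prescribed `p` gives `cp ≥ 2/3` and `p^A ≤ 2/3`. The first makes
the step size small against `q`, so that the staleness created by a step is paid for by the descent
term; the second keeps `m ≥ 1/3`. Telescoping then gives an average of `E‖∇F(x_t)‖²` of order
`M/(AT)` plus a multiple of `S/M`. Here `S = 0` if `b = n`, and otherwise `S/M ≤ ε/θ`. -/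

namespace FedAMD

/-! ### Upper bounds for expectations and centred noise -/

section ExpectationBounds

variable {Ω Ω' : Type*} [MeasurableSpace Ω] [MeasurableSpace Ω'] {μ : Measure Ω} {ν : Measure Ω'}

/-- The expectation of the nonnegative function `f` exists and is at most `c`. -/
def ExpLE (μ : Measure Ω) (f : Ω → ℝ) (c : ℝ) : Prop :=
  ∫⁻ ω, ENNReal.ofReal (f ω) ∂μ ≤ ENNReal.ofReal c

namespace ExpLE

variable {f g : Ω → ℝ} {a b c k : ℝ}

theorem mono (hg : ExpLE μ g a) (hfg : ∀ ω, f ω ≤ g ω) (hab : a ≤ b) : ExpLE μ f b :=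
  (lintegral_mono fun ω => ENNReal.ofReal_le_ofReal (hfg ω)).trans
    (hg.trans (ENNReal.ofReal_le_ofReal hab))

theorem mono_ae (hg : ExpLE μ g a) (hfg : ∀ᵐ ω ∂μ, f ω ≤ g ω) : ExpLE μ f a :=
  (lintegral_mono_ae (hfg.mono fun _ h => ENNReal.ofReal_le_ofReal h)).trans hg

theorem const [IsProbabilityMeasure μ] (c : ℝ) : ExpLE μ (fun _ => c) c := by
  simp [ExpLE]

theorem add (hf : ExpLE μ f a) (hg : ExpLE μ g b) (hm : Measurable f) (ha : 0 ≤ a) (hb : 0 ≤ b) :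
    ExpLE μ (fun ω => f ω + g ω) (a + b) := by
  calc ∫⁻ ω, ENNReal.ofReal (f ω + g ω) ∂μ
      ≤ ∫⁻ ω, ENNReal.ofReal (f ω) + ENNReal.ofReal (g ω) ∂μ :=
        lintegral_mono fun ω => ENNReal.ofReal_add_le
    _ = ∫⁻ ω, ENNReal.ofReal (f ω) ∂μ + ∫⁻ ω, ENNReal.ofReal (g ω) ∂μ :=
        lintegral_add_left hm.ennreal_ofReal _
    _ ≤ ENNReal.ofReal a + ENNReal.ofReal b := add_le_add hf hg
    _ = ENNReal.ofReal (a + b) := (ENNReal.ofReal_add ha hb).symm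

theorem const_mul (hf : ExpLE μ f a) (hk : 0 ≤ k) : ExpLE μ (fun ω => k * f ω) (k * a) := by
  simp only [ExpLE, ENNReal.ofReal_mul hk]
  rw [lintegral_const_mul' _ _ ENNReal.ofReal_ne_top]
  gcongr
  exact hf

theorem sum {ι : Type*} (s : Finset ι) {f : ι → Ω → ℝ} {a : ι → ℝ}
    (hf : ∀ i ∈ s, ExpLE μ (f i) (a i)) (hm : ∀ i, Measurable (f i)) (ha : ∀ i, 0 ≤ a i) :
    ExpLE μ (fun ω => ∑ i ∈ s, f i ω) (∑ i ∈ s, a i) := by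
  classical
  induction s using Finset.induction_on with
  | empty => simp [ExpLE]
  | insert j s hj ih =>
    simp only [Finset.sum_insert hj]
    exact (hf j (Finset.mem_insert_self _ _)).add
      (ih fun i hi => hf i (Finset.mem_insert_of_mem hi)) (hm j) (ha j)
      (Finset.sum_nonneg fun i _ => ha i)

theorem prod [SFinite ν] {f : Ω × Ω' → ℝ} {h : Ω → ℝ} (hm : Measurable f)
    (hf : ∀ x, ExpLE ν (fun y => f (x, y)) (h x)) (hh : ExpLE μ h c) :
    ExpLE (μ.prod ν) f c := by
  rw [ExpLE, lintegral_prod _ hm.ennreal_ofReal.aemeasurable]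
  exact (lintegral_mono hf).trans hh

theorem comp {T : Ω → Ω'} {f : Ω' → ℝ} (hT : MeasurePreserving T μ ν) (hf : Measurable f)
    (h : ExpLE ν f c) : ExpLE μ (fun ω => f (T ω)) c := by
  rw [ExpLE, ← hT.map_eq, lintegral_map hf.ennreal_ofReal hT.measurable] at h
  exact h

theorem of_comp {T : Ω → Ω'} {f : Ω' → ℝ} (hT : MeasurePreserving T μ ν) (hf : Measurable f)
    (h : ExpLE μ (fun ω => f (T ω)) c) : ExpLE ν f c := by
  rw [ExpLE, ← hT.map_eq, lintegral_map hf.ennreal_ofReal hT.measurable]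
  exact h

theorem map {T : Ω → Ω'} {f : Ω' → ℝ} (hT : Measurable T) (hf : Measurable f)
    (h : ExpLE μ (fun ω => f (T ω)) c) : ExpLE (μ.map T) f c := by
  rw [ExpLE, lintegral_map hf.ennreal_ofReal hT]
  exact h

theorem of_integral (hf : Integrable f μ) (h0 : ∀ ω, 0 ≤ f ω) (h : ∫ ω, f ω ∂μ ≤ c) :
    ExpLE μ f c := by
  rw [ExpLE, ← ofReal_integral_eq_lintegral_ofReal hf (Filter.Eventually.of_forall h0)]
  exact ENNReal.ofReal_le_ofReal h

theorem integrable (h : ExpLE μ f c) (hm : AEStronglyMeasurable f μ) (h0 : ∀ ω, 0 ≤ f ω) :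
    Integrable f μ := by
  refine ⟨hm, ?_⟩
  rw [hasFiniteIntegral_iff_ofReal (Filter.Eventually.of_forall h0)]
  exact h.trans_lt ENNReal.ofReal_lt_top

theorem integral_le (h : ExpLE μ f c) (hm : AEStronglyMeasurable f μ) (h0 : ∀ ω, 0 ≤ f ω)
    (hc : 0 ≤ c) : ∫ ω, f ω ∂μ ≤ c := by
  have hi := h.integrable hm h0
  rw [ExpLE, ← ofReal_integral_eq_lintegral_ofReal hi (Filter.Eventually.of_forall h0)] at h
  exact (ENNReal.ofReal_le_ofReal_iff hc).1 h

theorem of_lintegral_enorm {E : Type*} [NormedAddCommGroup E] {ξ : Ω → E}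
    (h : ∫⁻ ω, ‖ξ ω‖ₑ ^ 2 ∂μ ≤ ENNReal.ofReal c) : ExpLE μ (fun ω => ‖ξ ω‖ ^ 2) c := by
  refine le_of_eq_of_le (lintegral_congr fun ω => ?_) h
  rw [ENNReal.ofReal_pow (norm_nonneg _), ofReal_norm]

end ExpLE

variable {E : Type*} [NormedAddCommGroup E] [InnerProductSpace ℝ E] [MeasurableSpace E]
  [BorelSpace E]

/-- A centred random vector with second moment at most `V`. -/
structure IsNoise (μ : Measure Ω) (ξ : Ω → E) (V : ℝ) : Prop where
  measurable : Measurable ξ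
  integral_eq_zero : ∫ ω, ξ ω ∂μ = 0
  expLE : ExpLE μ (fun ω => ‖ξ ω‖ ^ 2) V
  nonneg : 0 ≤ V

namespace IsNoise

variable {ξ : Ω → E} {V : ℝ}

theorem smul [IsProbabilityMeasure μ] (h : IsNoise μ ξ V) (a : ℝ) :
    IsNoise μ (fun ω => a • ξ ω) (a ^ 2 * V) where
  measurable := h.measurable.const_smul a
  integral_eq_zero := by rw [integral_smul, h.integral_eq_zero, smul_zero]
  expLE := by
    simpa [norm_smul, mul_pow] using h.expLE.const_mul (sq_nonneg a)
  nonneg := mul_nonneg (sq_nonneg a) h.nonneg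

variable [SecondCountableTopology E]

theorem integrable [IsProbabilityMeasure μ] (h : IsNoise μ ξ V) : Integrable ξ μ := by
  have h2 : Integrable (fun ω => ‖ξ ω‖ ^ 2) μ :=
    h.expLE.integrable (h.measurable.norm.pow_const 2).aestronglyMeasurable fun ω => sq_nonneg _
  exact ((memLp_two_iff_integrable_sq_norm h.measurable.aestronglyMeasurable).2 h2).integrable
    one_le_two

variable [CompleteSpace E]

/-- The cross term `2⟨c, ξ⟩` integrates to zero because the noise is centred. -/
theorem expLE_norm_add_sq [IsProbabilityMeasure μ] (h : IsNoise μ ξ V) (c : E) :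
    ExpLE μ (fun ω => ‖c + ξ ω‖ ^ 2) (‖c‖ ^ 2 + V) := by
  have h2 : Integrable (fun ω => ‖ξ ω‖ ^ 2) μ :=
    h.expLE.integrable (h.measurable.norm.pow_const 2).aestronglyMeasurable fun ω => sq_nonneg _
  have hin : Integrable (fun ω => 2 * inner ℝ c (ξ ω)) μ := (h.integrable.const_inner c).const_mul 2
  have hc : Integrable (fun _ : Ω => ‖c‖ ^ 2) μ := integrable_const _
  have heq : (fun ω => ‖c + ξ ω‖ ^ 2) = fun ω => (‖c‖ ^ 2 + 2 * inner ℝ c (ξ ω)) + ‖ξ ω‖ ^ 2 :=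
    funext fun ω => norm_add_sq_real c (ξ ω)
  refine ExpLE.of_integral ?_ (fun ω => sq_nonneg _) ?_
  · rw [heq]
    exact (hc.add hin).add h2
  · have hci : Integrable (fun ω => ‖c‖ ^ 2 + 2 * inner ℝ c (ξ ω)) μ := hc.add hin
    rw [heq, integral_add hci h2, integral_add hc hin, integral_const_mul,
      integral_inner h.integrable, h.integral_eq_zero, inner_zero_right]
    have := h.expLE.integral_le (h.measurable.norm.pow_const 2).aestronglyMeasurable
      (fun ω => sq_nonneg _) h.nonneg
    simpa using this

/-- Independent centred errors add their variances. The coordinates are integrated out one at a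
time, and the arbitrary shift `c` absorbs the one held fixed, so the induction has to quantify over
`c`. -/
theorem expLE_norm_add_sum_sq {n : ℕ} {μ : Fin n → Measure Ω} [∀ i, IsProbabilityMeasure (μ i)]
    {ξ : Fin n → Ω → E} {V : Fin n → ℝ} (h : ∀ i, IsNoise (μ i) (ξ i) (V i)) (c : E) :
    ExpLE (Measure.pi μ) (fun ω => ‖c + ∑ i, ξ i (ω i)‖ ^ 2) (‖c‖ ^ 2 + ∑ i, V i) := by
  induction n generalizing c with
  | zero => simpa using ExpLE.const (μ := Measure.pi μ) (‖c‖ ^ 2)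
  | succ n ih =>
    have hm := measurePreserving_piFinSuccAbove μ 0
    let f : Ω × (Fin n → Ω) → ℝ := fun q => ‖(c + ξ 0 q.1) + ∑ i : Fin n, ξ i.succ (q.2 i)‖ ^ 2
    have hf : Measurable f := by
      refine Measurable.pow_const (Measurable.norm (Measurable.add (measurable_const.add
        ((h 0).measurable.comp measurable_fst)) (Finset.measurable_sum _ fun i _ => ?_))) 2
      exact (h i.succ).measurable.comp ((measurable_pi_apply i).comp measurable_snd)
    have key : ExpLE ((μ 0).prod (Measure.pi fun j : Fin n => μ ((0 : Fin (n + 1)).succAbove j)))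
        f (‖c‖ ^ 2 + ∑ i, V i) := by
      refine ExpLE.prod (h := fun x => ‖c + ξ 0 x‖ ^ 2 + ∑ i : Fin n, V i.succ) hf
        (fun x => ih (fun i => h i.succ) _) ?_
      rw [Fin.sum_univ_succ, ← add_assoc]
      refine ((h 0).expLE_norm_add_sq c).add (ExpLE.const _) ?_
        (add_nonneg (sq_nonneg _) (h 0).nonneg) (Finset.sum_nonneg fun i _ => (h i.succ).nonneg)
      exact ((measurable_const.add (h 0).measurable).norm).pow_const 2
    refine (key.comp hm hf).mono (fun ω => le_of_eq ?_) le_rfl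
    simp only [f, Fin.sum_univ_succ, MeasurableEquiv.piFinSuccAbove_apply, add_assoc]
    rfl

end IsNoise

/-- Expand `r(‖x‖ - s‖y‖)² ≥ 0`. The weights are kept free because the numerical margins of the
analysis depend on them. -/
theorem norm_add_sq_le_young {E : Type*} [NormedAddCommGroup E] {r s : ℝ} (hr : 0 < r)
    (hrs : r * s = 1) (x y : E) : ‖x + y‖ ^ 2 ≤ (1 + r) * ‖x‖ ^ 2 + (1 + s) * ‖y‖ ^ 2 := by
  have h1 : ‖x + y‖ ^ 2 ≤ (‖x‖ + ‖y‖) ^ 2 := by gcongr; exact norm_add_le _ _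
  have h2 : 0 ≤ r * (‖x‖ - s * ‖y‖) ^ 2 := by positivity
  have h3 : r * (‖x‖ - s * ‖y‖) ^ 2
      = r * ‖x‖ ^ 2 - 2 * (r * s) * (‖x‖ * ‖y‖) + (r * s) * s * ‖y‖ ^ 2 := by ring
  rw [h3, hrs] at h2
  nlinarith

theorem norm_sum_smul_sq_le {E ι : Type*} [NormedAddCommGroup E] [NormedSpace ℝ E]
    (s : Finset ι) (hs : s.Nonempty) (u : ι → E) :
    ‖(s.card : ℝ)⁻¹ • ∑ i ∈ s, u i‖ ^ 2 ≤ (s.card : ℝ)⁻¹ * ∑ i ∈ s, ‖u i‖ ^ 2 := by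
  have hc : (0 : ℝ) < s.card := by exact_mod_cast hs.card_pos
  have h1 : ‖∑ i ∈ s, u i‖ ^ 2 ≤ s.card * ∑ i ∈ s, ‖u i‖ ^ 2 :=
    (by gcongr; exact norm_sum_le _ _ : ‖∑ i ∈ s, u i‖ ^ 2 ≤ (∑ i ∈ s, ‖u i‖) ^ 2).trans
      sq_sum_le_card_mul_sum_sq
  rw [norm_smul, mul_pow, norm_inv, Real.norm_natCast]
  calc (s.card : ℝ)⁻¹ ^ 2 * ‖∑ i ∈ s, u i‖ ^ 2
      ≤ (s.card : ℝ)⁻¹ ^ 2 * (s.card * ∑ i ∈ s, ‖u i‖ ^ 2) := by gcongr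
    _ = (s.card : ℝ)⁻¹ * ∑ i ∈ s, ‖u i‖ ^ 2 := by field_simp

end ExpectationBounds

/-! ### Smooth functions and differentiation under the integral -/

section SmoothCalculus

variable {d : ℕ}

theorem gradient_const_mul_sum {ι : Type*} (s : Finset ι) {f : ι → Vec d → ℝ}
    (hf : ∀ i, Differentiable ℝ (f i)) (a : ℝ) (x : Vec d) :
    ∇ (fun y => a * ∑ i ∈ s, f i y) x = a • ∑ i ∈ s, ∇ (f i) x := by
  have h1 : HasFDerivAt (fun y => a * ∑ i ∈ s, f i y) (a • ∑ i ∈ s, fderiv ℝ (f i) x) x :=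
    (HasFDerivAt.fun_sum fun i _ => (hf i x).hasFDerivAt).const_mul a
  rw [gradient, h1.fderiv]
  simp [gradient, map_sum]

theorem hasDerivAt_comp_line {f : Vec d → ℝ} (hf : Differentiable ℝ f) (x u : Vec d) (s : ℝ) :
    HasDerivAt (fun s : ℝ => f (x + s • u)) (inner ℝ (∇ f (x + s • u)) u) s := by
  have h1 : HasDerivAt (fun s : ℝ => x + s • u) u s := by
    simpa using ((hasDerivAt_id s).smul_const u).const_add x
  have h2 := ((hf (x + s • u)).hasGradientAt.hasFDerivAt).comp_hasDerivAt s h1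
  exact h2

theorem continuous_gradient_of_lipschitz {f : Vec d → ℝ} {L : ℝ}
    (hL : ∀ v w, ‖∇ f v - ∇ f w‖ ≤ L * ‖v - w‖) : Continuous (∇ f) := by
  refine (LipschitzWith.of_dist_le_mul (K := L.toNNReal) fun v w => ?_).continuous
  rw [dist_eq_norm, dist_eq_norm]
  exact (hL v w).trans (by gcongr; exact Real.le_coe_toNNReal L)

/-- Along the segment, `f` minus its quadratic upper model has nonpositive derivative by the
Lipschitz bound, so it is antitone on `[0, 1]`. -/
theorem le_add_inner_add_norm_sq {f : Vec d → ℝ} {L : ℝ} (hf : Differentiable ℝ f)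
    (hL : ∀ v w, ‖∇ f v - ∇ f w‖ ≤ L * ‖v - w‖) (x u : Vec d) :
    f (x + u) ≤ f x + inner ℝ (∇ f x) u + L / 2 * ‖u‖ ^ 2 := by
  let ψ : ℝ → ℝ := fun s => f (x + s • u) - s * inner ℝ (∇ f x) u - L / 2 * ‖u‖ ^ 2 * s ^ 2
  have hψ : ∀ s, HasDerivAt ψ (inner ℝ (∇ f (x + s • u)) u - inner ℝ (∇ f x) u
      - L / 2 * ‖u‖ ^ 2 * (2 * s)) s := fun s => by
    have h1 := hasDerivAt_comp_line hf x u s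
    have h2 := (hasDerivAt_id s).mul_const (inner ℝ (∇ f x) u)
    have h3 := (hasDerivAt_pow 2 s).const_mul (L / 2 * ‖u‖ ^ 2)
    have h4 := (h1.fun_sub h2).fun_sub h3
    simpa only [Nat.cast_ofNat, one_mul, Nat.add_one_sub_one, pow_one, id] using h4
  have hanti : AntitoneOn ψ (Set.Icc 0 1) := by
    refine antitoneOn_of_deriv_nonpos (convex_Icc 0 1)
      (fun s _ => (hψ s).continuousAt.continuousWithinAt)
      (fun s _ => (hψ s).differentiableAt.differentiableWithinAt) fun s hs => ?_
    rw [interior_Icc] at hs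
    rw [(hψ s).deriv, ← inner_sub_left]
    have h1 := real_inner_le_norm (∇ f (x + s • u) - ∇ f x) u
    have h2 := hL (x + s • u) x
    rw [add_sub_cancel_left, norm_smul, Real.norm_of_nonneg hs.1.le] at h2
    nlinarith [norm_nonneg u]
  have h := hanti (Set.left_mem_Icc.2 zero_le_one) (Set.right_mem_Icc.2 zero_le_one) zero_le_one
  simp only [ψ, one_smul, zero_smul, add_zero, one_mul, zero_mul, one_pow, mul_one] at h
  norm_num at h
  have h5 : inner ℝ (∇ f x) u = (fderiv ℝ f x) u := by simp
  linarith

/-- A gradient step of length `1/L` cannot go below the lower bound `c`. This bounds the initial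
gradient and keeps the potential nonnegative after the gradient term is subtracted. -/
theorem norm_gradient_sq_le {f : Vec d → ℝ} {L c : ℝ} (hLpos : 0 < L) (hf : Differentiable ℝ f)
    (hL : ∀ v w, ‖∇ f v - ∇ f w‖ ≤ L * ‖v - w‖) (hc : ∀ x, c ≤ f x) (x : Vec d) :
    ‖∇ f x‖ ^ 2 ≤ 2 * L * (f x - c) := by
  have h := (hc _).trans (le_add_inner_add_norm_sq hf hL x (-(L⁻¹ • ∇ f x)))
  rw [inner_neg_right, real_inner_smul_right, real_inner_self_eq_norm_sq, norm_neg, norm_smul,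
    mul_pow, Real.norm_of_nonneg (inv_nonneg.2 hLpos.le)] at h
  have h2 : L / 2 * (L⁻¹ ^ 2 * ‖∇ f x‖ ^ 2) = L⁻¹ / 2 * ‖∇ f x‖ ^ 2 := by field_simp
  rw [h2] at h
  have h3 : L⁻¹ / 2 * ‖∇ f x‖ ^ 2 ≤ f x - c := by linarith
  calc ‖∇ f x‖ ^ 2 = 2 * L * (L⁻¹ / 2 * ‖∇ f x‖ ^ 2) := by field_simp
    _ ≤ 2 * L * (f x - c) := by gcongr

/-- Differentiation under the integral sign for a gradient field that is Lipschitz in mean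
square. -/
theorem integral_gradient_eq {Z : Type*} [MeasurableSpace Z] {μ : Measure Z}
    [IsProbabilityMeasure μ] {ℓ : Vec d → Z → ℝ} {L a C : ℝ}
    (hdiff : ∀ z, Differentiable ℝ fun x => ℓ x z) (hint : ∀ x, Integrable (ℓ x) μ)
    (hmeas : Measurable fun q : Vec d × Z => ∇ (fun y => ℓ y q.2) q.1)
    {F : Vec d → ℝ} (hFdef : ∀ x, F x = ∫ z, ℓ x z ∂μ) (hF : Differentiable ℝ F)
    (hL : ∀ v w, ‖∇ F v - ∇ F w‖ ≤ L * ‖v - w‖)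
    (hbound : ∀ x, ExpLE μ (fun z => ‖∇ (fun y => ℓ y z) x - ∇ F x‖ ^ 2) a) (ha : 0 ≤ a)
    (hlip : ∀ v w, ExpLE μ (fun z => ‖(∇ (fun y => ℓ y z) v - ∇ (fun y => ℓ y z) w)
      - (∇ F v - ∇ F w)‖ ^ 2) (C ^ 2 * ‖v - w‖ ^ 2)) (x : Vec d) :
    Integrable (fun z => ∇ (fun y => ℓ y z) x) μ ∧ ∫ z, ∇ (fun y => ℓ y z) x ∂μ = ∇ F x := by
  set G : Vec d → Z → Vec d := fun x z => ∇ (fun y => ℓ y z) x with hG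
  have hGm : ∀ x, Measurable (G x) := fun x => hmeas.comp measurable_prodMk_left
  have hcont := continuous_gradient_of_lipschitz hL
  have hL2 : ∀ x, MemLp (fun z => G x z - ∇ F x) 2 μ := fun x => by
    have hm : Measurable fun z => G x z - ∇ F x := (hGm x).sub_const _
    refine (memLp_two_iff_integrable_sq_norm hm.aestronglyMeasurable).2 ?_
    exact (hbound x).integrable (hm.norm.pow_const 2).aestronglyMeasurable fun _ => sq_nonneg _
  have hI0 : ∀ x, Integrable (fun z => G x z - ∇ F x) μ := fun x =>
    (hL2 x).integrable one_le_two
  have hI : ∀ x, Integrable (G x) μ := fun x => by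
    have h := (hI0 x).add (integrable_const (∇ F x))
    exact h.congr (Filter.Eventually.of_forall fun z => sub_add_cancel _ _)
  refine ⟨hI x, ?_⟩
  -- the mean of the gradients is continuous
  have hmcont : Continuous fun x => ∫ z, G x z ∂μ := by
    have hD : Continuous fun x => ∫ z, (G x z - ∇ F x) ∂μ := by
      refine (LipschitzWith.of_dist_le_mul (K := C.nnabs) fun v w => ?_).continuous
      rw [dist_eq_norm, dist_eq_norm, ← integral_sub (hI0 v) (hI0 w), Real.coe_nnabs]
      have hsub : MemLp (fun z => (G v z - ∇ F v) - (G w z - ∇ F w)) 2 μ := (hL2 v).sub (hL2 w)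
      have h1 := (hlip v w).integral_le (f := fun z => ‖(G v z - G w z) - (∇ F v - ∇ F w)‖ ^ 2)
        ((((hGm v).sub (hGm w)).sub_const _).norm.pow_const 2).aestronglyMeasurable
        (fun _ => sq_nonneg _) (by positivity)
      -- Jensen's inequality, read off from the nonnegativity of the variance.
      have h2 : (∫ z, ‖(G v z - ∇ F v) - (G w z - ∇ F w)‖ ∂μ) ^ 2
          ≤ ∫ z, ‖(G v z - ∇ F v) - (G w z - ∇ F w)‖ ^ 2 ∂μ := by
        have hv := variance_nonneg (fun z => ‖(G v z - ∇ F v) - (G w z - ∇ F w)‖) μ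
        rw [variance_eq_sub hsub.norm] at hv
        simpa using hv
      refine (norm_integral_le_integral_norm _).trans ?_
      refine abs_le_of_sq_le_sq' ?_ (by positivity) |>.2
      refine h2.trans (le_trans (le_of_eq ?_) (h1.trans (le_of_eq ?_)))
      · congr 1 with z
        congr 2
        abel
      · rw [mul_pow, sq_abs]
    have heq : (fun x => ∫ z, G x z ∂μ) = fun x => ∫ z, (G x z - ∇ F x) ∂μ + ∇ F x := by
      funext x
      rw [integral_sub (hI x) (integrable_const _)]
      simp
    rw [heq]
    exact hD.add hcont
  -- No dominating function is available. Instead the loss is written along a ray as the integral of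
  -- its derivative, and Fubini moves the expectation inside; the continuity of the mean gradient
  -- then allows differentiation at the start of the ray.
  refine ext_inner_right ℝ fun u => ?_
  let g : ℝ → Z → ℝ := fun s z => inner ℝ (G (x + s • u) z) u
  have hgm : Measurable (Function.uncurry g) := by
    have h1 : Measurable fun q : ℝ × Z => (x + q.1 • u, q.2) := by fun_prop
    exact (hmeas.comp h1).inner measurable_const
  have hprod : ∀ t : ℝ, 0 ≤ t →
      Integrable (Function.uncurry g) ((volume.restrict (Set.Ioc 0 t)).prod μ) := fun t ht => by
    refine ⟨hgm.aestronglyMeasurable, ?_⟩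
    let b : ℝ := ‖u‖ * (a + (1 + ‖∇ F x‖ + |L| * (t * ‖u‖)))
    have hb : 0 ≤ b := by positivity
    have hin : ∀ s ∈ Set.Ioc 0 t, ExpLE μ (fun z => ‖g s z‖) b := fun s hs => by
      have h1 := ((hbound (x + s • u)).add (ExpLE.const (1 + ‖∇ F x‖ + |L| * (t * ‖u‖)))
        ((((hGm _).sub_const _).norm.pow_const 2)) ha (by positivity)).const_mul (norm_nonneg u)
      refine h1.mono (fun z => ?_) le_rfl
      have h2 := norm_inner_le_norm (𝕜 := ℝ) (G (x + s • u) z) u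
      have h3 : ‖G (x + s • u) z‖ ≤ ‖G (x + s • u) z - ∇ F (x + s • u)‖
          + (‖∇ F (x + s • u) - ∇ F x‖ + ‖∇ F x‖) := by
        have h5 := norm_add_le (G (x + s • u) z - ∇ F (x + s • u)) (∇ F (x + s • u))
        have h6 := norm_add_le (∇ F (x + s • u) - ∇ F x) (∇ F x)
        rw [sub_add_cancel] at h5 h6
        linarith
      have h4 := hL (x + s • u) x
      rw [add_sub_cancel_left, norm_smul, Real.norm_of_nonneg hs.1.le] at h4
      have h7 : L * (s * ‖u‖) ≤ |L| * (t * ‖u‖) := by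
        gcongr
        · exact mul_nonneg hs.1.le (norm_nonneg _)
        · exact le_abs_self L
        · exact hs.2
      have h8 : ‖G (x + s • u) z - ∇ F (x + s • u)‖
          ≤ ‖G (x + s • u) z - ∇ F (x + s • u)‖ ^ 2 + 1 := by
        nlinarith [sq_nonneg (‖G (x + s • u) z - ∇ F (x + s • u)‖ - 1 / 2)]
      have h9 : ‖G (x + s • u) z‖ ≤ ‖G (x + s • u) z - ∇ F (x + s • u)‖ ^ 2
          + (1 + ‖∇ F x‖ + |L| * (t * ‖u‖)) := by linarith
      calc ‖g s z‖ ≤ ‖G (x + s • u) z‖ * ‖u‖ := h2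
        _ = ‖u‖ * ‖G (x + s • u) z‖ := mul_comm _ _
        _ ≤ _ := by gcongr
    rw [hasFiniteIntegral_iff_norm, lintegral_prod _ hgm.norm.ennreal_ofReal.aemeasurable]
    refine lt_of_le_of_lt (setLIntegral_mono (g := fun _ => ENNReal.ofReal b) measurable_const
      fun s hs => hin s hs) ?_
    rw [setLIntegral_const]
    exact ENNReal.mul_lt_top ENNReal.ofReal_lt_top (by simp)
  have hFTC : ∀ t ∈ Set.Ici (0 : ℝ), F (x + t • u)
      = F x + ∫ s in (0 : ℝ)..t, inner ℝ (∫ z, G (x + s • u) z ∂μ) u := fun t ht => by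
    have ht : 0 ≤ t := ht
    have h1 : F (x + t • u) - F x = ∫ z, (ℓ (x + t • u) z - ℓ x z) ∂μ := by
      rw [hFdef, hFdef, integral_sub (hint _) (hint _)]
    have h2 : ∀ᵐ z ∂μ, ℓ (x + t • u) z - ℓ x z = ∫ s in Set.Ioc 0 t, g s z := by
      filter_upwards [(hprod t ht).prod_left_ae] with z hz
      have hz' : IntervalIntegrable (fun s => g s z) volume 0 t :=
        (intervalIntegrable_iff_integrableOn_Ioc_of_le ht).2 hz
      have h3 := intervalIntegral.integral_eq_sub_of_hasDerivAt
        (fun s _ => hasDerivAt_comp_line (hdiff z) x u s) hz'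
      rw [intervalIntegral.integral_of_le ht] at h3
      rw [zero_smul, add_zero] at h3
      exact h3.symm
    have h4 : F (x + t • u) - F x = ∫ s in (0 : ℝ)..t, inner ℝ (∫ z, G (x + s • u) z ∂μ) u := by
      rw [h1, integral_congr_ae h2, integral_integral_swap (f := fun z s => g s z)
        (hprod t ht).swap,
        intervalIntegral.integral_of_le ht]
      refine integral_congr_ae (Filter.Eventually.of_forall fun s => ?_)
      simp only [g]
      rw [real_inner_comm, ← integral_inner (hI _)]
      simp_rw [real_inner_comm]
    linarith
  have hcts : Continuous fun s : ℝ => inner ℝ (∫ z, G (x + s • u) z ∂μ) u :=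
    (hmcont.comp (by fun_prop : Continuous fun s : ℝ => x + s • u)).inner continuous_const
  -- The integral identity is known for `t ≥ 0` only, so right derivatives at `0` are compared.
  have hd1 := (hasDerivAt_comp_line hF x u 0).hasDerivWithinAt (s := Set.Ici 0)
  have hd2 := ((hcts.integral_hasStrictDerivAt 0 0).hasDerivAt.const_add
    (F x)).hasDerivWithinAt (s := Set.Ici 0)
  have hd3 := hd2.congr hFTC (hFTC 0 Set.self_mem_Ici)
  have := (uniqueDiffWithinAt_Ici (0 : ℝ)).eq_deriv _ hd3 hd1
  simpa using this

end SmoothCalculus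

/-! ### Symmetries of uniform laws on finite sets -/

section UniformLaws

variable {Ω : Type*} [Finite Ω] [MeasurableSpace Ω] [MeasurableSingletonClass Ω]

theorem measurePreserving_uniformOn (e : Ω ≃ Ω) {S : Set Ω} (hS : e ⁻¹' S = S) :
    MeasurePreserving e (uniformOn S) (uniformOn S) := by
  refine ⟨measurable_of_countable _, Measure.ext fun T hT => ?_⟩
  rw [Measure.map_apply (measurable_of_countable _) hT, uniformOn,
    cond_apply S.toFinite.measurableSet,
    cond_apply S.toFinite.measurableSet]
  congr 1
  conv_lhs => rw [← hS, ← Set.preimage_inter, ← e.image_symm_eq_preimage]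
  exact Measure.count_injective_image e.symm.injective _

theorem measurePreserving_eval_uniformOn_injective {s n : ℕ} (hs : s ≤ n) (r : Fin s) :
    MeasurePreserving (fun j : Fin s → Fin n => j r)
      (uniformOn {j : Fin s → Fin n | Function.Injective j}) (uniformOn Set.univ) := by
  have hn : 0 < n := lt_of_lt_of_le r.pos hs
  have : Nonempty (Fin n) := ⟨⟨0, hn⟩⟩
  have : IsProbabilityMeasure (uniformOn {j : Fin s → Fin n | Function.Injective j}) :=
    isProbabilityMeasure_uniformOn (Set.toFinite _) ⟨Fin.castLE hs, Fin.castLE_injective hs⟩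
  have hmeas : Measurable fun j : Fin s → Fin n => j r := measurable_pi_apply r
  refine ⟨hmeas, ?_⟩
  set ρ := (uniformOn {j : Fin s → Fin n | Function.Injective j}).map fun j => j r with hρ
  have : IsProbabilityMeasure ρ := Measure.isProbabilityMeasure_map hmeas.aemeasurable
  -- Swapping two values permutes the injective maps, so all data points are equally likely in
  -- position `r`.
  have hinv : ∀ k l, ρ {k} = ρ {l} := fun k l => by
    let e : (Fin s → Fin n) ≃ (Fin s → Fin n) := Equiv.arrowCongr (Equiv.refl _) (Equiv.swap k l)
    have he := measurePreserving_uniformOn e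
      (S := {j : Fin s → Fin n | Function.Injective j}) (by
        ext j
        simp [e, Equiv.arrowCongr, Function.Injective])
    rw [hρ, Measure.map_apply hmeas (measurableSet_singleton _),
      Measure.map_apply hmeas (measurableSet_singleton _),
      ← he.measure_preimage (hmeas (measurableSet_singleton _)).nullMeasurableSet]
    congr 1
    ext j
    simp only [e, Equiv.arrowCongr, Set.mem_preimage, Set.mem_singleton_iff, Equiv.coe_fn_mk,
      Equiv.refl_symm, Equiv.coe_refl, Function.comp_apply, id]
    rw [Equiv.swap_apply_eq_iff, Equiv.swap_apply_left]
  refine Measure.ext_of_singleton fun k => ?_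
  have hsum : ∑ l, ρ {l} = 1 := by
    rw [sum_measure_singleton, Finset.coe_univ, measure_univ]
  rw [Finset.sum_congr rfl fun l _ => hinv l k, Finset.sum_const, Finset.card_univ,
    Fintype.card_fin, nsmul_eq_mul] at hsum
  rw [uniformOn_univ, Measure.count_singleton, Fintype.card_fin]
  rw [ENNReal.eq_div_iff (by exact_mod_cast hn.ne') (ENNReal.natCast_ne_top n)]
  exact hsum

end UniformLaws

/-! ### Marginals of the batch law -/

section Sampling

variable {Z : Type*} [MeasurableSpace Z] {M : ℕ} (D : LocalData Z M)

theorem LocalData.isProbabilityMeasure_batchLaw (i : Fin M) {s : ℕ} (hs : (s : ℕ∞) ≤ D.size) :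
    IsProbabilityMeasure (D.batchLaw i s) := by
  cases D with
  | online D => exact inferInstanceAs (IsProbabilityMeasure (Measure.pi _))
  | dataset n pts =>
    have hs : s ≤ n := by simpa [LocalData.size] using hs
    have : IsProbabilityMeasure (uniformOn {j : Fin s → Fin n | Function.Injective j}) :=
      isProbabilityMeasure_uniformOn (Set.toFinite _) ⟨Fin.castLE hs, Fin.castLE_injective hs⟩
    exact Measure.isProbabilityMeasure_map (measurable_of_countable _).aemeasurable

theorem LocalData.measurePreserving_batchLaw (i : Fin M) {s : ℕ} (hs : (s : ℕ∞) ≤ D.size)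
    (r : Fin s) :
    MeasurePreserving (fun B : Fin s → Z => B r) (D.batchLaw i s) (D.sampleLaw i) := by
  cases D with
  | online D => exact measurePreserving_eval (fun _ => (D i : Measure Z)) r
  | dataset n pts =>
    have hs : s ≤ n := by simpa [LocalData.size] using hs
    refine ⟨measurable_pi_apply r, ?_⟩
    simp only [LocalData.batchLaw, LocalData.sampleLaw]
    have h1 : Measurable fun (j : Fin s → Fin n) (r : Fin s) => pts i (j r) :=
      measurable_of_countable _
    rw [Measure.map_map (measurable_pi_apply r) h1,
      ← (measurePreserving_eval_uniformOn_injective hs r).map_eq]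
    exact (Measure.map_map (measurable_of_countable _) (measurable_pi_apply r)).symm

/-- A batch that exhausts the dataset is a rearrangement of it. -/
theorem LocalData.exists_ae_sum_batchLaw (i : Fin M) {s : ℕ} (hs : (s : ℕ∞) = D.size) :
    ∃ pts : Fin s → Z, ∀ (d : ℕ) (f : Z → Vec d), Measurable f →
      ∀ᵐ B ∂(D.batchLaw i s), ∑ r, f (B r) = ∑ r, f (pts r) := by
  cases D with
  | online D => simp [LocalData.size] at hs
  | dataset n pts =>
    have hsn : s = n := by simpa [LocalData.size] using hs
    subst hsn
    refine ⟨pts i, fun d f hf => ?_⟩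
    have hm : Measurable fun B : Fin s → Z => ∑ r, f (B r) :=
      Finset.measurable_sum _ fun r _ => hf.comp (measurable_pi_apply r)
    have h1 : Measurable fun (j : Fin s → Fin s) (r : Fin s) => pts i (j r) :=
      measurable_of_countable _
    rw [LocalData.batchLaw, ae_map_iff h1.aemeasurable (measurableSet_eq_fun hm measurable_const)]
    have hS : ∀ᵐ j ∂(uniformOn {j : Fin s → Fin s | Function.Injective j}),
        j ∈ {j : Fin s → Fin s | Function.Injective j} :=
      ae_cond_mem (Set.toFinite _).measurableSet
    filter_upwards [hS] with j hj
    exact (Finite.injective_iff_bijective.1 hj).sum_comp fun r => f (pts i r)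

end Sampling

/-! ### Unbiasedness and variance of batch gradients -/

namespace Problem

variable {Z : Type*} [MeasurableSpace Z] {d M : ℕ} {P : Problem Z d M} {L σ Lσ : ℝ}

theorem batchGrad_eq (hP : P.Regular) (i : Fin M) {s : ℕ} (B : Fin s → Z) (x : Vec d) :
    P.batchGrad i B x = (s : ℝ)⁻¹ • ∑ r, ∇ (fun y => P.loss i y (B r)) x :=
  gradient_const_mul_sum _ (fun r => hP.differentiable_loss i (B r)) _ x

theorem gradient_obj (hL : P.Smooth L) (x : Vec d) :
    ∇ P.obj x = (M : ℝ)⁻¹ • ∑ i, ∇ (P.localObj i) x :=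
  gradient_const_mul_sum _ (fun i => (hL i).1) _ x

theorem differentiable_obj (hL : P.Smooth L) : Differentiable ℝ P.obj :=
  (Differentiable.fun_sum fun i _ => (hL i).1).const_mul _

theorem norm_gradient_obj_sub_le (hL : P.Smooth L) (hL0 : 0 ≤ L) (v w : Vec d) :
    ‖∇ P.obj v - ∇ P.obj w‖ ≤ L * ‖v - w‖ := by
  rw [gradient_obj hL, gradient_obj hL, ← smul_sub, ← Finset.sum_sub_distrib, norm_smul, norm_inv,
    Real.norm_natCast]
  have h1 : ‖∑ i, (∇ (P.localObj i) v - ∇ (P.localObj i) w)‖ ≤ M * (L * ‖v - w‖) := by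
    refine (norm_sum_le_of_le _ fun i _ => (hL i).2 v w).trans (le_of_eq ?_)
    simp
  rcases Nat.eq_zero_or_pos M with hM | hM
  · subst hM
    simp
    positivity
  · have hM' : (0 : ℝ) < M := by exact_mod_cast hM
    calc (M : ℝ)⁻¹ * ‖∑ i, (∇ (P.localObj i) v - ∇ (P.localObj i) w)‖
        ≤ (M : ℝ)⁻¹ * (M * (L * ‖v - w‖)) := by gcongr
      _ = L * ‖v - w‖ := by field_simp

theorem measurable_gradient_localObj (hL : P.Smooth L) (i : Fin M) :
    Measurable (∇ (P.localObj i)) :=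
  (continuous_gradient_of_lipschitz (hL i).2).measurable

theorem measurable_gradient_obj (hL : P.Smooth L) (hL0 : 0 ≤ L) : Measurable (∇ P.obj) :=
  (continuous_gradient_of_lipschitz (norm_gradient_obj_sub_le hL hL0)).measurable

theorem measurable_batchGrad (hP : P.Regular) (i : Fin M) (s : ℕ) :
    Measurable fun q : Vec d × (Fin s → Z) => P.batchGrad i q.2 q.1 := by
  simp_rw [batchGrad_eq hP]
  have h : ∀ r : Fin s, Measurable fun q : Vec d × (Fin s → Z) =>
      ∇ (fun y => P.loss i y (q.2 r)) q.1 := fun r => (hP.measurable_grad i).comp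
    (measurable_fst.prodMk ((measurable_pi_apply r).comp measurable_snd))
  exact (Finset.measurable_sum Finset.univ fun r _ => h r).const_smul (s : ℝ)⁻¹

/-- Unbiasedness is not among the assumptions; it follows from the noise and smoothness bounds for
batches of size one by differentiation under the integral. -/
theorem integral_gradient_loss (hP : P.Regular) (hL : P.Smooth L) (hσ : P.BoundedNoise σ)
    (hLσ : P.AverageSmooth Lσ) (h1 : 1 ≤ P.data.size) (i : Fin M) (x : Vec d) :
    Integrable (fun z => ∇ (fun y => P.loss i y z) x) (P.data.sampleLaw i) ∧
      ∫ z, ∇ (fun y => P.loss i y z) x ∂(P.data.sampleLaw i) = ∇ (P.localObj i) x := by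
  have h1' : ((1 : ℕ) : ℕ∞) ≤ P.data.size := by exact_mod_cast h1
  have hmp := P.data.measurePreserving_batchLaw i h1' 0
  have := P.data.isProbabilityMeasure_batchLaw i h1'
  have : IsProbabilityMeasure (P.data.sampleLaw i) := by
    rw [← hmp.map_eq]
    exact Measure.isProbabilityMeasure_map hmp.measurable.aemeasurable
  have hgm : ∀ x, Measurable fun z => ∇ (fun y => P.loss i y z) x := fun x =>
    (hP.measurable_grad i).comp measurable_prodMk_left
  have hb : ∀ x (B : Fin 1 → Z),
      P.batchGrad i B x = ∇ (fun y => P.loss i y (B 0)) x := fun x B => by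
    rw [batchGrad_eq hP]
    simp
  refine integral_gradient_eq (a := σ ^ 2) (C := Lσ) (hP.differentiable_loss i)
    (hP.integrable_loss i) (hP.measurable_grad i) (F := P.localObj i)
    (fun _ => rfl) (hL i).1 (hL i).2 (fun x => ?_)
    (sq_nonneg σ) (fun v w => ?_) x
  · refine ExpLE.of_comp hmp (((hgm x).sub_const _).norm.pow_const 2) ?_
    have h := ExpLE.of_lintegral_enorm (hσ i 1 le_rfl h1' x)
    simpa only [hb, Nat.cast_one, div_one] using h
  · refine ExpLE.of_comp hmp ((((hgm v).sub (hgm w)).sub_const _).norm.pow_const 2) ?_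
    have h := ExpLE.of_lintegral_enorm (hLσ i 1 le_rfl h1' v w)
    simpa only [hb, Nat.cast_one, div_one] using h

/-- Linearity uses only the marginal law of each sample, so drawing with or without replacement
makes no difference here. -/
theorem integral_batchGrad (hP : P.Regular) (hL : P.Smooth L) (hσ : P.BoundedNoise σ)
    (hLσ : P.AverageSmooth Lσ) (i : Fin M) {s : ℕ} (hs : 1 ≤ s) (hsize : (s : ℕ∞) ≤ P.data.size)
    (x : Vec d) : Integrable (fun B : Fin s → Z => P.batchGrad i B x) (P.data.batchLaw i s) ∧
      ∫ B, P.batchGrad i B x ∂(P.data.batchLaw i s) = ∇ (P.localObj i) x := by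
  have h1 : 1 ≤ P.data.size := le_trans (by exact_mod_cast hs) hsize
  obtain ⟨hint, heq⟩ := integral_gradient_loss hP hL hσ hLσ h1 i x
  have hmp := fun r => P.data.measurePreserving_batchLaw i hsize r
  have hi : ∀ r : Fin s, Integrable (fun B : Fin s → Z => ∇ (fun y => P.loss i y (B r)) x)
      (P.data.batchLaw i s) := fun r => (hmp r).integrable_comp_of_integrable hint
  have hs0 : (s : ℝ) ≠ 0 := by exact_mod_cast (by omega : s ≠ 0)
  simp_rw [batchGrad_eq hP]
  refine ⟨(integrable_finsetSum Finset.univ fun r _ => hi r).smul (s : ℝ)⁻¹, ?_⟩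
  rw [integral_smul, integral_finsetSum _ fun r _ => hi r]
  have h2 : ∀ r : Fin s, ∫ B : Fin s → Z, ∇ (fun y => P.loss i y (B r)) x ∂(P.data.batchLaw i s)
      = ∇ (P.localObj i) x := fun r => by
    rw [← heq, ← (hmp r).map_eq, integral_map (hmp r).measurable.aemeasurable]
    rw [(hmp r).map_eq]
    exact hint.aestronglyMeasurable
  simp only [h2, Finset.sum_const, Finset.card_univ, Fintype.card_fin]
  rw [← Nat.cast_smul_eq_nsmul ℝ, smul_smul, inv_mul_cancel₀ hs0, one_smul]

theorem isNoise_batchGrad (hP : P.Regular) (hL : P.Smooth L) (hσ : P.BoundedNoise σ)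
    (hLσ : P.AverageSmooth Lσ) (i : Fin M) {s : ℕ} (hs : 1 ≤ s) (hsize : (s : ℕ∞) ≤ P.data.size)
    (x : Vec d) : IsNoise (P.data.batchLaw i s)
      (fun B : Fin s → Z => P.batchGrad i B x - ∇ (P.localObj i) x) (σ ^ 2 / s) := by
  have := P.data.isProbabilityMeasure_batchLaw i hsize
  obtain ⟨hint, heq⟩ := integral_batchGrad hP hL hσ hLσ i hs hsize x
  refine ⟨((measurable_batchGrad hP i s).comp measurable_prodMk_left).sub_const _, ?_,
    ExpLE.of_lintegral_enorm (hσ i s hs hsize x), by positivity⟩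
  rw [integral_sub hint (integrable_const _), heq]
  simp

theorem isNoise_batchGrad_sub (hP : P.Regular) (hL : P.Smooth L) (hσ : P.BoundedNoise σ)
    (hLσ : P.AverageSmooth Lσ) (i : Fin M) {s : ℕ} (hs : 1 ≤ s) (hsize : (s : ℕ∞) ≤ P.data.size)
    (v w : Vec d) : IsNoise (P.data.batchLaw i s)
      (fun B : Fin s → Z => (P.batchGrad i B v - P.batchGrad i B w)
        - (∇ (P.localObj i) v - ∇ (P.localObj i) w)) (Lσ ^ 2 / s * ‖v - w‖ ^ 2) := by
  have := P.data.isProbabilityMeasure_batchLaw i hsize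
  have hv := integral_batchGrad hP hL hσ hLσ i hs hsize v
  have hw := integral_batchGrad hP hL hσ hLσ i hs hsize w
  refine ⟨(((measurable_batchGrad hP i s).comp measurable_prodMk_left).sub
    ((measurable_batchGrad hP i s).comp measurable_prodMk_left)).sub_const _, ?_,
    ExpLE.of_lintegral_enorm (hLσ i s hs hsize v w), by positivity⟩
  have hvw : Integrable (fun B : Fin s → Z => P.batchGrad i B v - P.batchGrad i B w)
    (P.data.batchLaw i s) := hv.1.sub hw.1
  rw [integral_sub hvw (integrable_const _), integral_sub hv.1 hw.1, hv.2, hw.2]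
  simp

/-- A batch that exhausts the dataset has an almost surely constant gradient, which must equal its
mean. Hence the variance term disappears when `b = n`. -/
theorem isNoise_batchGrad_full (hP : P.Regular) (hL : P.Smooth L) (hσ : P.BoundedNoise σ)
    (hLσ : P.AverageSmooth Lσ) (i : Fin M) {s : ℕ} (hs : 1 ≤ s) (hsize : (s : ℕ∞) = P.data.size)
    (x : Vec d) : IsNoise (P.data.batchLaw i s)
      (fun B : Fin s → Z => P.batchGrad i B x - ∇ (P.localObj i) x) 0 := by
  have h := isNoise_batchGrad hP hL hσ hLσ i hs hsize.le x
  refine ⟨h.measurable, h.integral_eq_zero, ?_, le_rfl⟩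
  have := P.data.isProbabilityMeasure_batchLaw i hsize.le
  -- the batch gradient does not depend on the order in which the dataset is drawn
  obtain ⟨pts, hpts⟩ := P.data.exists_ae_sum_batchLaw i hsize
  have hgm : Measurable fun z => ∇ (fun y => P.loss i y z) x :=
    (hP.measurable_grad i).comp measurable_prodMk_left
  have hconst : ∃ c : Vec d, ∀ᵐ B ∂(P.data.batchLaw i s), P.batchGrad i B x = c := by
    refine ⟨(s : ℝ)⁻¹ • ∑ r, ∇ (fun y => P.loss i y (pts r)) x, ?_⟩
    filter_upwards [hpts d _ hgm] with B hB
    rw [batchGrad_eq hP, hB]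
  obtain ⟨c, hc⟩ := hconst
  have hceq : c = ∇ (P.localObj i) x := by
    rw [← (integral_batchGrad hP hL hσ hLσ i hs hsize.le x).2, integral_congr_ae hc]
    simp
  refine (ExpLE.const (μ := P.data.batchLaw i s) 0).mono_ae ?_
  filter_upwards [hc] with B hB
  simp [hB, hceq]

end Problem

/-! ### Local updates of a miner -/

section Miner

/-- Condition on the first `k` batches and integrate out the last one; every induction along a local
run uses this. -/
theorem ExpLE.pi_succ {Ω : Type*} [MeasurableSpace Ω] {ρ : Measure Ω} [IsProbabilityMeasure ρ]
    {k : ℕ} {F : (Fin k → Ω) × Ω → ℝ} {h : (Fin k → Ω) → ℝ} {c : ℝ} (hF : Measurable F)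
    (hin : ∀ B, ExpLE ρ (fun z => F (B, z)) (h B))
    (hout : ExpLE (Measure.pi fun _ : Fin k => ρ) h c) :
    ExpLE (Measure.pi fun _ : Fin (k + 1) => ρ)
      (fun B => F (fun j => B j.castSucc, B (Fin.last k))) c := by
  have h1 := (measurePreserving_piFinSuccAbove (fun _ : Fin (k + 1) => ρ) (Fin.last k))
  have h2 := (Measure.measurePreserving_swap (μ := ρ)
    (ν := Measure.pi fun _ : Fin k => ρ)).comp h1
  refine ((ExpLE.prod hF hin hout).comp h2 hF).mono (fun B => le_of_eq ?_) le_rfl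
  simp only [Function.comp, MeasurableEquiv.piFinSuccAbove_apply, Prod.swap]
  congr 2
  funext j
  simp [Fin.init]

theorem ExpLE.pi_castSucc {Ω : Type*} [MeasurableSpace Ω] {ρ : Measure Ω} [IsProbabilityMeasure ρ]
    {k : ℕ} {f : (Fin k → Ω) → ℝ} {c : ℝ} (hf : Measurable f)
    (h : ExpLE (Measure.pi fun _ : Fin k => ρ) f c) :
    ExpLE (Measure.pi fun _ : Fin (k + 1) => ρ) (fun B => f fun j => B j.castSucc) c :=
  ExpLE.pi_succ (F := fun q => f q.1) (hf.comp measurable_fst) (fun _ => ExpLE.const _) h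

variable {Z : Type*} [MeasurableSpace Z] {d M : ℕ} {P : Problem Z d M}

theorem measurable_batchGrad_comp {i : Fin M} {s : ℕ} {α : Type*} [MeasurableSpace α]
    (hm : Measurable fun q : Vec d × (Fin s → Z) => P.batchGrad i q.2 q.1) {f : α → Vec d}
    {B : α → Fin s → Z} (hf : Measurable f) (hB : Measurable B) :
    Measurable fun a => P.batchGrad i (B a) (f a) := by
  have h := hm.comp (hf.prodMk hB)
  exact h

theorem measurable_minerRun {i : Fin M} {s : ℕ}
    (hm : Measurable fun q : Vec d × (Fin s → Z) => P.batchGrad i q.2 q.1) (ηl : ℝ) (k : ℕ) :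
    Measurable fun q : (Vec d × Vec d) × (Fin k → Fin s → Z) =>
      minerRun P ηl i q.1.1 q.1.2 k q.2 := by
  induction k with
  | zero => simp only [minerRun]; fun_prop
  | succ k ih =>
    have h1 : Measurable fun q : (Vec d × Vec d) × (Fin (k + 1) → Fin s → Z) =>
        minerRun P ηl i q.1.1 q.1.2 k fun j => q.2 j.castSucc :=
      ih.comp (measurable_fst.prodMk (measurable_pi_lambda _ fun j =>
        (measurable_pi_apply j.castSucc).comp measurable_snd))
    have h2 : Measurable fun q : (Vec d × Vec d) × (Fin (k + 1) → Fin s → Z) =>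
        q.2 (Fin.last k) := (measurable_pi_apply (Fin.last k)).comp measurable_snd
    have h3 := hm.comp (h1.fst.prodMk h2)
    have h4 := hm.comp (h1.snd.fst.prodMk h2)
    have h5 := (h1.snd.snd.sub h3).add h4
    exact h1.snd.fst.prodMk ((h1.snd.fst.sub (h5.const_smul ηl)).prodMk h5)

variable {ηl : ℝ} {i : Fin M} {x g : Vec d} {s : ℕ}

theorem minerRun_succ (k : ℕ) (B : Fin (k + 1) → Fin s → Z) :
    minerRun P ηl i x g (k + 1) B =
      (let r := minerRun P ηl i x g k fun j => B j.castSucc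
      let g' := r.2.2 - P.batchGrad i (B (Fin.last k)) r.1 + P.batchGrad i (B (Fin.last k)) r.2.1
      (r.2.1, r.2.1 - ηl • g', g')) := rfl

/-- The last displacement is `-ηl g^k`; at `k = 0` it vanishes because `x^{-1} = x^0`. -/
theorem norm_minerRun_sub_le (k : ℕ) (B : Fin k → Fin s → Z) :
    ‖(minerRun P ηl i x g k B).2.1 - (minerRun P ηl i x g k B).1‖ ^ 2
      ≤ ηl ^ 2 * ‖(minerRun P ηl i x g k B).2.2‖ ^ 2 := by
  cases k with
  | zero =>
    simp only [minerRun, sub_self, norm_zero, zero_pow two_ne_zero]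
    positivity
  | succ k =>
    simp only [minerRun_succ]
    rw [sub_sub_cancel_left, norm_neg, norm_smul, mul_pow, Real.norm_eq_abs, sq_abs]

variable {ρ : Measure (Fin s → Z)} [IsProbabilityMeasure ρ] {L C : ℝ} {K : ℕ}

theorem measurable_minerRun_seed
    (hm : Measurable fun q : Vec d × (Fin s → Z) => P.batchGrad i q.2 q.1) (k : ℕ) :
    Measurable (minerRun P ηl i x g (s := s) k) :=
  (measurable_minerRun hm ηl k).comp (measurable_prodMk_left (x := (x, g)))

/-- The displacement of a miner is close to `k` steps in a fixed direction `h` if all its update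
directions are close to `h`. -/
theorem expLE_displacement_succ
    (hm : Measurable fun q : Vec d × (Fin s → Z) => P.batchGrad i q.2 q.1) {k : ℕ} {h : Vec d}
    {b : ℝ} (hb : 0 ≤ b)
    (hk : ExpLE (Measure.pi fun _ : Fin k => ρ)
      (fun B => ‖x - (minerRun P ηl i x g k B).2.1 - (k * ηl) • h‖ ^ 2) (k ^ 2 * ηl ^ 2 * b))
    (hk1 : ExpLE (Measure.pi fun _ : Fin (k + 1) => ρ)
      (fun B => ‖(minerRun P ηl i x g (k + 1) B).2.2 - h‖ ^ 2) b) :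
    ExpLE (Measure.pi fun _ : Fin (k + 1) => ρ)
      (fun B => ‖x - (minerRun P ηl i x g (k + 1) B).2.1 - (((k + 1 : ℕ) : ℝ) * ηl) • h‖ ^ 2)
      (((k + 1 : ℕ) : ℝ) ^ 2 * ηl ^ 2 * b) := by
  have hr := measurable_minerRun_seed (ηl := ηl) (x := x) (g := g) hm
  have heq : ∀ B : Fin (k + 1) → Fin s → Z,
      x - (minerRun P ηl i x g (k + 1) B).2.1 - (((k + 1 : ℕ) : ℝ) * ηl) • h
        = (x - (minerRun P ηl i x g k fun j => B j.castSucc).2.1 - (k * ηl) • h)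
          + ηl • ((minerRun P ηl i x g (k + 1) B).2.2 - h) := fun B => by
    simp only [minerRun_succ, Nat.cast_add, Nat.cast_one, add_mul, one_mul, add_smul, smul_sub]
    abel
  simp_rw [heq]
  rcases Nat.eq_zero_or_pos k with rfl | hpos
  · refine (hk1.const_mul (sq_nonneg ηl)).mono (fun B => le_of_eq ?_) (le_of_eq (by norm_num))
    simp [minerRun, norm_smul, mul_pow]
  · have hkpos : (0 : ℝ) < k := by exact_mod_cast hpos
    have hm1 : Measurable fun B : Fin k → Fin s → Z =>
        ‖x - (minerRun P ηl i x g k B).2.1 - (k * ηl) • h‖ ^ 2 :=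
      ((measurable_const.sub (hr k).snd.fst).sub_const _).norm.pow_const 2
    have hm1' : Measurable fun B : Fin (k + 1) → Fin s → Z =>
        ‖x - (minerRun P ηl i x g k fun j => B j.castSucc).2.1 - (k * ηl) • h‖ ^ 2 :=
      hm1.comp (measurable_pi_lambda _ fun j => measurable_pi_apply j.castSucc)
    -- With Young weights `1/k` and `k` the bounds add up exactly: `(1 + 1/k)k² + (1 + k) = (k +
    -- 1)²`.
    have h1 := (ExpLE.pi_castSucc hm1 hk).const_mul (k := 1 + 1 / (k : ℝ)) (by positivity)
    have h2 := hk1.const_mul (k := (1 + (k : ℝ)) * ηl ^ 2) (by positivity)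
    refine (h1.add h2 (hm1'.const_mul _) (by positivity) (by positivity)).mono (fun B => ?_)
      (le_of_eq ?_)
    · refine (norm_add_sq_le_young (r := 1 / (k : ℝ)) (s := k) (by positivity)
        (by field_simp) _ _).trans (le_of_eq ?_)
      rw [norm_smul, mul_pow, Real.norm_eq_abs, sq_abs]
      ring
    · push_cast
      field_simp
      ring

/-- Given the past, the fresh batch adds a centred increment of conditional second moment at most
`C‖x^k - x^{k-1}‖²`, which the local step turns into `C ηl²‖g^k‖²`. The vector `N` is any function
of the past. -/
theorem expLE_martingale_succ
    (hm : Measurable fun q : Vec d × (Fin s → Z) => P.batchGrad i q.2 q.1)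
    (hgm : Measurable (∇ (P.localObj i)))
    (hnoise : ∀ v w, IsNoise ρ (fun B : Fin s → Z => (P.batchGrad i B v - P.batchGrad i B w)
        - (∇ (P.localObj i) v - ∇ (P.localObj i) w)) (C * ‖v - w‖ ^ 2))
    (hC0 : 0 ≤ C) {k : ℕ} {r : (Fin k → Fin s → Z) → Vec d × Vec d × Vec d} (hr : Measurable r)
    (hstep : ∀ B, ‖(r B).2.1 - (r B).1‖ ^ 2 ≤ ηl ^ 2 * ‖(r B).2.2‖ ^ 2)
    {N : (Fin k → Fin s → Z) → Vec d} (hN : Measurable N) {a b : ℝ} (ha : 0 ≤ a) (hb : 0 ≤ b)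
    (hNa : ExpLE (Measure.pi fun _ : Fin k => ρ) (fun B => ‖N B‖ ^ 2) a)
    (hrb : ExpLE (Measure.pi fun _ : Fin k => ρ) (fun B => ‖(r B).2.2‖ ^ 2) b) :
    ExpLE (Measure.pi fun _ : Fin (k + 1) => ρ)
      (fun B => ‖(N fun j => B j.castSucc)
        + ((P.batchGrad i (B (Fin.last k)) (r fun j => B j.castSucc).2.1
            - P.batchGrad i (B (Fin.last k)) (r fun j => B j.castSucc).1)
          - (∇ (P.localObj i) (r fun j => B j.castSucc).2.1
            - ∇ (P.localObj i) (r fun j => B j.castSucc).1))‖ ^ 2)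
      (a + C * ηl ^ 2 * b) := by
  have hr' : Measurable fun q : (Fin k → Fin s → Z) × (Fin s → Z) => r q.1 := hr.comp measurable_fst
  have h1 : Measurable fun q : (Fin k → Fin s → Z) × (Fin s → Z) =>
      P.batchGrad i q.2 (r q.1).2.1 := measurable_batchGrad_comp hm hr'.snd.fst measurable_snd
  have h2 : Measurable fun q : (Fin k → Fin s → Z) × (Fin s → Z) =>
      P.batchGrad i q.2 (r q.1).1 := measurable_batchGrad_comp hm hr'.fst measurable_snd
  have h3 : Measurable fun q : (Fin k → Fin s → Z) × (Fin s → Z) =>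
      ∇ (P.localObj i) (r q.1).2.1 := by
    have h := hgm.comp hr'.snd.fst
    exact h
  have h4 : Measurable fun q : (Fin k → Fin s → Z) × (Fin s → Z) =>
      ∇ (P.localObj i) (r q.1).1 := by
    have h := hgm.comp hr'.fst
    exact h
  have hout := hNa.add (hrb.const_mul (k := C * ηl ^ 2) (by positivity))
    (hN.norm.pow_const 2) ha (by positivity)
  let F : (Fin k → Fin s → Z) × (Fin s → Z) → ℝ := fun q =>
    ‖N q.1 + ((P.batchGrad i q.2 (r q.1).2.1 - P.batchGrad i q.2 (r q.1).1)
      - (∇ (P.localObj i) (r q.1).2.1 - ∇ (P.localObj i) (r q.1).1))‖ ^ 2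
  have hF : Measurable F := by
    have h5 := ((hN.comp measurable_fst).add ((h1.sub h2).sub (h3.sub h4))).norm.pow_const 2
    exact h5
  refine ExpLE.pi_succ (F := F) hF (fun B => ?_) hout
  have h6 := (hnoise (r B).2.1 (r B).1).expLE_norm_add_sq (N B)
  refine h6.mono (fun _ => le_rfl) ?_
  have h5 : C * ‖(r B).2.1 - (r B).1‖ ^ 2 ≤ C * (ηl ^ 2 * ‖(r B).2.2‖ ^ 2) := by
    gcongr
    exact hstep B
  linarith

/-- Second moment bounds along the trajectory of a miner that starts at `x` with direction `g`. -/
structure MinerBounds (P : Problem Z d M) (ηl : ℝ) (i : Fin M) (x g : Vec d)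
    (ρ : Measure (Fin s → Z)) (L : ℝ) (K k : ℕ) : Prop where
  martingale : ∀ c : Vec d, ExpLE (Measure.pi fun _ : Fin k => ρ)
    (fun B => ‖c + ((minerRun P ηl i x g k B).2.2 - g
      - (∇ (P.localObj i) (minerRun P ηl i x g k B).1 - ∇ (P.localObj i) x))‖ ^ 2)
    (‖c‖ ^ 2 + k / K * (5 / 144 * ‖g‖ ^ 2))
  drift : ExpLE (Measure.pi fun _ : Fin k => ρ)
    (fun B => ‖∇ (P.localObj i) (minerRun P ηl i x g k B).1 - ∇ (P.localObj i) x‖ ^ 2)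
    (5 / 72 * ‖g‖ ^ 2)
  direction : ExpLE (Measure.pi fun _ : Fin k => ρ)
    (fun B => ‖(minerRun P ηl i x g k B).2.2‖ ^ 2) (5 / 3 * ‖g‖ ^ 2)
  displacement : ExpLE (Measure.pi fun _ : Fin k => ρ)
    (fun B => ‖x - (minerRun P ηl i x g k B).2.1‖ ^ 2) (k ^ 2 * ηl ^ 2 * (5 / 3 * ‖g‖ ^ 2))

/-- The four bounds feed each other, so they are proved by one induction: the previous direction
controls the new martingale increment, the displacement controls the drift, and martingale and drift
control the next direction. The shift in the martingale bound is left free since it is used both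
with `g` and with `g - h`. -/
theorem minerBounds (hm : Measurable fun q : Vec d × (Fin s → Z) => P.batchGrad i q.2 q.1)
    (hgm : Measurable (∇ (P.localObj i)))
    (hlip : ∀ v w, ‖∇ (P.localObj i) v - ∇ (P.localObj i) w‖ ≤ L * ‖v - w‖)
    (hnoise : ∀ v w, IsNoise ρ (fun B : Fin s → Z => (P.batchGrad i B v - P.batchGrad i B w)
        - (∇ (P.localObj i) v - ∇ (P.localObj i) w)) (C * ‖v - w‖ ^ 2))
    (hC0 : 0 ≤ C) (hC : 2 * C ≤ K * L ^ 2) (hK : 1 ≤ K) (hη : 24 * K ^ 2 * L ^ 2 * ηl ^ 2 = 1)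
    {k : ℕ} (hk : k ≤ K) : MinerBounds P ηl i x g ρ L K k := by
  have hK0 : (0 : ℝ) < K := by exact_mod_cast hK
  have hr := measurable_minerRun_seed (ηl := ηl) (x := x) (g := g) hm
  induction k with
  | zero =>
    refine ⟨fun c => ?_, ?_, ?_, ?_⟩
    · simpa [minerRun] using ExpLE.const (μ := Measure.pi fun _ : Fin 0 => ρ) (‖c‖ ^ 2)
    · refine (ExpLE.const (5 / 72 * ‖g‖ ^ 2)).mono (fun B => ?_) le_rfl
      simp only [minerRun, sub_self, norm_zero, zero_pow two_ne_zero]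
      positivity
    · refine (ExpLE.const (5 / 3 * ‖g‖ ^ 2)).mono (fun B => ?_) le_rfl
      simp only [minerRun]
      nlinarith [sq_nonneg ‖g‖]
    · simpa [minerRun] using ExpLE.const (μ := Measure.pi fun _ : Fin 0 => ρ) 0
  | succ k ih =>
    have ihk := ih (by omega)
    have hkK : (k : ℝ) ≤ K := by exact_mod_cast (by omega : k ≤ K)
    have hk0 : (0 : ℝ) ≤ k := k.cast_nonneg
    have hk1 : ((k + 1 : ℕ) : ℝ) ≤ K := by exact_mod_cast hk
    have hmart : ∀ c : Vec d, ExpLE (Measure.pi fun _ : Fin (k + 1) => ρ)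
        (fun B => ‖c + ((minerRun P ηl i x g (k + 1) B).2.2 - g
          - (∇ (P.localObj i) (minerRun P ηl i x g (k + 1) B).1 - ∇ (P.localObj i) x))‖ ^ 2)
        (‖c‖ ^ 2 + ((k + 1 : ℕ) : ℝ) / K * (5 / 144 * ‖g‖ ^ 2)) := fun c => by
      have hN : Measurable fun B : Fin k → Fin s → Z => c + ((minerRun P ηl i x g k B).2.2 - g
          - (∇ (P.localObj i) (minerRun P ηl i x g k B).1 - ∇ (P.localObj i) x)) :=
        measurable_const.add (((hr k).snd.snd.sub_const g).sub
          ((hgm.comp (hr k).fst).sub_const _))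
      refine (expLE_martingale_succ hm hgm hnoise hC0 (hr k) (norm_minerRun_sub_le k) hN
        (by positivity) (by positivity)
        (ihk.martingale c) ihk.direction).mono (fun B => le_of_eq ?_) ?_
      · simp only [minerRun_succ]
        congr 2
        abel
      -- From `2C ≤ K L²` and `24K²L²ηl² = 1`. Multiplied by `5/3`, this is the `5/144` per `K` in
      -- the martingale bound.
      · have h1 : C * ηl ^ 2 ≤ 1 / (48 * K) := by
          rw [le_div_iff₀ (by positivity)]
          have h2 : 2 * C * (24 * K * ηl ^ 2) ≤ K * L ^ 2 * (24 * K * ηl ^ 2) := by gcongr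
          nlinarith
        have h2 : C * ηl ^ 2 * (5 / 3 * ‖g‖ ^ 2) ≤ 1 / (48 * K) * (5 / 3 * ‖g‖ ^ 2) := by gcongr
        have h3 : ((k + 1 : ℕ) : ℝ) / K * (5 / 144 * ‖g‖ ^ 2)
            = k / K * (5 / 144 * ‖g‖ ^ 2) + 1 / (48 * K) * (5 / 3 * ‖g‖ ^ 2) := by
          push_cast
          field_simp
          ring
        linarith
    have hPk1 : Measurable fun B : Fin (k + 1) → Fin s → Z =>
        ∇ (P.localObj i) (minerRun P ηl i x g (k + 1) B).1 - ∇ (P.localObj i) x :=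
      (hgm.comp (hr (k + 1)).fst).sub_const _
    have hdrift : ExpLE (Measure.pi fun _ : Fin (k + 1) => ρ)
        (fun B => ‖∇ (P.localObj i) (minerRun P ηl i x g (k + 1) B).1 - ∇ (P.localObj i) x‖ ^ 2)
        (5 / 72 * ‖g‖ ^ 2) := by
      have hdm : Measurable fun B : Fin k → Fin s → Z =>
          ‖x - (minerRun P ηl i x g k B).2.1‖ ^ 2 :=
        (measurable_const.sub (hr k).snd.fst).norm.pow_const 2
      have h1 := (ExpLE.pi_castSucc hdm ihk.displacement).const_mul (sq_nonneg L)
      refine h1.mono (fun B => ?_) ?_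
      · simp only [minerRun_succ]
        rw [← mul_pow]
        refine pow_le_pow_left₀ (norm_nonneg _) ?_ 2
        rw [norm_sub_rev x]
        exact hlip _ _
      · have h2 : L ^ 2 * (k ^ 2 * ηl ^ 2) ≤ 1 / 24 := by
          have h3 : L ^ 2 * (k ^ 2 * ηl ^ 2) ≤ L ^ 2 * (K ^ 2 * ηl ^ 2) := by gcongr
          linarith
        calc L ^ 2 * (k ^ 2 * ηl ^ 2 * (5 / 3 * ‖g‖ ^ 2))
            = L ^ 2 * (k ^ 2 * ηl ^ 2) * (5 / 3 * ‖g‖ ^ 2) := by ring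
          _ ≤ 1 / 24 * (5 / 3 * ‖g‖ ^ 2) := by gcongr
          _ = 5 / 72 * ‖g‖ ^ 2 := by ring
    have hdir : ExpLE (Measure.pi fun _ : Fin (k + 1) => ρ)
        (fun B => ‖(minerRun P ηl i x g (k + 1) B).2.2‖ ^ 2) (5 / 3 * ‖g‖ ^ 2) := by
      -- The Young weight `1/3` closes the induction: `4/3 (1 + 5/144) + 4 · 5/72 = 179/108 ≤ 5/3`.
      have h1 := (hmart g).const_mul (k := 1 + 1 / 3) (by norm_num)
      have h2 := hdrift.const_mul (k := 1 + 3) (by norm_num)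
      refine (h1.add h2 (Measurable.const_mul (Measurable.pow_const (Measurable.norm
        (measurable_const.add (((hr (k + 1)).snd.snd.sub_const g).sub hPk1))) 2) _)
        (by positivity) (by positivity)).mono (fun B => ?_) ?_
      · refine le_trans (le_of_eq ?_) (norm_add_sq_le_young (r := 1 / 3) (s := 3) (by norm_num)
          (by norm_num) _ _)
        congr 2
        abel
      · have h3 : ((k + 1 : ℕ) : ℝ) / K ≤ 1 := (div_le_one hK0).2 hk1
        have h4 : ((k + 1 : ℕ) : ℝ) / K * (5 / 144 * ‖g‖ ^ 2) ≤ 1 * (5 / 144 * ‖g‖ ^ 2) := by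
          gcongr
        nlinarith [sq_nonneg ‖g‖]
    refine ⟨hmart, hdrift, hdir, ?_⟩
    -- Comparison with the zero direction gives the plain displacement.
    have h1 := expLE_displacement_succ hm (h := 0) (b := 5 / 3 * ‖g‖ ^ 2) (by positivity)
      (by simpa using ihk.displacement) (by simpa using hdir)
    simpa using h1

/-- The mean update direction of a miner, compared with an arbitrary direction `h`. -/
theorem expLE_minerRun (hm : Measurable fun q : Vec d × (Fin s → Z) => P.batchGrad i q.2 q.1)
    (hgm : Measurable (∇ (P.localObj i)))
    (hlip : ∀ v w, ‖∇ (P.localObj i) v - ∇ (P.localObj i) w‖ ≤ L * ‖v - w‖)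
    (hnoise : ∀ v w, IsNoise ρ (fun B : Fin s → Z => (P.batchGrad i B v - P.batchGrad i B w)
        - (∇ (P.localObj i) v - ∇ (P.localObj i) w)) (C * ‖v - w‖ ^ 2))
    (hC0 : 0 ≤ C) (hC : 2 * C ≤ K * L ^ 2) (hK : 1 ≤ K) (hη : 24 * K ^ 2 * L ^ 2 * ηl ^ 2 = 1)
    (hη0 : 0 < ηl) (h : Vec d) :
    ExpLE (Measure.pi fun _ : Fin K => ρ)
      (fun B => 1 / 8 * ‖(K * ηl)⁻¹ • (x - (minerRun P ηl i x g K B).2.1)‖ ^ 2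
        + 1 / 2 * ‖(K * ηl)⁻¹ • (x - (minerRun P ηl i x g K B).2.1) - h‖ ^ 2)
      (7 / 16 * ‖g‖ ^ 2 + 3 / 5 * ‖g - h‖ ^ 2) := by
  have hK0 : (0 : ℝ) < K := by exact_mod_cast hK
  have hr := measurable_minerRun_seed (ηl := ηl) (x := x) (g := g) hm
  have hb := fun k hk => minerBounds (x := x) (g := g) hm hgm hlip hnoise hC0 hC hK hη (k := k) hk
  have hdir : ∀ k ≤ K, ExpLE (Measure.pi fun _ : Fin k => ρ)
      (fun B => ‖(minerRun P ηl i x g k B).2.2 - h‖ ^ 2)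
      (11 / 24 * ‖g‖ ^ 2 + 6 / 5 * ‖g - h‖ ^ 2) := fun k hk => by
    -- Weights `1/5` and `5`: the coefficient of `‖g‖²` is `6/5 · 5/144 + 6 · 5/72 = 11/24`.
    have h1 := ((hb k hk).martingale (g - h)).const_mul (k := 1 + 1 / 5) (by norm_num)
    have h2 := (hb k hk).drift.const_mul (k := 1 + 5) (by norm_num)
    refine (h1.add h2 (Measurable.const_mul (Measurable.pow_const (Measurable.norm
      (measurable_const.add (((hr k).snd.snd.sub_const g).sub
        ((hgm.comp (hr k).fst).sub_const _)))) 2) _)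
      (by positivity) (by positivity)).mono (fun B => ?_) ?_
    · refine le_trans (le_of_eq ?_) (norm_add_sq_le_young (r := 1 / 5) (s := 5) (by norm_num)
        (by norm_num) _ _)
      congr 2
      abel
    · have h3 : (k : ℝ) / K ≤ 1 := (div_le_one hK0).2 (by exact_mod_cast hk)
      have h4 : (k : ℝ) / K * (5 / 144 * ‖g‖ ^ 2) ≤ 1 * (5 / 144 * ‖g‖ ^ 2) := by
        gcongr
      nlinarith [sq_nonneg ‖g‖]
  have hdisp : ∀ k ≤ K, ExpLE (Measure.pi fun _ : Fin k => ρ)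
      (fun B => ‖x - (minerRun P ηl i x g k B).2.1 - (k * ηl) • h‖ ^ 2)
      (k ^ 2 * ηl ^ 2 * (11 / 24 * ‖g‖ ^ 2 + 6 / 5 * ‖g - h‖ ^ 2)) := fun k => by
    induction k with
    | zero =>
      intro _
      simpa [minerRun] using ExpLE.const (μ := Measure.pi fun _ : Fin 0 => ρ) 0
    | succ k ih =>
      intro hk
      exact expLE_displacement_succ hm (by positivity) (ih (by omega)) (hdir _ hk)
  have hKη : (K * ηl : ℝ) ≠ 0 := (mul_pos hK0 hη0).ne'
  -- The final constants are `1/8 · 5/3 + 1/2 · 11/24 = 7/16` and `1/2 · 6/5 = 3/5`. The weight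
  -- `1/8` is the part of `‖u‖²` that the descent step leaves uncompensated.
  have h1 := (hb K le_rfl).displacement.const_mul (k := 1 / 8 * ((K * ηl)⁻¹) ^ 2) (by positivity)
  have h2 := (hdisp K le_rfl).const_mul (k := 1 / 2 * ((K * ηl)⁻¹) ^ 2) (by positivity)
  refine (h1.add h2 (Measurable.const_mul (Measurable.pow_const (Measurable.norm
    (measurable_const.sub (hr K).snd.fst)) 2) _) (by positivity) (by positivity)).mono
    (fun B => le_of_eq ?_) (le_of_eq ?_)
  · have h3 : (K * ηl)⁻¹ • (x - (minerRun P ηl i x g K B).2.1) - h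
        = (K * ηl)⁻¹ • (x - (minerRun P ηl i x g K B).2.1 - (K * ηl) • h) := by
      rw [smul_sub _ _ ((K * ηl) • h), smul_smul, inv_mul_cancel₀ hKη, one_smul]
    rw [h3, norm_smul, norm_smul, mul_pow, mul_pow, Real.norm_eq_abs, sq_abs]
    ring
  · field_simp
    ring

end Miner

/-! ### Random participants, anchors and miners -/

section Selection

/-- The indicator of `true`. -/
def ind (b : Bool) : ℝ := if b = true then 1 else 0

theorem ind_nonneg (b : Bool) : 0 ≤ ind b := by cases b <;> simp [ind]

theorem ind_mul_self (b : Bool) : ind b * ind b = ind b := by cases b <;> simp [ind]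

variable {M A : ℕ} {p : ℝ}

theorem isProbabilityMeasure_coinLaw (hp0 : 0 ≤ p) (hp1 : p ≤ 1) :
    IsProbabilityMeasure (coinLaw p) := by
  refine ⟨?_⟩
  simp only [coinLaw, Measure.add_apply, Measure.smul_apply, measure_univ, smul_eq_mul, mul_one]
  rw [← ENNReal.ofReal_add hp0 (by linarith)]
  simp

theorem integral_ind_coinLaw (hp0 : 0 ≤ p) : ∫ b, ind b ∂(coinLaw p) = p := by
  rw [coinLaw, integral_add_measure (Integrable.of_finite.smul_measure ENNReal.ofReal_ne_top)
    (Integrable.of_finite.smul_measure ENNReal.ofReal_ne_top), integral_smul_measure,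
    integral_smul_measure]
  simp [ind, hp0]

theorem integral_prod_ind_coins (hp0 : 0 ≤ p) (hp1 : p ≤ 1) (T : Finset (Fin M)) :
    ∫ co, ∏ k ∈ T, ind (co k) ∂(Measure.pi fun _ : Fin M => coinLaw p) = p ^ T.card := by
  have := isProbabilityMeasure_coinLaw hp0 hp1
  have h1 : ∀ co : Fin M → Bool,
      ∏ k ∈ T, ind (co k) = ∏ k, (fun b => if k ∈ T then ind b else 1) (co k) := fun co => by
    simp [Finset.prod_ite_mem]
  simp_rw [h1]
  rw [integral_fintype_prod_eq_prod (𝕜 := ℝ) (fun k b => if k ∈ T then ind b else 1)]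
  have h2 : ∀ k, ∫ b, (if k ∈ T then ind b else 1) ∂(coinLaw p)
      = if k ∈ T then p else 1 := fun k => by
    split_ifs
    · exact integral_ind_coinLaw hp0
    · rw [integral_const, probReal_univ, one_smul]
  simp [h2]

theorem isProbabilityMeasure_participantLaw (hAM : A ≤ M) :
    IsProbabilityMeasure (participantLaw M A) := by
  obtain ⟨T, -, hT⟩ := Finset.exists_subset_card_eq
    (s := (Finset.univ : Finset (Fin M))) (n := A) (by simpa using hAM)
  refine isProbabilityMeasure_uniformOn (Set.toFinite _) ⟨fun i => decide (i ∈ T), ?_⟩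
  simp [hT]

theorem ae_card_participantLaw :
    ∀ᵐ s ∂(participantLaw M A), (Finset.univ.filter fun i => s i = true).card = A := by
  have h : ∀ᵐ s ∂(participantLaw M A),
      s ∈ {s : Fin M → Bool | (Finset.univ.filter fun i => s i = true).card = A} :=
    ae_cond_mem (Set.toFinite _).measurableSet
  exact h

theorem sum_ind (s : Fin M → Bool) :
    ∑ i, ind (s i) = (Finset.univ.filter fun i => s i = true).card := by
  simp [ind, Finset.sum_boole]

theorem integral_participantLaw_perm (e : Fin M ≃ Fin M) (f : (Fin M → Bool) → ℝ) :
    ∫ s, f (fun i => s (e i)) ∂(participantLaw M A) = ∫ s, f s ∂(participantLaw M A) := by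
  let E : (Fin M → Bool) ≃ (Fin M → Bool) := Equiv.arrowCongr e.symm (Equiv.refl _)
  have hE : MeasurePreserving E (participantLaw M A) (participantLaw M A) := by
    refine measurePreserving_uniformOn E ?_
    ext s
    have : (Finset.univ.filter fun i => s (e i) = true).card
        = (Finset.univ.filter fun i => s i = true).card := by
      refine Finset.card_bij (fun i _ => e i) (by simp) (fun i _ j _ h => e.injective h) ?_
      intro j hj
      exact ⟨e.symm j, by simpa using hj, by simp⟩
    simp [E, Equiv.arrowCongr, this]
  rw [← hE.map_eq, integral_map hE.measurable.aemeasurable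
    (measurable_of_countable f).aestronglyMeasurable, hE.map_eq]
  simp [E, Equiv.arrowCongr]
  rfl

/-- The indicators always sum to `A`, and by symmetry they have equal expectations. -/
theorem integral_ind_participantLaw (hAM : A ≤ M) (i : Fin M) :
    ∫ s, ind (s i) ∂(participantLaw M A) = A / M := by
  have := isProbabilityMeasure_participantLaw hAM
  have hM : (M : ℝ) ≠ 0 := by exact_mod_cast i.pos.ne'
  have hsum : ∫ s, ∑ j, ind (s j) ∂(participantLaw M A) = A := by
    rw [integral_congr_ae (g := fun _ => (A : ℝ))]
    · simp
    · filter_upwards [ae_card_participantLaw] with s hs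
      rw [sum_ind, hs]
  rw [integral_finsetSum _ fun _ _ => Integrable.of_finite] at hsum
  have hsym : ∀ j, ∫ s, ind (s j) ∂(participantLaw M A) = ∫ s, ind (s i) ∂(participantLaw M A) :=
    fun j => by
      rw [← integral_participantLaw_perm (Equiv.swap i j) fun s => ind (s i)]
      simp
  simp only [hsym, Finset.sum_const, Finset.card_univ, Fintype.card_fin, nsmul_eq_mul] at hsum
  rw [eq_div_iff hM, mul_comm, hsum]

/-- Multiply the sum of the indicators by one of them, remove the diagonal term and use symmetry for
the remaining pairs. -/
theorem integral_ind_mul_ind_participantLaw (hAM : A ≤ M) {i j : Fin M} (hij : i ≠ j) :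
    ∫ s, ind (s i) * ind (s j) ∂(participantLaw M A) = A * (A - 1) / (M * (M - 1)) := by
  have := isProbabilityMeasure_participantLaw hAM
  have hM0 : (M : ℝ) ≠ 0 := by exact_mod_cast i.pos.ne'
  have hM : 2 ≤ M := by
    have hi := i.isLt
    have hj := j.isLt
    have : (i : ℕ) ≠ j := fun h => hij (Fin.ext h)
    omega
  have hM1 : (M : ℝ) - 1 ≠ 0 := by
    have : (2 : ℝ) ≤ M := by exact_mod_cast hM
    linarith
  have hsum : ∫ s, ∑ k, ind (s i) * ind (s k) ∂(participantLaw M A) = A * (A / M) := by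
    rw [← integral_ind_participantLaw hAM i, ← integral_const_mul]
    refine integral_congr_ae ?_
    filter_upwards [ae_card_participantLaw] with s hs
    rw [← Finset.mul_sum, sum_ind, hs, mul_comm]
  rw [integral_finsetSum _ fun _ _ => Integrable.of_finite,
    ← Finset.add_sum_erase _ _ (Finset.mem_univ i)] at hsum
  have hsym : ∀ k ∈ Finset.univ.erase i, ∫ s, ind (s i) * ind (s k) ∂(participantLaw M A)
      = ∫ s, ind (s i) * ind (s j) ∂(participantLaw M A) := fun k hk => by
    have hki := Finset.ne_of_mem_erase hk
    rw [← integral_participantLaw_perm (Equiv.swap j k) fun s => ind (s i) * ind (s j)]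
    simp [Equiv.swap_apply_of_ne_of_ne hij hki.symm]
  rw [Finset.sum_congr rfl hsym, Finset.sum_const, Finset.card_erase_of_mem (Finset.mem_univ i),
    Finset.card_univ, Fintype.card_fin, nsmul_eq_mul, Nat.cast_sub (by omega)] at hsum
  simp_rw [ind_mul_self] at hsum
  rw [integral_ind_participantLaw hAM, Nat.cast_one] at hsum
  have h3 : (∫ s, ind (s i) * ind (s j) ∂(participantLaw M A)) * (M * (M - 1))
      = A * (A - 1) := by
    have h4 : ((M : ℝ) - 1) * ∫ s, ind (s i) * ind (s j) ∂(participantLaw M A)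
        = A * (A / M) - A / M := by linarith
    calc _ = M * (((M : ℝ) - 1) * ∫ s, ind (s i) * ind (s j) ∂(participantLaw M A)) := by ring
      _ = _ := by rw [h4]; field_simp
  rw [eq_div_iff (mul_ne_zero hM0 hM1), h3]

/-- The joint law of the participants and of the coins. -/
noncomputable def selectLaw (M A : ℕ) (p : ℝ) : Measure ((Fin M → Bool) × (Fin M → Bool)) :=
  (participantLaw M A).prod (Measure.pi fun _ : Fin M => coinLaw p)

/-- The indicator that client `i` is an anchor. -/
def anchorInd (w : (Fin M → Bool) × (Fin M → Bool)) (i : Fin M) : ℝ := ind (w.1 i) * ind (w.2 i)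

theorem anchorInd_nonneg (w : (Fin M → Bool) × (Fin M → Bool)) (i : Fin M) : 0 ≤ anchorInd w i :=
  mul_nonneg (ind_nonneg _) (ind_nonneg _)

theorem anchorInd_mul_self (w : (Fin M → Bool) × (Fin M → Bool)) (i : Fin M) :
    anchorInd w i * anchorInd w i = anchorInd w i := by
  rw [anchorInd, mul_mul_mul_comm, ind_mul_self, ind_mul_self]

theorem anchorInd_eq_ite (w : (Fin M → Bool) × (Fin M → Bool)) (i : Fin M) :
    anchorInd w i = if w.1 i = true ∧ w.2 i = true then 1 else 0 := by
  simp only [anchorInd, ind]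
  split_ifs <;> simp_all

/-- The set of miners. -/
def miners (w : (Fin M → Bool) × (Fin M → Bool)) : Finset (Fin M) :=
  Finset.univ.filter fun i => w.1 i = true ∧ w.2 i = false

/-- The indicator that there is a miner. -/
def minerInd (w : (Fin M → Bool) × (Fin M → Bool)) : ℝ := if (miners w).card = 0 then 0 else 1

theorem minerInd_nonneg (w : (Fin M → Bool) × (Fin M → Bool)) : 0 ≤ minerInd w := by
  simp only [minerInd]; split_ifs <;> norm_num

theorem isProbabilityMeasure_selectLaw (hAM : A ≤ M) (hp0 : 0 ≤ p) (hp1 : p ≤ 1) :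
    IsProbabilityMeasure (selectLaw M A p) := by
  have := isProbabilityMeasure_participantLaw hAM
  have := isProbabilityMeasure_coinLaw hp0 hp1
  exact inferInstanceAs (IsProbabilityMeasure (Measure.prod _ _))

theorem integral_anchorInd (hAM : A ≤ M) (hp0 : 0 ≤ p) (hp1 : p ≤ 1) (i : Fin M) :
    ∫ w, anchorInd w i ∂(selectLaw M A p) = p * A / M := by
  have := isProbabilityMeasure_participantLaw hAM
  have := isProbabilityMeasure_coinLaw hp0 hp1
  simp only [anchorInd, selectLaw]
  rw [integral_prod_mul (fun s : Fin M → Bool => ind (s i)) (fun s : Fin M → Bool => ind (s i)),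
    integral_ind_participantLaw hAM]
  have h := integral_prod_ind_coins hp0 hp1 {i}
  simp only [Finset.prod_singleton, Finset.card_singleton, pow_one] at h
  rw [h]
  ring

theorem integral_anchorInd_mul (hAM : A ≤ M) (hp0 : 0 ≤ p) (hp1 : p ≤ 1) {i j : Fin M}
    (hij : i ≠ j) : ∫ w, anchorInd w i * anchorInd w j ∂(selectLaw M A p)
      = p ^ 2 * (A * (A - 1) / (M * (M - 1))) := by
  have := isProbabilityMeasure_participantLaw hAM
  have := isProbabilityMeasure_coinLaw hp0 hp1
  simp only [anchorInd, selectLaw, mul_mul_mul_comm]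
  rw [integral_prod_mul (fun s : Fin M → Bool => ind (s i) * ind (s j))
    (fun s : Fin M → Bool => ind (s i) * ind (s j)), integral_ind_mul_ind_participantLaw hAM hij]
  have h := integral_prod_ind_coins hp0 hp1 {i, j}
  simp only [Finset.prod_pair hij, Finset.card_pair hij] at h
  rw [h, mul_comm]

/-- There is no miner exactly when all `A` participants toss anchor, and the coins are independent
of the participants. -/
theorem integral_minerInd (hAM : A ≤ M) (hp0 : 0 ≤ p) (hp1 : p ≤ 1) :
    ∫ w, minerInd w ∂(selectLaw M A p) = 1 - p ^ A := by
  have := isProbabilityMeasure_participantLaw hAM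
  have := isProbabilityMeasure_coinLaw hp0 hp1
  have h1 : ∀ s co : Fin M → Bool, minerInd (s, co)
      = 1 - ∏ k ∈ Finset.univ.filter (fun i => s i = true), ind (co k) := fun s co => by
    by_cases h : (miners (s, co)).card = 0
    · rw [minerInd, if_pos h, Finset.prod_eq_one, sub_self]
      intro k hk
      rw [Finset.card_eq_zero, miners, Finset.filter_eq_empty_iff] at h
      have := h (Finset.mem_univ k)
      simp_all [ind]
    · rw [minerInd, if_neg h]
      obtain ⟨k, hk⟩ := Finset.card_pos.1 (Nat.pos_of_ne_zero h)
      rw [miners, Finset.mem_filter] at hk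
      rw [Finset.prod_eq_zero (i := k), sub_zero]
      · simpa using hk.2.1
      · simpa [ind] using hk.2.2
  rw [selectLaw, integral_prod _ Integrable.of_finite]
  rw [integral_congr_ae (g := fun _ => 1 - p ^ A)]
  · simp
  · filter_upwards [ae_card_participantLaw] with s hs
    simp_rw [h1]
    rw [integral_sub Integrable.of_finite Integrable.of_finite, integral_prod_ind_coins hp0 hp1, hs]
    simp

/-- Second moments of a random sum over the anchors. -/
theorem exists_integral_norm_add_sum_anchorInd_sq (d : ℕ) (hA : 1 ≤ A) (hAM : A ≤ M) (hp0 : 0 ≤ p)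
    (hp1 : p ≤ 1) : ∃ q₂ : ℝ, 0 ≤ q₂ ∧ q₂ ≤ (p * A / M) ^ 2 ∧ 2 * (p * A / M) - 1 ≤ q₂ ∧
      ∀ (c : Vec d) (z : Fin M → Vec d),
        ∫ w, ‖c + ∑ i, anchorInd w i • z i‖ ^ 2 ∂(selectLaw M A p)
          = ‖c‖ ^ 2 + 2 * (p * A / M) * inner ℝ c (∑ i, z i) + q₂ * ‖∑ i, z i‖ ^ 2
            + (p * A / M - q₂) * ∑ i, ‖z i‖ ^ 2 := by
  have := isProbabilityMeasure_selectLaw hAM hp0 hp1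
  set q : ℝ := p * A / M with hq
  have key : ∀ q₂ : ℝ, (∀ i j : Fin M, i ≠ j →
      ∫ w, anchorInd w i * anchorInd w j ∂(selectLaw M A p) = q₂) →
      ∀ (c : Vec d) (z : Fin M → Vec d),
        ∫ w, ‖c + ∑ i, anchorInd w i • z i‖ ^ 2 ∂(selectLaw M A p)
          = ‖c‖ ^ 2 + 2 * q * inner ℝ c (∑ i, z i) + q₂ * ‖∑ i, z i‖ ^ 2
            + (q - q₂) * ∑ i, ‖z i‖ ^ 2 := fun q₂ hq₂ c z => by
    have h1 : ∀ w, ‖c + ∑ i, anchorInd w i • z i‖ ^ 2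
        = ‖c‖ ^ 2 + 2 * (∑ i, anchorInd w i * inner ℝ c (z i))
          + ∑ i, ∑ j, anchorInd w i * anchorInd w j * inner ℝ (z i) (z j) := fun w => by
      rw [norm_add_sq_real, inner_sum, ← real_inner_self_eq_norm_sq (∑ i, anchorInd w i • z i),
        sum_inner]
      simp_rw [inner_sum, real_inner_smul_left, real_inner_smul_right, mul_assoc]
    have h2 : ∀ i j, ∫ w, anchorInd w i * anchorInd w j ∂(selectLaw M A p)
        = q₂ + if i = j then q - q₂ else 0 := fun i j => by
      split_ifs with h
      · subst h
        simp_rw [anchorInd_mul_self]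
        rw [integral_anchorInd hAM hp0 hp1]
        ring
      · rw [hq₂ i j h, add_zero]
    have h3 : ‖∑ i, z i‖ ^ 2 = ∑ i, ∑ j, inner ℝ (z i) (z j) := by
      rw [← real_inner_self_eq_norm_sq, sum_inner]
      simp_rw [inner_sum]
    simp_rw [h1]
    rw [integral_add Integrable.of_finite Integrable.of_finite,
      integral_add Integrable.of_finite Integrable.of_finite, integral_const_mul,
      integral_finsetSum _ fun _ _ => Integrable.of_finite,
      integral_finsetSum _ fun _ _ => Integrable.of_finite]
    simp_rw [integral_finsetSum _ fun _ _ => (Integrable.of_finite :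
      Integrable _ (selectLaw M A p)), integral_mul_const, h2, integral_anchorInd hAM hp0 hp1,
      add_mul, Finset.sum_add_distrib, ite_mul, zero_mul, Finset.sum_ite_eq, Finset.mem_univ,
      if_true, real_inner_self_eq_norm_sq, ← Finset.mul_sum]
    rw [h3, inner_sum]
    simp
    ring
  by_cases hM : M = 1
  -- A single client has no pairs, so `q₂` is arbitrary and `q²` meets all the bounds.
  · refine ⟨q ^ 2, sq_nonneg _, le_rfl, by nlinarith [sq_nonneg (q - 1)], key _ fun i j hij => ?_⟩
    subst hM
    exact absurd (Subsingleton.elim i j) hij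
  · have hM2 : 2 ≤ M := by omega
    have hMr : (2 : ℝ) ≤ M := by exact_mod_cast hM2
    have hAr : (1 : ℝ) ≤ A := by exact_mod_cast hA
    have hAMr : (A : ℝ) ≤ M := by exact_mod_cast hAM
    have hM1 : (0 : ℝ) < M - 1 := by linarith
    have hM0 : (0 : ℝ) < M := by linarith
    -- Here `q₂` is the probability that two given clients are both anchors. It is at most `q²`
    -- because sampling without replacement is negatively correlated.
    refine ⟨p ^ 2 * (A * (A - 1) / (M * (M - 1))), ?_, ?_, ?_,
      key _ fun i j hij => integral_anchorInd_mul hAM hp0 hp1 hij⟩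
    · have : (0 : ℝ) ≤ A - 1 := by linarith
      positivity
    · have hq2 : q ^ 2 = p ^ 2 * (A / M : ℝ) ^ 2 := by rw [hq]; ring
      rw [hq2]
      gcongr
      rw [div_pow, div_le_div_iff₀ (by positivity) (by positivity)]
      have : (0 : ℝ) ≤ A * M * (M - A) :=
        mul_nonneg (by positivity) (by linarith)
      nlinarith
    · let i : Fin M := ⟨0, by omega⟩
      let j : Fin M := ⟨1, by omega⟩
      have hij : i ≠ j := by simp [i, j]
      -- The probability that neither of two clients is an anchor equals `1 - 2q + q₂`.
      have h0 : 0 ≤ ∫ w, (1 - anchorInd w i) * (1 - anchorInd w j) ∂(selectLaw M A p) := by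
        refine integral_nonneg fun w => mul_nonneg ?_ ?_ <;>
        · rw [anchorInd_eq_ite]
          split_ifs <;> norm_num
      have h1 : ∀ w : (Fin M → Bool) × (Fin M → Bool), (1 - anchorInd w i) * (1 - anchorInd w j)
          = (1 - anchorInd w i) - anchorInd w j + anchorInd w i * anchorInd w j := fun w => by ring
      simp_rw [h1] at h0
      rw [integral_add Integrable.of_finite Integrable.of_finite,
        integral_sub Integrable.of_finite Integrable.of_finite,
        integral_sub Integrable.of_finite Integrable.of_finite,
        integral_anchorInd hAM hp0 hp1, integral_anchorInd hAM hp0 hp1,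
        integral_anchorInd_mul hAM hp0 hp1 hij] at h0
      simp at h0
      rw [hq]
      linarith

end Selection

/-! ### One round on the augmented state -/

section Round

variable {Z : Type*} [MeasurableSpace Z] {d M : ℕ} (P : Problem Z d M) (H : Params)

/-- The mean update direction of miner `i`. -/
noncomputable def minerDir (x g : Vec d) (i : Fin M) (B : Fin H.K → Fin H.b' → Z) : Vec d :=
  (H.K * H.ηl : ℝ)⁻¹ • (x - (minerRun P H.ηl i x g H.K B).2.1)

/-- The average of the mean update directions of the miners. -/
noncomputable def avgDir (x g : Vec d) (w : (Fin M → Bool) × (Fin M → Bool))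
    (B : Fin M → Fin H.K → Fin H.b' → Z) : Vec d :=
  ((miners w).card : ℝ)⁻¹ • ∑ i ∈ miners w, minerDir P H x g i (B i)

/-- The average `g_t` of the caching gradients. -/
noncomputable def meanGrad (v : Fin M → Vec d) : Vec d := (M : ℝ)⁻¹ • ∑ i, v i

/-- The effective step size of a round. -/
noncomputable def Params.stepSize : ℝ := H.ηs * (H.K * H.ηl)

/-- The state together with the models at which the clients were anchors for the last time. -/
abbrev AugState (d M : ℕ) : Type := State d M × (Fin M → Vec d)

/-- One round of the algorithm on the augmented state. -/
noncomputable def augStep (a : AugState d M) (w : Seed Z M H) : AugState d M :=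
  (step P H a.1 w, fun i => if w.1 i = true ∧ w.2.1 i = true then a.1.1 else a.2 i)

variable {P H}

/-- Without miners the averaged direction is an empty sum, hence zero, so one formula covers both
branches of the round. -/
theorem step_fst (hKη : (H.K * H.ηl : ℝ) ≠ 0) (st : State d M) (w : Seed Z M H) :
    (step P H st w).1 = st.1
      - H.stepSize • avgDir P H st.1 (meanGrad st.2.1) (w.1, w.2.1) w.2.2.2 := by
  have h1 : ∀ i, st.1 - (minerRun P H.ηl i st.1 (meanGrad st.2.1) H.K (w.2.2.2 i)).2.1
      = (H.K * H.ηl : ℝ) • minerDir P H st.1 (meanGrad st.2.1) i (w.2.2.2 i) := fun i => by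
    rw [minerDir, smul_smul, mul_inv_cancel₀ hKη, one_smul]
  simp only [meanGrad] at h1
  simp only [step, h1]
  split_ifs with h
  · have : (miners (w.1, w.2.1)) = ∅ := Finset.card_eq_zero.1 h
    simp [avgDir, this]
  · rw [← Finset.smul_sum, Params.stepSize, mul_smul H.ηs, avgDir,
      smul_comm (H.K * H.ηl : ℝ) ((miners (w.1, w.2.1)).card : ℝ)⁻¹]
    rfl

theorem step_snd_fst (st : State d M) (w : Seed Z M H) (i : Fin M) :
    (step P H st w).2.1 i = st.2.1 i
      + anchorInd (w.1, w.2.1) i • (P.batchGrad i (w.2.2.1 i) st.1 - st.2.1 i) := by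
  simp only [step, anchorInd_eq_ite]
  split_ifs <;> simp

theorem augStep_snd (a : AugState d M) (w : Seed Z M H) (i : Fin M) :
    (augStep P H a w).2 i = a.2 i + anchorInd (w.1, w.2.1) i • (a.1.1 - a.2 i) := by
  simp only [augStep, anchorInd_eq_ite]
  split_ifs <;> simp

theorem measurable_sel {α : Type*} [MeasurableSpace α]
    (f : (Fin M → Bool) × (Fin M → Bool) → ℝ) :
    Measurable fun q : α × Seed Z M H => f (q.2.1, q.2.2.1) :=
  (measurable_of_countable f).comp
    (measurable_snd.fst.prodMk measurable_snd.snd.fst)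

theorem measurable_meanGrad : Measurable (meanGrad (d := d) (M := M)) :=
  (Finset.measurable_sum Finset.univ fun i _ => measurable_pi_apply i).const_smul (M : ℝ)⁻¹

theorem measurable_minerDir
    (hm : ∀ i, Measurable fun q : Vec d × (Fin H.b' → Z) => P.batchGrad i q.2 q.1) (i : Fin M) :
    Measurable fun q : (Vec d × Vec d) × (Fin H.K → Fin H.b' → Z) =>
      minerDir P H q.1.1 q.1.2 i q.2 := by
  have h := measurable_minerRun (hm i) H.ηl H.K
  exact (measurable_fst.fst.sub h.snd.fst).const_smul (H.K * H.ηl : ℝ)⁻¹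

theorem measurable_avgDir
    (hm : ∀ i, Measurable fun q : Vec d × (Fin H.b' → Z) => P.batchGrad i q.2 q.1) :
    Measurable fun q : State d M × Seed Z M H =>
      avgDir P H q.1.1 (meanGrad q.1.2.1) (q.2.1, q.2.2.1) q.2.2.2.2 := by
  have h1 : ∀ i, Measurable fun q : State d M × Seed Z M H =>
      minerDir P H q.1.1 (meanGrad q.1.2.1) i (q.2.2.2.2 i) := fun i => by
    have h2 : Measurable fun q : State d M × Seed Z M H =>
        ((q.1.1, meanGrad q.1.2.1), q.2.2.2.2 i) :=
      (measurable_fst.fst.prodMk (measurable_meanGrad.comp measurable_fst.snd.fst)).prodMk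
        ((measurable_pi_apply i).comp measurable_snd.snd.snd.snd)
    have h3 := (measurable_minerDir hm i).comp h2
    exact h3
  have h4 : ∀ q : State d M × Seed Z M H,
      avgDir P H q.1.1 (meanGrad q.1.2.1) (q.2.1, q.2.2.1) q.2.2.2.2
        = ((miners (q.2.1, q.2.2.1)).card : ℝ)⁻¹ • ∑ i,
          (if i ∈ miners (q.2.1, q.2.2.1) then (1 : ℝ) else 0)
            • minerDir P H q.1.1 (meanGrad q.1.2.1) i (q.2.2.2.2 i) := fun q => by
    simp only [avgDir, ite_smul, one_smul, zero_smul, Finset.sum_ite_mem, Finset.univ_inter]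
  simp_rw [h4]
  refine (measurable_sel fun w => ((miners w).card : ℝ)⁻¹).smul
    (Finset.measurable_sum _ fun i _ => ?_)
  exact (measurable_sel fun w => if i ∈ miners w then (1 : ℝ) else 0).smul (h1 i)

theorem measurable_step (hKη : (H.K * H.ηl : ℝ) ≠ 0)
    (hb : ∀ i, Measurable fun q : Vec d × (Fin H.b → Z) => P.batchGrad i q.2 q.1)
    (hm : ∀ i, Measurable fun q : Vec d × (Fin H.b' → Z) => P.batchGrad i q.2 q.1) :
    Measurable fun q : State d M × Seed Z M H => step P H q.1 q.2 := by
  refine Measurable.prodMk (f := fun q : State d M × Seed Z M H => (step P H q.1 q.2).1)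
    (g := fun q => (step P H q.1 q.2).2) ?_ (Measurable.prodMk
    (f := fun q : State d M × Seed Z M H => (step P H q.1 q.2).2.1)
    (g := fun q => (step P H q.1 q.2).2.2) ?_ ?_)
  · simp_rw [step_fst hKη]
    exact measurable_fst.fst.sub ((measurable_avgDir hm).const_smul H.stepSize)
  · refine measurable_pi_lambda _ fun i => ?_
    simp_rw [step_snd_fst]
    have h1 : Measurable fun q : State d M × Seed Z M H => q.1.2.1 i :=
      (measurable_pi_apply i).comp measurable_fst.snd.fst
    have h2 : Measurable fun q : State d M × Seed Z M H => P.batchGrad i (q.2.2.2.1 i) q.1.1 :=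
      measurable_batchGrad_comp (hb i) measurable_fst.fst
        ((measurable_pi_apply i).comp measurable_snd.snd.snd.fst)
    exact h1.add ((measurable_sel fun w => anchorInd w i).smul (h2.sub h1))
  · have h1 : Measurable fun w : (Fin M → Bool) × (Fin M → Bool) =>
        (Finset.univ.filter fun i => w.1 i = true ∧ w.2 i = true).card * H.b
          + (miners w).card * (H.K * H.b') := measurable_of_countable _
    have h2 : Measurable fun q : State d M × Seed Z M H => ((q.2.1, q.2.2.1) : _ × _) :=
      measurable_snd.fst.prodMk measurable_snd.snd.fst
    have h0 : Measurable fun q : State d M × Seed Z M H => q.1.2.2 := measurable_fst.snd.snd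
    have h3 := h0.add (h1.comp h2)
    convert h3 using 1
    funext q
    exact add_assoc _ _ _

theorem measurable_augStep (hKη : (H.K * H.ηl : ℝ) ≠ 0)
    (hb : ∀ i, Measurable fun q : Vec d × (Fin H.b → Z) => P.batchGrad i q.2 q.1)
    (hm : ∀ i, Measurable fun q : Vec d × (Fin H.b' → Z) => P.batchGrad i q.2 q.1) :
    Measurable fun q : AugState d M × Seed Z M H => augStep P H q.1 q.2 := by
  refine Measurable.prodMk (f := fun q : AugState d M × Seed Z M H => (augStep P H q.1 q.2).1)
    (g := fun q => (augStep P H q.1 q.2).2) ?_ ?_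
  · have h := (measurable_step hKη hb hm).comp
      ((measurable_fst.fst.prodMk measurable_snd :
        Measurable fun q : AugState d M × Seed Z M H => (q.1.1, q.2)))
    exact h
  · refine measurable_pi_lambda _ fun i => ?_
    simp_rw [augStep_snd]
    have h1 : Measurable fun q : AugState d M × Seed Z M H => q.1.2 i :=
      (measurable_pi_apply i).comp measurable_fst.snd
    exact h1.add ((measurable_sel fun w => anchorInd w i).smul (measurable_fst.fst.fst.sub h1))

end Round

/-! ### Evolution of the sampling errors in one round -/

section OneRound

variable {Z : Type*} [MeasurableSpace Z] {d M : ℕ} {P : Problem Z d M} {H : Params}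
  {L S : ℝ}

/-- The properties of the stochastic gradients and of the parameters that the analysis uses: `S`
bounds the variance of the gradient on a large batch. -/
structure Setting (P : Problem Z d M) (H : Params) (L S : ℝ) : Prop where
  smooth : P.Smooth L
  pos : 0 < L
  measurable_big : ∀ i, Measurable fun q : Vec d × (Fin H.b → Z) => P.batchGrad i q.2 q.1
  measurable_small : ∀ i, Measurable fun q : Vec d × (Fin H.b' → Z) => P.batchGrad i q.2 q.1
  prob_big : ∀ i, IsProbabilityMeasure (P.data.batchLaw i H.b)
  prob_small : ∀ i, IsProbabilityMeasure (P.data.batchLaw i H.b')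
  noise_big : ∀ i v, IsNoise (P.data.batchLaw i H.b)
    (fun B : Fin H.b → Z => P.batchGrad i B v - ∇ (P.localObj i) v) S
  noise_small : ∃ C, 0 ≤ C ∧ 2 * C ≤ H.K * L ^ 2 ∧ ∀ i v w, IsNoise (P.data.batchLaw i H.b')
    (fun B : Fin H.b' → Z => (P.batchGrad i B v - P.batchGrad i B w)
      - (∇ (P.localObj i) v - ∇ (P.localObj i) w)) (C * ‖v - w‖ ^ 2)
  one_le_A : 1 ≤ H.A
  A_le : H.A ≤ M
  one_le_K : 1 ≤ H.K
  p_nonneg : 0 ≤ H.p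
  p_le_one : H.p ≤ 1
  ηl_pos : 0 < H.ηl
  ηl_sq : 24 * (H.K : ℝ) ^ 2 * L ^ 2 * H.ηl ^ 2 = 1

/-- The law of all batches of a round. -/
noncomputable def batchesLaw (P : Problem Z d M) (H : Params) :
    Measure ((Fin M → Fin H.b → Z) × (Fin M → Fin H.K → Fin H.b' → Z)) :=
  (Measure.pi fun i => P.data.batchLaw i H.b).prod
    (Measure.pi fun i => Measure.pi fun _ : Fin H.K => P.data.batchLaw i H.b')

/-- The errors of the caching gradients `v` at the models `y` where they were computed. -/
noncomputable def cacheError (P : Problem Z d M) (a : AugState d M) (i : Fin M) : Vec d :=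
  a.1.2.1 i - ∇ (P.localObj i) (a.2 i)

/-- The mean squared distance between the model and the last anchor models. -/
noncomputable def staleness (a : AugState d M) : ℝ := (M : ℝ)⁻¹ * ∑ i, ‖a.1.1 - a.2 i‖ ^ 2

/-- The Lyapunov function of the analysis. -/
noncomputable def potential (P : Problem Z d M) (c ν μ : ℝ) (a : AugState d M) : ℝ :=
  (P.obj a.1.1 - c) + ν * ‖meanGrad a.1.2.1‖ ^ 2 + μ * staleness a

namespace Setting

theorem S_nonneg (hs : Setting P H L S) : 0 ≤ S :=
  (hs.noise_big ⟨0, lt_of_lt_of_le hs.one_le_A hs.A_le⟩ 0).nonneg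

theorem M_pos (hs : Setting P H L S) : (0 : ℝ) < M := by
  exact_mod_cast lt_of_lt_of_le hs.one_le_A hs.A_le

theorem Kη_pos (hs : Setting P H L S) : (0 : ℝ) < H.K * H.ηl :=
  mul_pos (by exact_mod_cast hs.one_le_K) hs.ηl_pos

theorem isProbabilityMeasure_batchesLaw (hs : Setting P H L S) :
    IsProbabilityMeasure (batchesLaw P H) := by
  have := hs.prob_big
  have := hs.prob_small
  exact inferInstanceAs (IsProbabilityMeasure (Measure.prod _ _))

theorem isProbabilityMeasure_seedLaw (hs : Setting P H L S) :
    IsProbabilityMeasure (seedLaw P H) := by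
  have := hs.prob_big
  have := hs.prob_small
  have := isProbabilityMeasure_participantLaw hs.A_le
  have := isProbabilityMeasure_coinLaw hs.p_nonneg hs.p_le_one
  exact inferInstanceAs (IsProbabilityMeasure (Measure.prod _ _))

/-- Batches are integrated first, for fixed participants and coins. The remaining integral is over a
finite space, where exact computations are possible. -/
theorem expLE_seedLaw (hs : Setting P H L S) {f : Seed Z M H → ℝ} (hf : Measurable f)
    {T : (Fin M → Bool) × (Fin M → Bool) → ℝ} {c : ℝ}
    (hT : ∀ w, ExpLE (batchesLaw P H) (fun q => f (w.1, w.2, q)) (T w)) (hT0 : ∀ w, 0 ≤ T w)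
    (hc : ∫ w, T w ∂(selectLaw M H.A H.p) ≤ c) : ExpLE (seedLaw P H) f c := by
  have := hs.prob_big
  have := hs.prob_small
  have := hs.isProbabilityMeasure_batchesLaw
  have := isProbabilityMeasure_participantLaw hs.A_le
  have := isProbabilityMeasure_coinLaw hs.p_nonneg hs.p_le_one
  have h1 : ∀ s, ExpLE ((Measure.pi fun _ : Fin M => coinLaw H.p).prod (batchesLaw P H))
      (fun q => f (s, q)) (∫ co, T (s, co) ∂(Measure.pi fun _ : Fin M => coinLaw H.p)) := fun s =>
    ExpLE.prod (h := fun co => T (s, co)) (hf.comp measurable_prodMk_left) (fun co => hT (s, co))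
      (ExpLE.of_integral Integrable.of_finite (fun co => hT0 _) le_rfl)
  refine ExpLE.prod hf h1 (ExpLE.of_integral Integrable.of_finite
    (fun s => integral_nonneg fun co => hT0 _) ?_)
  rw [selectLaw, integral_prod _ Integrable.of_finite] at hc
  exact hc

theorem expLE_big (hs : Setting P H L S) {F : (Fin M → Fin H.b → Z) → ℝ} {c : ℝ} (hF : Measurable F)
    (h : ExpLE (Measure.pi fun i => P.data.batchLaw i H.b) F c) :
    ExpLE (batchesLaw P H) (fun q => F q.1) c := by
  have := hs.prob_big
  have := hs.prob_small
  exact h.comp measurePreserving_fst hF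

theorem expLE_big_apply (hs : Setting P H L S) (i : Fin M)
    {F : (Fin H.b → Z) → ℝ} {c : ℝ} (hF : Measurable F)
    (h : ExpLE (P.data.batchLaw i H.b) F c) :
    ExpLE (batchesLaw P H) (fun q => F (q.1 i)) c := by
  have := hs.prob_big
  have hmp : MeasurePreserving (fun B : Fin M → Fin H.b → Z => B i)
      (Measure.pi fun i => P.data.batchLaw i H.b) (P.data.batchLaw i H.b) :=
    measurePreserving_eval (fun i => P.data.batchLaw i H.b) i
  have h1 := h.comp hmp hF
  exact hs.expLE_big (F := fun B => F (B i)) (hF.comp (measurable_pi_apply i)) h1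

theorem expLE_small_apply (hs : Setting P H L S) (i : Fin M)
    {F : (Fin H.K → Fin H.b' → Z) → ℝ} {c : ℝ}
    (hF : Measurable F)
    (h : ExpLE (Measure.pi fun _ : Fin H.K => P.data.batchLaw i H.b') F c) :
    ExpLE (batchesLaw P H) (fun q => F (q.2 i)) c := by
  have := hs.prob_big
  have := hs.prob_small
  have h1 : MeasurePreserving (fun q : (Fin M → Fin H.b → Z) × (Fin M → Fin H.K → Fin H.b' → Z) =>
      q.2 i) (batchesLaw P H) (Measure.pi fun _ : Fin H.K => P.data.batchLaw i H.b') :=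
    (measurePreserving_eval (fun i => Measure.pi fun _ : Fin H.K => P.data.batchLaw i H.b')
      i).comp measurePreserving_snd
  exact h.comp h1 hF

/-- The reference model of an anchor moves to `x_t` together with its cache, so the old error is
replaced entirely by fresh noise. -/
theorem cacheError_augStep (a : AugState d M) (w : Seed Z M H) (i : Fin M) :
    cacheError P (augStep P H a w) i
      = (cacheError P a i + anchorInd (w.1, w.2.1) i • (-cacheError P a i))
        + anchorInd (w.1, w.2.1) i
          • (P.batchGrad i (w.2.2.1 i) a.1.1 - ∇ (P.localObj i) a.1.1) := by
  simp only [cacheError, augStep, step, anchorInd_eq_ite]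
  split_ifs <;> simp

theorem measurable_augStep_seed (hs : Setting P H L S) (a : AugState d M) :
    Measurable fun w => augStep P H a w :=
  (measurable_augStep hs.Kη_pos.ne' hs.measurable_big hs.measurable_small).comp
    (measurable_prodMk_left (x := a))

theorem measurable_cacheError (hs : Setting P H L S) (i : Fin M) :
    Measurable fun a : AugState d M => cacheError P a i := by
  have h1 : Measurable fun a : AugState d M => a.1.2.1 i :=
    (measurable_pi_apply i).comp measurable_fst.snd.fst
  have h2 : Measurable fun a : AugState d M => ∇ (P.localObj i) (a.2 i) := by
    have h0 : Measurable fun a : AugState d M => a.2 i :=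
      (measurable_pi_apply i).comp measurable_snd
    have h := (Problem.measurable_gradient_localObj hs.smooth i).comp h0
    exact h
  exact h1.sub h2

theorem measurable_norm_sum_cacheError_sq (hs : Setting P H L S) :
    Measurable fun a : AugState d M => ‖∑ i, cacheError P a i‖ ^ 2 :=
  (Finset.measurable_sum _ fun i _ => hs.measurable_cacheError i).norm.pow_const 2

theorem measurable_sum_norm_cacheError_sq (hs : Setting P H L S) :
    Measurable fun a : AugState d M => ∑ i, ‖cacheError P a i‖ ^ 2 :=
  Finset.measurable_sum _ fun i _ => (hs.measurable_cacheError i).norm.pow_const 2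

/-- The random selection multiplies the old errors by indicators, and its second-moment formula is
applied with `c = Σ e_i` and `z_i = -e_i`. Fresh noise is independent across clients and contributes
`S` per anchor. -/
theorem expLE_norm_sum_cacheError_sq (hs : Setting P H L S) {q₂ : ℝ} {a : AugState d M}
    (hq₂ : ∀ (c : Vec d) (z : Fin M → Vec d),
        ∫ w, ‖c + ∑ i, anchorInd w i • z i‖ ^ 2 ∂(selectLaw M H.A H.p)
          = ‖c‖ ^ 2 + 2 * (H.p * H.A / M) * inner ℝ c (∑ i, z i) + q₂ * ‖∑ i, z i‖ ^ 2
            + (H.p * H.A / M - q₂) * ∑ i, ‖z i‖ ^ 2) :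
    ExpLE (seedLaw P H) (fun w => ‖∑ i, cacheError P (augStep P H a w) i‖ ^ 2)
      ((1 - 2 * (H.p * H.A / M) + q₂) * ‖∑ i, cacheError P a i‖ ^ 2
        + (H.p * H.A / M - q₂) * ∑ i, ‖cacheError P a i‖ ^ 2 + H.p * H.A / M * (M * S)) := by
  have := isProbabilityMeasure_selectLaw hs.A_le hs.p_nonneg hs.p_le_one
  have := hs.prob_big
  refine hs.expLE_seedLaw
    (hs.measurable_norm_sum_cacheError_sq.comp (hs.measurable_augStep_seed a))
    (T := fun w => ‖∑ i, cacheError P a i + ∑ i, anchorInd w i • (-cacheError P a i)‖ ^ 2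
      + ∑ i, anchorInd w i * S) (fun w => ?_)
    (fun w => add_nonneg (sq_nonneg _) (Finset.sum_nonneg fun i _ =>
      mul_nonneg (anchorInd_nonneg w i) hs.S_nonneg)) ?_
  · have h1 := IsNoise.expLE_norm_add_sum_sq
      (fun i => (hs.noise_big i a.1.1).smul (anchorInd w i))
      (∑ i, cacheError P a i + ∑ i, anchorInd w i • (-cacheError P a i))
    have hm : Measurable fun B : Fin M → Fin H.b → Z =>
        ‖(∑ i, cacheError P a i + ∑ i, anchorInd w i • (-cacheError P a i))
          + ∑ i, anchorInd w i • (P.batchGrad i (B i) a.1.1 - ∇ (P.localObj i) a.1.1)‖ ^ 2 :=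
      (measurable_const.add (Finset.measurable_sum Finset.univ fun i _ =>
        ((hs.noise_big i a.1.1).smul (anchorInd w i)).measurable.comp
          (measurable_pi_apply i))).norm.pow_const 2
    refine (hs.expLE_big hm h1).mono (fun q => le_of_eq ?_) (le_of_eq ?_)
    · change ‖∑ i, cacheError P (augStep P H a (w.1, w.2, q)) i‖ ^ 2 = _
      simp_rw [cacheError_augStep]
      rw [Finset.sum_add_distrib, Finset.sum_add_distrib]
    · simp only [pow_two (anchorInd w _), anchorInd_mul_self]
  · rw [integral_add Integrable.of_finite Integrable.of_finite, hq₂,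
      integral_finsetSum _ fun _ _ => Integrable.of_finite]
    simp_rw [integral_mul_const, integral_anchorInd hs.A_le hs.p_nonneg hs.p_le_one]
    simp only [Finset.sum_neg_distrib, inner_neg_right, real_inner_self_eq_norm_sq, norm_neg,
      Finset.sum_const, Finset.card_univ, Fintype.card_fin, nsmul_eq_mul]
    apply le_of_eq
    ring

theorem expLE_sum_norm_cacheError_sq (hs : Setting P H L S) (a : AugState d M) :
    ExpLE (seedLaw P H) (fun w => ∑ i, ‖cacheError P (augStep P H a w) i‖ ^ 2)
      ((1 - H.p * H.A / M) * ∑ i, ‖cacheError P a i‖ ^ 2 + H.p * H.A / M * (M * S)) := by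
  have := isProbabilityMeasure_selectLaw hs.A_le hs.p_nonneg hs.p_le_one
  have hα : ∀ (w : (Fin M → Bool) × (Fin M → Bool)) i, 0 ≤ 1 - anchorInd w i := fun w i => by
    rw [anchorInd_eq_ite]
    split_ifs <;> norm_num
  refine hs.expLE_seedLaw
    (hs.measurable_sum_norm_cacheError_sq.comp (hs.measurable_augStep_seed a))
    (T := fun w => ∑ i, ((1 - anchorInd w i) * ‖cacheError P a i‖ ^ 2 + anchorInd w i * S))
    (fun w => ?_) (fun w => Finset.sum_nonneg fun i _ => add_nonneg
      (mul_nonneg (hα w i) (sq_nonneg _)) (mul_nonneg (anchorInd_nonneg w i) hs.S_nonneg)) ?_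
  · have := hs.isProbabilityMeasure_batchesLaw
    have h1 : ∀ i, ExpLE (batchesLaw P H) (fun q => (1 - anchorInd w i) * ‖cacheError P a i‖ ^ 2
        + anchorInd w i * ‖P.batchGrad i (q.1 i) a.1.1 - ∇ (P.localObj i) a.1.1‖ ^ 2)
        ((1 - anchorInd w i) * ‖cacheError P a i‖ ^ 2 + anchorInd w i * S) := fun i =>
      (ExpLE.const _).add ((hs.expLE_big_apply i
        ((hs.noise_big i a.1.1).measurable.norm.pow_const 2)
        (hs.noise_big i a.1.1).expLE).const_mul (anchorInd_nonneg w i)) measurable_const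
        (mul_nonneg (hα w i) (sq_nonneg _)) (mul_nonneg (anchorInd_nonneg w i) hs.S_nonneg)
    refine (ExpLE.sum Finset.univ (fun i _ => h1 i) (fun i => ?_) (fun i => add_nonneg
      (mul_nonneg (hα w i) (sq_nonneg _)) (mul_nonneg (anchorInd_nonneg w i) hs.S_nonneg))).mono
      (fun q => Finset.sum_le_sum fun i _ => le_of_eq ?_) le_rfl
    · exact measurable_const.add ((((hs.noise_big i a.1.1).measurable.comp
        ((measurable_pi_apply i).comp measurable_fst)).norm.pow_const 2).const_mul _)
    · rw [cacheError_augStep]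
      simp only [anchorInd_eq_ite]
      split_ifs <;> simp
  · rw [integral_finsetSum _ fun _ _ => Integrable.of_finite]
    have h2 : ∀ i, ∫ w, ((1 - anchorInd w i) * ‖cacheError P a i‖ ^ 2 + anchorInd w i * S)
        ∂(selectLaw M H.A H.p)
        = (1 - H.p * H.A / M) * ‖cacheError P a i‖ ^ 2 + H.p * H.A / M * S := fun i => by
      rw [integral_add Integrable.of_finite Integrable.of_finite, integral_mul_const,
        integral_mul_const, integral_sub Integrable.of_finite Integrable.of_finite,
        integral_anchorInd hs.A_le hs.p_nonneg hs.p_le_one]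
      simp
    simp_rw [h2]
    rw [Finset.sum_add_distrib, ← Finset.mul_sum]
    simp only [Finset.sum_const, Finset.card_univ, Fintype.card_fin, nsmul_eq_mul]
    apply le_of_eq
    ring

end Setting

end OneRound

/-! ### Expected change of the potential -/

section Descent

variable {Z : Type*} [MeasurableSpace Z] {d M : ℕ} {P : Problem Z d M} {H : Params}
  {L S : ℝ}

theorem avgDir_eq_zero {x g : Vec d} {w : (Fin M → Bool) × (Fin M → Bool)}
    {B : Fin M → Fin H.K → Fin H.b' → Z} (hw : (miners w).card = 0) : avgDir P H x g w B = 0 := by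
  simp [avgDir, Finset.card_eq_zero.1 hw]

/-- Convexity of the squared norm bounds the average by individual miners, each of which is
estimated separately. -/
theorem minerInd_mul_avgDir_le (x g h : Vec d) (w : (Fin M → Bool) × (Fin M → Bool))
    (B : Fin M → Fin H.K → Fin H.b' → Z) :
    minerInd w * (1 / 8 * ‖avgDir P H x g w B‖ ^ 2 + 1 / 2 * ‖avgDir P H x g w B - h‖ ^ 2)
      ≤ ((miners w).card : ℝ)⁻¹ * ∑ i ∈ miners w, (1 / 8 * ‖minerDir P H x g i (B i)‖ ^ 2
        + 1 / 2 * ‖minerDir P H x g i (B i) - h‖ ^ 2) := by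
  by_cases hw : (miners w).card = 0
  · simp [minerInd, hw]
  · have hne : (miners w).Nonempty := Finset.card_pos.1 (Nat.pos_of_ne_zero hw)
    have hc : ((miners w).card : ℝ) ≠ 0 := by exact_mod_cast hw
    have h1 := norm_sum_smul_sq_le (miners w) hne fun i => minerDir P H x g i (B i)
    have h2 := norm_sum_smul_sq_le (miners w) hne fun i => minerDir P H x g i (B i) - h
    have h3 : avgDir P H x g w B - h = ((miners w).card : ℝ)⁻¹ • ∑ i ∈ miners w,
        (minerDir P H x g i (B i) - h) := by
      rw [Finset.sum_sub_distrib, Finset.sum_const, smul_sub, ← Nat.cast_smul_eq_nsmul ℝ, smul_smul,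
        inv_mul_cancel₀ hc, one_smul, avgDir]
    rw [minerInd, if_neg hw, one_mul, h3, Finset.sum_add_distrib, ← Finset.mul_sum,
      ← Finset.mul_sum]
    simp only [avgDir]
    linarith

namespace Setting

/-- The inner product with the gradient is polarised, so the gain in `‖∇F‖²` and in `‖u‖²` stands
against the single error `‖u - ∇F‖²`. -/
theorem obj_sub_smul_le (hs : Setting P H L S) (x u : Vec d) (γ : ℝ) :
    P.obj (x - γ • u) ≤ P.obj x - γ / 2 * ‖∇ P.obj x‖ ^ 2 - γ / 2 * (1 - γ * L) * ‖u‖ ^ 2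
      + γ / 2 * ‖u - ∇ P.obj x‖ ^ 2 := by
  have h1 := le_add_inner_add_norm_sq (Problem.differentiable_obj hs.smooth)
    (Problem.norm_gradient_obj_sub_le hs.smooth hs.pos.le) x (-(γ • u))
  rw [← sub_eq_add_neg, inner_neg_right, real_inner_smul_right, norm_neg, norm_smul, mul_pow,
    Real.norm_eq_abs, sq_abs] at h1
  have h2 := norm_sub_sq_real u (∇ P.obj x)
  rw [real_inner_comm] at h2
  rw [h2]
  linarith

theorem obj_step_le (hs : Setting P H L S) (st : State d M) (w : Seed Z M H) :
    P.obj (step P H st w).1 ≤ P.obj st.1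
      - H.stepSize / 2 * (minerInd (w.1, w.2.1) * ‖∇ P.obj st.1‖ ^ 2)
      - H.stepSize / 2 * (1 - H.stepSize * L)
        * ‖avgDir P H st.1 (meanGrad st.2.1) (w.1, w.2.1) w.2.2.2‖ ^ 2
      + H.stepSize / 2 * (minerInd (w.1, w.2.1)
        * ‖avgDir P H st.1 (meanGrad st.2.1) (w.1, w.2.1) w.2.2.2 - ∇ P.obj st.1‖ ^ 2) := by
  rw [step_fst hs.Kη_pos.ne']
  by_cases hw : (miners (w.1, w.2.1)).card = 0
  · simp [minerInd, hw, avgDir_eq_zero hw]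
  · rw [minerInd, if_neg hw, one_mul, one_mul]
    exact hs.obj_sub_smul_le _ _ _

/-- The reference model of an anchor becomes `x_t`, leaving only the new step; all others add the
step to their old distance by Young with weights `q/2` and `2/q`, half of the decay being spent on
the expansion. -/
theorem staleness_augStep_le (hs : Setting P H L S) (a : AugState d M) (w : Seed Z M H) {q : ℝ}
    (hq : 0 < q) :
    staleness (augStep P H a w) ≤ (1 + q / 2)
        * ((M : ℝ)⁻¹ * ∑ i, (1 - anchorInd (w.1, w.2.1) i) * ‖a.1.1 - a.2 i‖ ^ 2)
      + (1 + 2 / q) * (H.stepSize ^ 2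
        * ‖avgDir P H a.1.1 (meanGrad a.1.2.1) (w.1, w.2.1) w.2.2.2‖ ^ 2) := by
  have hM := hs.M_pos
  set u := avgDir P H a.1.1 (meanGrad a.1.2.1) (w.1, w.2.1) w.2.2.2 with hu
  have h1 : ∀ i, ‖(augStep P H a w).1.1 - (augStep P H a w).2 i‖ ^ 2
      ≤ (1 + q / 2) * ((1 - anchorInd (w.1, w.2.1) i) * ‖a.1.1 - a.2 i‖ ^ 2)
        + (1 + 2 / q) * (H.stepSize ^ 2 * ‖u‖ ^ 2) := fun i => by
    have h2 : ‖-(H.stepSize • u)‖ ^ 2 = H.stepSize ^ 2 * ‖u‖ ^ 2 := by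
      rw [norm_neg, norm_smul, mul_pow, Real.norm_eq_abs, sq_abs]
    have h3 : (augStep P H a w).1.1 = a.1.1 + -(H.stepSize • u) := by
      rw [← sub_eq_add_neg]
      exact step_fst hs.Kη_pos.ne' a.1 w
    rw [h3, augStep_snd, anchorInd_eq_ite]
    split_ifs
    · rw [one_smul, add_sub_cancel, add_sub_cancel_left, h2, sub_self, zero_mul, mul_zero, zero_add]
      refine le_mul_of_one_le_left (by positivity) ?_
      have : 0 < 2 / q := by positivity
      linarith
    · rw [zero_smul, add_zero, add_sub_right_comm, sub_zero, one_mul, ← h2]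
      exact norm_add_sq_le_young (by positivity) (by field_simp) _ _
  calc staleness (augStep P H a w)
      ≤ (M : ℝ)⁻¹ * ∑ i : Fin M, ((1 + q / 2)
          * ((1 - anchorInd (w.1, w.2.1) i) * ‖a.1.1 - a.2 i‖ ^ 2)
        + (1 + 2 / q) * (H.stepSize ^ 2 * ‖u‖ ^ 2)) := by
        rw [staleness]
        gcongr with i
        exact h1 i
    _ = _ := by
        rw [Finset.sum_add_distrib, ← Finset.mul_sum, Finset.sum_const, Finset.card_univ,
          Fintype.card_fin, nsmul_eq_mul]
        field_simp

theorem meanGrad_step (st : State d M) (w : Seed Z M H) :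
    meanGrad (step P H st w).2.1 = (meanGrad st.2.1
        + ∑ i, anchorInd (w.1, w.2.1) i • ((M : ℝ)⁻¹ • (∇ (P.localObj i) st.1 - st.2.1 i)))
      + ∑ i, (anchorInd (w.1, w.2.1) i * (M : ℝ)⁻¹)
        • (P.batchGrad i (w.2.2.1 i) st.1 - ∇ (P.localObj i) st.1) := by
  simp only [meanGrad, Finset.smul_sum, ← Finset.sum_add_distrib]
  refine Finset.sum_congr rfl fun i _ => ?_
  rw [step_snd_fst]
  module

theorem measurable_potential (hs : Setting P H L S) (c ν μ : ℝ) :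
    Measurable (potential P c ν μ) := by
  have h1 : Measurable P.obj := (Problem.differentiable_obj hs.smooth).continuous.measurable
  have h2 : Measurable fun a : AugState d M => P.obj a.1.1 := h1.comp measurable_fst.fst
  have h3 : Measurable fun a : AugState d M => meanGrad a.1.2.1 :=
    measurable_meanGrad.comp measurable_fst.snd.fst
  have h4 : ∀ i, Measurable fun a : AugState d M => a.2 i := fun i =>
    (measurable_pi_apply i).comp measurable_snd
  have h5 : Measurable fun a : AugState d M => a.1.1 := measurable_fst.fst
  exact ((h2.sub_const c).add ((h3.norm.pow_const 2).const_mul ν)).add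
    (((Finset.measurable_sum Finset.univ fun i _ =>
      (h5.sub (h4 i)).norm.pow_const 2).const_mul (M : ℝ)⁻¹).const_mul μ)

theorem norm_gradient_obj_sq_le (hs : Setting P H L S) {c : ℝ} (hc : ∀ x, c ≤ P.obj x) (x : Vec d) :
    ‖∇ P.obj x‖ ^ 2 ≤ 2 * L * (P.obj x - c) :=
  norm_gradient_sq_le hs.pos (Problem.differentiable_obj hs.smooth)
    (Problem.norm_gradient_obj_sub_le hs.smooth hs.pos.le) hc x

/-- `hcoef` says that the staleness created by the step, reduced by the descent term, leaves at most
`γ/8` of `‖u‖²`, the amount included in the miner estimate. -/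
theorem potential_augStep_le (hs : Setting P H L S) (a : AugState d M) (w : Seed Z M H)
    {c ν μ q : ℝ} (hμ : 0 ≤ μ) (hq : 0 < q) (hγ : 0 ≤ H.stepSize)
    (hcoef : μ * ((1 + 2 / q) * H.stepSize ^ 2)
      - H.stepSize / 2 * (1 - H.stepSize * L) ≤ H.stepSize / 8) :
    potential P c ν μ (augStep P H a w)
      ≤ (P.obj a.1.1 - c - H.stepSize / 2 * (minerInd (w.1, w.2.1) * ‖∇ P.obj a.1.1‖ ^ 2)
          + μ * ((1 + q / 2) * ((M : ℝ)⁻¹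
            * ∑ i, (1 - anchorInd (w.1, w.2.1) i) * ‖a.1.1 - a.2 i‖ ^ 2)))
        + ν * ‖meanGrad (step P H a.1 w).2.1‖ ^ 2
        + H.stepSize * (((miners (w.1, w.2.1)).card : ℝ)⁻¹ * ∑ i ∈ miners (w.1, w.2.1),
          (1 / 8 * ‖minerDir P H a.1.1 (meanGrad a.1.2.1) i (w.2.2.2 i)‖ ^ 2
          + 1 / 2 * ‖minerDir P H a.1.1 (meanGrad a.1.2.1) i (w.2.2.2 i)
            - ∇ P.obj a.1.1‖ ^ 2)) := by
  have h1 := hs.obj_step_le a.1 w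
  have h2 := mul_le_mul_of_nonneg_left (hs.staleness_augStep_le a w hq) hμ
  have h3 := mul_le_mul_of_nonneg_left (minerInd_mul_avgDir_le (P := P) (H := H) a.1.1
    (meanGrad a.1.2.1) (∇ P.obj a.1.1) (w.1, w.2.1) w.2.2.2) hγ
  set u := avgDir P H a.1.1 (meanGrad a.1.2.1) (w.1, w.2.1) w.2.2.2 with hu
  have h4 : minerInd (w.1, w.2.1) * ‖u‖ ^ 2 = ‖u‖ ^ 2 := by
    by_cases hw : (miners (w.1, w.2.1)).card = 0
    · simp [hu, avgDir_eq_zero hw]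
    · rw [minerInd, if_neg hw, one_mul]
  have h5 := mul_le_mul_of_nonneg_right hcoef (sq_nonneg ‖u‖)
  have h6 : H.stepSize * (minerInd (w.1, w.2.1)
        * (1 / 8 * ‖u‖ ^ 2 + 1 / 2 * ‖u - ∇ P.obj a.1.1‖ ^ 2))
      = H.stepSize / 8 * ‖u‖ ^ 2
        + H.stepSize / 2 * (minerInd (w.1, w.2.1) * ‖u - ∇ P.obj a.1.1‖ ^ 2) := by
    calc _ = H.stepSize / 8 * (minerInd (w.1, w.2.1) * ‖u‖ ^ 2)
        + H.stepSize / 2 * (minerInd (w.1, w.2.1) * ‖u - ∇ P.obj a.1.1‖ ^ 2) := by ring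
      _ = _ := by rw [h4]
  rw [h6] at h3
  change (P.obj (step P H a.1 w).1 - c) + ν * ‖meanGrad (step P H a.1 w).2.1‖ ^ 2
    + μ * staleness (augStep P H a w) ≤ _
  linarith

theorem expLE_potential (hs : Setting P H L S) (a : AugState d M)
    {c ν μ q q₂ m : ℝ} (hc : ∀ x, c ≤ P.obj x) (hν : 0 ≤ ν) (hμ : 0 ≤ μ) (hqdef : q = H.p * H.A / M)
    (hq : 0 < q) (hm : m = 1 - H.p ^ H.A) (hγ : 0 ≤ H.stepSize) (hγL : H.stepSize * L ≤ 1)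
    (hcoef : μ * ((1 + 2 / q) * H.stepSize ^ 2)
      - H.stepSize / 2 * (1 - H.stepSize * L) ≤ H.stepSize / 8)
    (hq₂ : ∀ (c : Vec d) (z : Fin M → Vec d),
        ∫ w, ‖c + ∑ i, anchorInd w i • z i‖ ^ 2 ∂(selectLaw M H.A H.p)
          = ‖c‖ ^ 2 + 2 * q * inner ℝ c (∑ i, z i) + q₂ * ‖∑ i, z i‖ ^ 2
            + (q - q₂) * ∑ i, ‖z i‖ ^ 2) :
    ExpLE (seedLaw P H) (fun w => potential P c ν μ (augStep P H a w))
      ((P.obj a.1.1 - c - H.stepSize / 2 * (m * ‖∇ P.obj a.1.1‖ ^ 2)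
          + μ * ((1 + q / 2) * ((1 - q) * staleness a)))
        + ν * (‖meanGrad a.1.2.1‖ ^ 2
          + 2 * q * inner ℝ (meanGrad a.1.2.1) (∇ P.obj a.1.1 - meanGrad a.1.2.1)
          + q₂ * ‖∇ P.obj a.1.1 - meanGrad a.1.2.1‖ ^ 2
          + (q - q₂) * ((M : ℝ)⁻¹ ^ 2 * ∑ i, ‖∇ (P.localObj i) a.1.1 - a.1.2.1 i‖ ^ 2)
          + q * ((M : ℝ)⁻¹ * S))
        + H.stepSize * (m * (7 / 16 * ‖meanGrad a.1.2.1‖ ^ 2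
          + 3 / 5 * ‖meanGrad a.1.2.1 - ∇ P.obj a.1.1‖ ^ 2))) := by
  have := isProbabilityMeasure_selectLaw hs.A_le hs.p_nonneg hs.p_le_one
  have := hs.isProbabilityMeasure_batchesLaw
  have := hs.prob_big
  have := hs.prob_small
  have hM := hs.M_pos
  have hα : ∀ (w : (Fin M → Bool) × (Fin M → Bool)) i, 0 ≤ 1 - anchorInd w i := fun w i => by
    rw [anchorInd_eq_ite]
    split_ifs <;> norm_num
  set x := a.1.1 with hx
  set g := meanGrad a.1.2.1 with hg
  set h := ∇ P.obj x with hh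
  set z : Fin M → Vec d := fun i => (M : ℝ)⁻¹ • (∇ (P.localObj i) x - a.1.2.1 i) with hz
  set J : ℝ := 7 / 16 * ‖g‖ ^ 2 + 3 / 5 * ‖g - h‖ ^ 2 with hJ
  have hJ0 : 0 ≤ J := by positivity
  let T₁ : (Fin M → Bool) × (Fin M → Bool) → ℝ := fun w =>
    P.obj x - c - H.stepSize / 2 * (minerInd w * ‖h‖ ^ 2)
      + μ * ((1 + q / 2) * ((M : ℝ)⁻¹ * ∑ i, (1 - anchorInd w i) * ‖x - a.2 i‖ ^ 2))
  let T₂ : (Fin M → Bool) × (Fin M → Bool) → ℝ := fun w =>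
    ‖g + ∑ i, anchorInd w i • z i‖ ^ 2 + ∑ i, anchorInd w i * ((M : ℝ)⁻¹ ^ 2 * S)
  -- Nonnegativity is required because expectations are taken of positive parts; it holds by `‖∇F‖²
  -- ≤ 2L(F - c)` and `γL ≤ 1`.
  have hT₁ : ∀ w, 0 ≤ T₁ w := fun w => by
    have h1 := hs.norm_gradient_obj_sq_le hc x
    have h2 : minerInd w ≤ 1 := by
      simp only [minerInd]
      split_ifs <;> norm_num
    have h3 : minerInd w * ‖h‖ ^ 2 ≤ 1 * (2 * L * (P.obj x - c)) :=
      mul_le_mul h2 h1 (sq_nonneg _) zero_le_one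
    have h4 : H.stepSize / 2 * (minerInd w * ‖h‖ ^ 2)
        ≤ H.stepSize / 2 * (1 * (2 * L * (P.obj x - c))) := by gcongr
    have h5 : 0 ≤ P.obj x - c := sub_nonneg.2 (hc x)
    have h6 : H.stepSize * L * (P.obj x - c) ≤ 1 * (P.obj x - c) := by gcongr
    have h7 : 0 ≤ μ * ((1 + q / 2) * ((M : ℝ)⁻¹ * ∑ i, (1 - anchorInd w i) * ‖x - a.2 i‖ ^ 2)) := by
      refine mul_nonneg hμ (mul_nonneg (by positivity) (mul_nonneg (by positivity)
        (Finset.sum_nonneg fun i _ => mul_nonneg (hα w i) (sq_nonneg _))))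
    simp only [T₁]
    linarith
  have hT₂ : ∀ w, 0 ≤ T₂ w := fun w => add_nonneg (sq_nonneg _) (Finset.sum_nonneg fun i _ =>
    mul_nonneg (anchorInd_nonneg w i) (mul_nonneg (sq_nonneg _) hs.S_nonneg))
  have hT₃ : ∀ w : (Fin M → Bool) × (Fin M → Bool), 0 ≤ minerInd w * J := fun w =>
    mul_nonneg (minerInd_nonneg w) hJ0
  refine hs.expLE_seedLaw ((hs.measurable_potential c ν μ).comp (hs.measurable_augStep_seed a))
    (T := fun w => T₁ w + ν * T₂ w + H.stepSize * (minerInd w * J)) (fun w => ?_)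
    (fun w => add_nonneg (add_nonneg (hT₁ w) (mul_nonneg hν (hT₂ w))) (mul_nonneg hγ (hT₃ w))) ?_
  · -- the expectation over the batches
    have hξm : ∀ i, Measurable fun q : (Fin M → Fin H.b → Z) × (Fin M → Fin H.K → Fin H.b' → Z) =>
        P.batchGrad i (q.1 i) x - ∇ (P.localObj i) x := fun i =>
      (hs.noise_big i x).measurable.comp ((measurable_pi_apply i).comp measurable_fst)
    have hg' : ExpLE (batchesLaw P H)
        (fun q => ‖meanGrad (step P H a.1 (w.1, w.2, q)).2.1‖ ^ 2) (T₂ w) := by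
      have h1 := IsNoise.expLE_norm_add_sum_sq
        (fun i => (hs.noise_big i x).smul (anchorInd w i * (M : ℝ)⁻¹))
        (g + ∑ i, anchorInd w i • z i)
      have hm : Measurable fun B : Fin M → Fin H.b → Z => ‖(g + ∑ i, anchorInd w i • z i)
          + ∑ i, (anchorInd w i * (M : ℝ)⁻¹)
            • (P.batchGrad i (B i) x - ∇ (P.localObj i) x)‖ ^ 2 :=
        (measurable_const.add (Finset.measurable_sum Finset.univ fun i _ =>
          ((hs.noise_big i x).smul (anchorInd w i * (M : ℝ)⁻¹)).measurable.comp
            (measurable_pi_apply i))).norm.pow_const 2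
      refine (hs.expLE_big hm h1).mono (fun q => le_of_eq ?_) (le_of_eq ?_)
      · rw [meanGrad_step]
      · simp only [T₂]
        congr 1
        refine Finset.sum_congr rfl fun i _ => ?_
        rw [mul_pow, pow_two (anchorInd w i), anchorInd_mul_self, mul_assoc]
    have hgm : Measurable fun q : (Fin M → Fin H.b → Z) × (Fin M → Fin H.K → Fin H.b' → Z) =>
        ‖meanGrad (step P H a.1 (w.1, w.2, q)).2.1‖ ^ 2 := by
      simp_rw [meanGrad_step]
      exact (measurable_const.add (Finset.measurable_sum Finset.univ fun i _ =>
        (hξm i).const_smul (anchorInd w i * (M : ℝ)⁻¹))).norm.pow_const 2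
    let ψ : Fin M → (Fin H.K → Fin H.b' → Z) → ℝ := fun i B =>
      1 / 8 * ‖minerDir P H x g i B‖ ^ 2 + 1 / 2 * ‖minerDir P H x g i B - h‖ ^ 2
    have hψm : ∀ i, Measurable (ψ i) := fun i => by
      have h1 : Measurable fun B => minerDir P H x g i B := by
        have h2 := (measurable_minerDir hs.measurable_small i).comp
          (measurable_prodMk_left (x := (x, g)))
        exact h2
      exact ((h1.norm.pow_const 2).const_mul (1 / 8)).add
        (((h1.sub_const h).norm.pow_const 2).const_mul (1 / 2))
    have hψ : ∀ i, ExpLE (batchesLaw P H) (fun q => ψ i (q.2 i)) J := fun i => by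
      obtain ⟨C, hC0, hC, hnoise⟩ := hs.noise_small
      exact hs.expLE_small_apply i (hψm i) (expLE_minerRun (hs.measurable_small i)
        (Problem.measurable_gradient_localObj hs.smooth i) (hs.smooth i).2 (hnoise i) hC0 hC
        hs.one_le_K hs.ηl_sq hs.ηl_pos h)
    have hψs : ExpLE (batchesLaw P H)
        (fun q => ((miners w).card : ℝ)⁻¹ * ∑ i ∈ miners w, ψ i (q.2 i)) (minerInd w * J) := by
      refine ((ExpLE.sum (miners w) (fun i _ => hψ i) (fun i => (hψm i).comp
        ((measurable_pi_apply i).comp measurable_snd)) fun _ => hJ0).const_mul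
        (k := ((miners w).card : ℝ)⁻¹) (by positivity)).mono (fun q => le_rfl) (le_of_eq ?_)
      rw [Finset.sum_const, nsmul_eq_mul, minerInd]
      split_ifs with h0
      · simp [h0]
      · have : ((miners w).card : ℝ) ≠ 0 := by exact_mod_cast h0
        field_simp
    exact (((ExpLE.const (T₁ w)).add (hg'.const_mul hν) measurable_const (hT₁ w)
      (mul_nonneg hν (hT₂ w))).add (hψs.const_mul hγ)
      (measurable_const.add (hgm.const_mul ν))
      (add_nonneg (hT₁ w) (mul_nonneg hν (hT₂ w))) (mul_nonneg hγ (hT₃ w))).mono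
      (fun q => hs.potential_augStep_le a (w.1, w.2, q) hμ hq hγ hcoef) le_rfl
  · -- the expectation over the participants and the coins
    have hzsum : ∑ i, z i = h - g := by
      simp only [hz]
      rw [← Finset.smul_sum, Finset.sum_sub_distrib, smul_sub, hh,
        Problem.gradient_obj hs.smooth]
      rfl
    have hznorm : ∑ i, ‖z i‖ ^ 2
        = (M : ℝ)⁻¹ ^ 2 * ∑ i, ‖∇ (P.localObj i) x - a.1.2.1 i‖ ^ 2 := by
      rw [Finset.mul_sum]
      refine Finset.sum_congr rfl fun i _ => ?_
      rw [hz, norm_smul, mul_pow, Real.norm_eq_abs, sq_abs]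
    have hI₁ : ∫ w, T₁ w ∂(selectLaw M H.A H.p)
        = P.obj x - c - H.stepSize / 2 * (m * ‖h‖ ^ 2)
          + μ * ((1 + q / 2) * ((1 - q) * staleness a)) := by
      have h1 : ∀ i, ∫ w, (1 - anchorInd w i) * ‖x - a.2 i‖ ^ 2 ∂(selectLaw M H.A H.p)
          = (1 - q) * ‖x - a.2 i‖ ^ 2 := fun i => by
        rw [integral_mul_const, integral_sub Integrable.of_finite Integrable.of_finite,
          integral_anchorInd hs.A_le hs.p_nonneg hs.p_le_one, hqdef]
        simp
      simp only [T₁]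
      rw [integral_add Integrable.of_finite Integrable.of_finite,
        integral_sub Integrable.of_finite Integrable.of_finite, integral_const_mul,
        integral_mul_const, integral_minerInd hs.A_le hs.p_nonneg hs.p_le_one, integral_const_mul,
        integral_const_mul, integral_const_mul, integral_finsetSum _ fun _ _ =>
        Integrable.of_finite, integral_const, probReal_univ, one_smul, ← hm]
      simp_rw [h1]
      rw [← Finset.mul_sum, staleness]
      ring
    have hI₂ : ∫ w, T₂ w ∂(selectLaw M H.A H.p) = ‖g‖ ^ 2 + 2 * q * inner ℝ g (h - g)
        + q₂ * ‖h - g‖ ^ 2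
        + (q - q₂) * ((M : ℝ)⁻¹ ^ 2 * ∑ i, ‖∇ (P.localObj i) x - a.1.2.1 i‖ ^ 2)
        + q * ((M : ℝ)⁻¹ * S) := by
      simp only [T₂]
      rw [integral_add Integrable.of_finite Integrable.of_finite, hq₂, hzsum, hznorm,
        integral_finsetSum _ fun _ _ => Integrable.of_finite]
      simp_rw [integral_mul_const, integral_anchorInd hs.A_le hs.p_nonneg hs.p_le_one, ← hqdef]
      rw [Finset.sum_const, Finset.card_univ, Fintype.card_fin, nsmul_eq_mul]
      field_simp
    rw [integral_add Integrable.of_finite Integrable.of_finite,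
      integral_add Integrable.of_finite Integrable.of_finite, integral_const_mul,
      integral_const_mul, integral_mul_const, integral_minerInd hs.A_le hs.p_nonneg hs.p_le_one,
      hI₁, hI₂, ← hm]

end Setting

end Descent

/-! ### The one-step decrease -/

section Convergence

variable {Z : Type*} [MeasurableSpace Z] {d M : ℕ} {P : Problem Z d M} {H : Params}
  {L S : ℝ}

/-- The scalar constants of the analysis: `q` is the probability that a given client is an anchor,
`m` the probability that there is a miner, `ν` and `μ` are the weights of the potential. -/
structure Rates (M : ℕ) (H : Params) (L q m ν μ : ℝ) : Prop where
  q_eq : q = H.p * H.A / M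
  q_pos : 0 < q
  q_le_one : q ≤ 1
  m_eq : m = 1 - H.p ^ H.A
  m_pos : 0 < m
  m_le_one : m ≤ 1
  ν_nonneg : 0 ≤ ν
  μ_nonneg : 0 ≤ μ
  ν_mul : ν * q = 7 / 16 * (m * H.stepSize)
  μ_mul : μ * (q / 2 * (1 + q))
    = m * H.stepSize * (L ^ 2 * (25 / 24 * (3 / 5 + 7 / 16 * (q - 1 + (M : ℝ)⁻¹))))
  step_pos : 0 < H.stepSize
  step_mul_le : H.stepSize * L ≤ 1
  coef_le : μ * ((1 + 2 / q) * H.stepSize ^ 2)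
    - H.stepSize / 2 * (1 - H.stepSize * L) ≤ H.stepSize / 8

namespace Setting

variable {q m ν μ c : ℝ}

/-- Pure bookkeeping of coefficients. The letters stand for: `o` the objective gap, `gg` and `hh`
the squared norms of `g` and `h`, `e = ‖g - h‖²`, `ip = ⟨g, h - g⟩`, `δ` the staleness, `zz` the sum
of squared individual cache errors over `M²`, `R` and `Q` the two sampling errors over `M²`, `N =
S/M`, `r = 1/M`. -/
theorem potential_bound {o gg hh e δ zz R Q N ip k γ m q q₂ ν μ L r : ℝ} (hk : k = m * γ)
    (hk0 : 0 ≤ k)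
    (hν0 : 0 ≤ ν) (hν : ν * q = 7 / 16 * k) (hq0 : 0 < q) (hq1 : q ≤ 1) (hq₂0 : 0 ≤ q₂)
    (hq₂ : q₂ ≤ q ^ 2)
    (hμ : μ * (q / 2 * (1 + q)) = k * (L ^ 2 * (25 / 24 * (3 / 5 + 7 / 16 * (q - 1 + r)))))
    (hip : 2 * ip = hh - gg - e) (he0 : 0 ≤ e) (hz0 : 0 ≤ zz) (hR0 : 0 ≤ R)
    (he : e ≤ 25 / 24 * (L ^ 2 * δ) + 25 * R)
    (hz : zz ≤ 25 / 24 * (L ^ 2 * (r * δ)) + 25 * Q) :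
    (o - γ / 2 * (m * hh) + μ * ((1 + q / 2) * ((1 - q) * δ)))
        + ν * (gg + 2 * q * ip + q₂ * e + (q - q₂) * zz + q * N)
        + γ * (m * (7 / 16 * gg + 3 / 5 * e))
      ≤ o + ν * gg + μ * δ - k / 16 * hh + k * (15 * R + 175 / 16 * Q + 7 / 16 * N) := by
  have h1 : ν * (q₂ * e) ≤ 7 / 16 * k * (q * e) := by
    calc ν * (q₂ * e) ≤ ν * (q ^ 2 * e) := by gcongr
      _ = ν * q * (q * e) := by ring
      _ = 7 / 16 * k * (q * e) := by rw [hν]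
  have h2 : ν * ((q - q₂) * zz) ≤ 7 / 16 * k * zz := by
    calc ν * ((q - q₂) * zz) ≤ ν * (q * zz) := by
          gcongr
          linarith
      _ = 7 / 16 * k * zz := by rw [← mul_assoc, hν]
  -- Since `(1 + q/2)(1 - q) = 1 - q/2 (1 + q)`, the choice of `μ` cancels all staleness terms.
  have h3 : μ * ((1 + q / 2) * ((1 - q) * δ)) = μ * δ
      - k * (L ^ 2 * (25 / 24 * (3 / 5 + 7 / 16 * (q - 1 + r)))) * δ := by
    rw [← hμ]
    ring
  have h4 : ν * (2 * q * ip) = 7 / 16 * k * (hh - gg - e) := by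
    rw [← hip, ← hν]
    ring
  have h5 : ν * (q * N) = 7 / 16 * k * N := by rw [← mul_assoc, hν]
  -- The coefficient of `e` collects `3/5` from the miners, `-7/16` from the polarised inner product
  -- and at most `7/16 q` from `q₂ ≤ q²`.
  have h6 := mul_le_mul_of_nonneg_left he (show 0 ≤ 3 / 5 - 7 / 16 * (1 - q) by linarith)
  have h6' : (3 / 5 - 7 / 16 * (1 - q)) * (25 * R) ≤ 3 / 5 * (25 * R) := by
    gcongr
    linarith
  have h7 : k * ((3 / 5 - 7 / 16 * (1 - q)) * e + 7 / 16 * zz)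
      ≤ k * ((3 / 5 - 7 / 16 * (1 - q)) * (25 / 24 * (L ^ 2 * δ)) + 15 * R
        + 7 / 16 * (25 / 24 * (L ^ 2 * (r * δ)) + 25 * Q)) := by
    gcongr ?_ * ?_
    linarith
  have h8 : γ / 2 * (m * hh) = k / 2 * hh := by rw [hk]; ring
  have h9 : γ * (m * (7 / 16 * gg + 3 / 5 * e)) = k * (7 / 16 * gg + 3 / 5 * e) := by rw [hk]; ring
  rw [h3, h8, h9]
  have h10 : ν * (gg + 2 * q * ip + q₂ * e + (q - q₂) * zz + q * N)
      = ν * gg + ν * (2 * q * ip) + ν * (q₂ * e) + ν * ((q - q₂) * zz) + ν * (q * N) := by ring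
  rw [h10, h4, h5]
  linarith

/-- Young with weight `1/24` keeps the staleness factor close to one, where the margin is tight; the
factor `25` falls on the sampling error and only enlarges the absolute constant. -/
theorem norm_gradient_sub_cache_sq_le (hs : Setting P H L S) (a : AugState d M) (i : Fin M) :
    ‖∇ (P.localObj i) a.1.1 - a.1.2.1 i‖ ^ 2
      ≤ 25 / 24 * (L ^ 2 * ‖a.1.1 - a.2 i‖ ^ 2) + 25 * ‖cacheError P a i‖ ^ 2 := by
  have h1 : ∇ (P.localObj i) a.1.1 - a.1.2.1 i
      = (∇ (P.localObj i) a.1.1 - ∇ (P.localObj i) (a.2 i)) + -cacheError P a i := by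
    rw [cacheError]
    abel
  have h2 := norm_add_sq_le_young (r := 1 / 24) (s := 24) (by norm_num) (by norm_num)
    (∇ (P.localObj i) a.1.1 - ∇ (P.localObj i) (a.2 i)) (-cacheError P a i)
  have h3 := pow_le_pow_left₀ (norm_nonneg _) ((hs.smooth i).2 a.1.1 (a.2 i)) 2
  rw [mul_pow] at h3
  rw [h1]
  rw [norm_neg] at h2
  linarith

theorem norm_meanGrad_sub_sq_le (hs : Setting P H L S) (a : AugState d M) :
    ‖meanGrad a.1.2.1 - ∇ P.obj a.1.1‖ ^ 2
      ≤ 25 / 24 * (L ^ 2 * staleness a)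
        + 25 * ((M : ℝ)⁻¹ ^ 2 * ‖∑ i, cacheError P a i‖ ^ 2) := by
  have hM := hs.M_pos
  have hne : (Finset.univ : Finset (Fin M)).Nonempty :=
    ⟨⟨0, by exact_mod_cast hM⟩, Finset.mem_univ _⟩
  have h1 : meanGrad a.1.2.1 - ∇ P.obj a.1.1
      = (M : ℝ)⁻¹ • ∑ i, (∇ (P.localObj i) (a.2 i) - ∇ (P.localObj i) a.1.1)
        + (M : ℝ)⁻¹ • ∑ i, cacheError P a i := by
    rw [meanGrad, Problem.gradient_obj hs.smooth, ← smul_sub, ← smul_add,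
      ← Finset.sum_add_distrib, ← Finset.sum_sub_distrib]
    congr 1
    refine Finset.sum_congr rfl fun i _ => ?_
    rw [cacheError]
    abel
  have h2 := norm_add_sq_le_young (r := 1 / 24) (s := 24) (by norm_num) (by norm_num)
    ((M : ℝ)⁻¹ • ∑ i, (∇ (P.localObj i) (a.2 i) - ∇ (P.localObj i) a.1.1))
    ((M : ℝ)⁻¹ • ∑ i, cacheError P a i)
  have h3 := norm_sum_smul_sq_le Finset.univ hne fun i =>
    ∇ (P.localObj i) (a.2 i) - ∇ (P.localObj i) a.1.1
  rw [Finset.card_univ, Fintype.card_fin] at h3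
  have h4 : (M : ℝ)⁻¹ * ∑ i, ‖∇ (P.localObj i) (a.2 i) - ∇ (P.localObj i) a.1.1‖ ^ 2
      ≤ L ^ 2 * staleness a := by
    have h5 : ∑ i, ‖∇ (P.localObj i) (a.2 i) - ∇ (P.localObj i) a.1.1‖ ^ 2
        ≤ L ^ 2 * ∑ i, ‖a.1.1 - a.2 i‖ ^ 2 := by
      rw [Finset.mul_sum]
      refine Finset.sum_le_sum fun i _ => ?_
      rw [← mul_pow, norm_sub_rev a.1.1]
      exact pow_le_pow_left₀ (norm_nonneg _) ((hs.smooth i).2 _ _) 2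
    rw [staleness, mul_left_comm]
    exact mul_le_mul_of_nonneg_left h5 (inv_nonneg.2 hM.le)
  rw [norm_smul (M : ℝ)⁻¹ (∑ i, cacheError P a i), mul_pow, Real.norm_eq_abs, sq_abs] at h2
  rw [h1]
  linarith

theorem two_mul_inner_sub (g h : Vec d) :
    2 * inner ℝ g (h - g) = ‖h‖ ^ 2 - ‖g‖ ^ 2 - ‖g - h‖ ^ 2 := by
  have h1 := norm_sub_sq_real g h
  rw [inner_sub_right, real_inner_self_eq_norm_sq]
  linarith

theorem expLE_potential_augStep (hs : Setting P H L S) (hr : Rates M H L q m ν μ)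
    (hc : ∀ x, c ≤ P.obj x) (a : AugState d M) :
    ExpLE (seedLaw P H) (fun w => potential P c ν μ (augStep P H a w))
      (potential P c ν μ a - m * H.stepSize / 16 * ‖∇ P.obj a.1.1‖ ^ 2
        + m * H.stepSize * (15 * ((M : ℝ)⁻¹ ^ 2 * ‖∑ i, cacheError P a i‖ ^ 2)
          + 175 / 16 * ((M : ℝ)⁻¹ ^ 2 * ∑ i, ‖cacheError P a i‖ ^ 2)
          + 7 / 16 * ((M : ℝ)⁻¹ * S))) := by
  obtain ⟨q₂, hq₂0, hq₂, -, hformula⟩ := exists_integral_norm_add_sum_anchorInd_sq d hs.one_le_A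
    hs.A_le hs.p_nonneg hs.p_le_one
  rw [← hr.q_eq] at hq₂ hformula
  have hM := hs.M_pos
  refine (hs.expLE_potential a hc hr.ν_nonneg hr.μ_nonneg hr.q_eq hr.q_pos hr.m_eq hr.step_pos.le
    hr.step_mul_le hr.coef_le hformula).mono (fun _ => le_rfl) ?_
  have he := hs.norm_meanGrad_sub_sq_le a
  have hz : (M : ℝ)⁻¹ ^ 2 * ∑ i, ‖∇ (P.localObj i) a.1.1 - a.1.2.1 i‖ ^ 2
      ≤ 25 / 24 * (L ^ 2 * ((M : ℝ)⁻¹ * staleness a))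
        + 25 * ((M : ℝ)⁻¹ ^ 2 * ∑ i, ‖cacheError P a i‖ ^ 2) := by
    calc (M : ℝ)⁻¹ ^ 2 * ∑ i, ‖∇ (P.localObj i) a.1.1 - a.1.2.1 i‖ ^ 2
        ≤ (M : ℝ)⁻¹ ^ 2 * ∑ i, (25 / 24 * (L ^ 2 * ‖a.1.1 - a.2 i‖ ^ 2)
          + 25 * ‖cacheError P a i‖ ^ 2) := by
          gcongr with i
          exact hs.norm_gradient_sub_cache_sq_le a i
      _ = _ := by
          rw [Finset.sum_add_distrib, ← Finset.mul_sum, ← Finset.mul_sum, ← Finset.mul_sum,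
            staleness]
          ring
  rw [norm_sub_rev (∇ P.obj a.1.1) (meanGrad a.1.2.1)]
  exact potential_bound rfl (mul_nonneg hr.m_pos.le hr.step_pos.le) hr.ν_nonneg hr.ν_mul hr.q_pos
    hr.q_le_one hq₂0 hq₂ hr.μ_mul (two_mul_inner_sub _ _) (sq_nonneg _)
    (mul_nonneg (sq_nonneg _) (Finset.sum_nonneg fun i _ => sq_nonneg _))
    (mul_nonneg (sq_nonneg _) (sq_nonneg _)) he hz

end Setting

end Convergence

/-! ### The whole run: invariants and telescoping -/

section Chain

variable {Z : Type*} [MeasurableSpace Z] {d M : ℕ} {P : Problem Z d M} {H : Params}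
  {L S : ℝ}

/-- The initial augmented state. -/
noncomputable def augInit (P : Problem Z d M) (H : Params) (x₀ : Vec d)
    (B : Fin M → Fin H.b → Z) : AugState d M :=
  (initState P H x₀ B, fun _ => x₀)

/-- The law of the augmented state after `t` rounds. -/
noncomputable def augLaw (P : Problem Z d M) (H : Params) (x₀ : Vec d) :
    ℕ → Measure (AugState d M)
  | 0 => (Measure.pi fun i => P.data.batchLaw i H.b).map (augInit P H x₀)
  | t + 1 => ((augLaw P H x₀ t).prod (seedLaw P H)).map fun q => augStep P H q.1 q.2

namespace Setting

variable {q m ν μ c : ℝ} {x₀ : Vec d} {t : ℕ}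

theorem measurable_step (hs : Setting P H L S) :
    Measurable fun q : State d M × Seed Z M H => step P H q.1 q.2 :=
  FedAMD.measurable_step hs.Kη_pos.ne' hs.measurable_big hs.measurable_small

theorem measurable_augStep (hs : Setting P H L S) :
    Measurable fun q : AugState d M × Seed Z M H => augStep P H q.1 q.2 :=
  FedAMD.measurable_augStep hs.Kη_pos.ne' hs.measurable_big hs.measurable_small

theorem measurable_augInit (hs : Setting P H L S) (x₀ : Vec d) : Measurable (augInit P H x₀) := by
  have h : ∀ i, Measurable fun B : Fin M → Fin H.b → Z => P.batchGrad i (B i) x₀ := fun i => by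
    have h1 := (hs.measurable_big i).comp ((measurable_const (a := x₀)).prodMk
      (measurable_pi_apply i : Measurable fun B : Fin M → Fin H.b → Z => B i))
    exact h1
  have h2 : Measurable fun B : Fin M → Fin H.b → Z => fun i => P.batchGrad i (B i) x₀ :=
    measurable_pi_lambda _ h
  have h3 : Measurable fun B : Fin M → Fin H.b → Z => initState P H x₀ B :=
    measurable_const.prodMk (h2.prodMk measurable_const)
  exact h3.prodMk measurable_const

theorem isProbabilityMeasure_augLaw (hs : Setting P H L S) (x₀ : Vec d) (t : ℕ) :
    IsProbabilityMeasure (augLaw P H x₀ t) := by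
  have := hs.prob_big
  have := hs.isProbabilityMeasure_seedLaw
  induction t with
  | zero => exact Measure.isProbabilityMeasure_map (hs.measurable_augInit x₀).aemeasurable
  | succ t ih => exact Measure.isProbabilityMeasure_map hs.measurable_augStep.aemeasurable

/-- The remembered anchor models never influence the algorithm; they only serve the analysis. -/
theorem map_fst_augLaw (hs : Setting P H L S) (x₀ : Vec d) (t : ℕ) :
    (augLaw P H x₀ t).map Prod.fst = law P H x₀ t := by
  have := hs.isProbabilityMeasure_seedLaw
  induction t with
  | zero =>
    rw [augLaw, Measure.map_map measurable_fst (hs.measurable_augInit x₀)]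
    rfl
  | succ t ih =>
    have := hs.isProbabilityMeasure_augLaw x₀ t
    have h1 : (law P H x₀ t).prod (seedLaw P H)
        = ((augLaw P H x₀ t).prod (seedLaw P H)).map (Prod.map Prod.fst id) := by
      rw [← Measure.map_prod_map _ _ measurable_fst measurable_id, ih, Measure.map_id]
    rw [augLaw, law, h1, Measure.map_map measurable_fst hs.measurable_augStep,
      Measure.map_map hs.measurable_step (measurable_fst.prodMap measurable_id)]
    rfl

theorem expLE_augLaw_succ (hs : Setting P H L S) {f h : AugState d M → ℝ} {e : ℝ}
    (hf : Measurable f) (hh : ∀ a, ExpLE (seedLaw P H) (fun w => f (augStep P H a w)) (h a))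
    (he : ExpLE (augLaw P H x₀ t) h e) : ExpLE (augLaw P H x₀ (t + 1)) f e := by
  have := hs.isProbabilityMeasure_seedLaw
  exact (ExpLE.prod (f := fun q => f (augStep P H q.1 q.2)) (hf.comp hs.measurable_augStep) hh
    he).map hs.measurable_augStep hf

theorem cacheError_augInit (x₀ : Vec d) (B : Fin M → Fin H.b → Z) (i : Fin M) :
    cacheError P (augInit P H x₀ B) i = P.batchGrad i (B i) x₀ - ∇ (P.localObj i) x₀ :=
  rfl

/-- The bound `M S` is a fixed point: with both moments at most `M S`, the recursion for the norm of
the sum returns `(1 - 2q + q₂) + (q - q₂) + q = 1` times it. The coefficients are nonnegative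
because `2q - 1 ≤ q₂ ≤ q² ≤ q`. Independence of the caches is never claimed. -/
theorem expLE_augLaw_cacheError (hs : Setting P H L S) (x₀ : Vec d) (t : ℕ) :
    ExpLE (augLaw P H x₀ t) (fun a => ‖∑ i, cacheError P a i‖ ^ 2) (M * S) ∧
      ExpLE (augLaw P H x₀ t) (fun a => ∑ i, ‖cacheError P a i‖ ^ 2) (M * S) := by
  have := hs.prob_big
  have hM := hs.M_pos
  have hS := hs.S_nonneg
  have hMS : 0 ≤ M * S := mul_nonneg hM.le hS
  induction t with
  | zero =>
    refine ⟨ExpLE.map (hs.measurable_augInit x₀) hs.measurable_norm_sum_cacheError_sq ?_,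
      ExpLE.map (hs.measurable_augInit x₀) hs.measurable_sum_norm_cacheError_sq ?_⟩
    · refine (IsNoise.expLE_norm_add_sum_sq (fun i => hs.noise_big i x₀) 0).mono
        (fun B => ?_) ?_
      · simp_rw [cacheError_augInit]
        rw [zero_add]
      · simp
    · refine (ExpLE.sum Finset.univ (f := fun i (B : Fin M → Fin H.b → Z) =>
        ‖P.batchGrad i (B i) x₀ - ∇ (P.localObj i) x₀‖ ^ 2) (a := fun _ => S) (fun i _ => ?_)
        (fun i => ?_) fun _ => hS).mono (fun B => le_rfl) (by simp)
      · exact (hs.noise_big i x₀).expLE.comp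
          (measurePreserving_eval (fun i => P.data.batchLaw i H.b) i)
          ((hs.noise_big i x₀).measurable.norm.pow_const 2)
      · exact ((hs.noise_big i x₀).measurable.comp (measurable_pi_apply i)).norm.pow_const 2
  | succ t ih =>
    have := hs.isProbabilityMeasure_augLaw x₀ t
    obtain ⟨q₂, hq₂0, hq₂, hq₂', hformula⟩ := exists_integral_norm_add_sum_anchorInd_sq d
      hs.one_le_A hs.A_le hs.p_nonneg hs.p_le_one
    have hq0 : 0 ≤ H.p * H.A / M := by
      have := hs.p_nonneg
      positivity
    have hq1 : H.p * H.A / M ≤ 1 := by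
      rw [div_le_one hM]
      have h1 : (H.A : ℝ) ≤ M := by exact_mod_cast hs.A_le
      nlinarith [hs.p_le_one, hs.p_nonneg, (Nat.cast_nonneg H.A : (0 : ℝ) ≤ H.A)]
    generalize hq : H.p * H.A / M = q at *
    have h1 : 0 ≤ 1 - 2 * q + q₂ := by linarith
    have h2 : 0 ≤ q - q₂ := by nlinarith
    refine ⟨hs.expLE_augLaw_succ hs.measurable_norm_sum_cacheError_sq (fun a =>
      hs.expLE_norm_sum_cacheError_sq (q₂ := q₂) (by rw [hq]; exact hformula)) ?_,
      hs.expLE_augLaw_succ hs.measurable_sum_norm_cacheError_sq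
        (fun a => hs.expLE_sum_norm_cacheError_sq a) ?_⟩
    · rw [hq]
      refine ((((ih.1.const_mul h1).add (ih.2.const_mul h2)
        (hs.measurable_norm_sum_cacheError_sq.const_mul _) (mul_nonneg h1 hMS)
        (mul_nonneg h2 hMS)).add (ExpLE.const (q * (M * S)))
        ((hs.measurable_norm_sum_cacheError_sq.const_mul _).add
          (hs.measurable_sum_norm_cacheError_sq.const_mul _)) (add_nonneg (mul_nonneg h1 hMS)
        (mul_nonneg h2 hMS)) (mul_nonneg hq0 hMS))).mono (fun a => le_rfl) (le_of_eq (by ring))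
    · rw [hq]
      have h3 : 0 ≤ 1 - q := by linarith
      exact (((ih.2.const_mul h3).add (ExpLE.const (q * (M * S)))
        (hs.measurable_sum_norm_cacheError_sq.const_mul _) (mul_nonneg h3 hMS)
        (mul_nonneg hq0 hMS))).mono (fun a => le_rfl) (le_of_eq (by ring))

theorem expLE_augLaw_zero_potential (hs : Setting P H L S) (hc : ∀ x, c ≤ P.obj x) (hν : 0 ≤ ν) :
    ExpLE (augLaw P H x₀ 0) (potential P c ν μ)
      ((P.obj x₀ - c) + ν * (‖∇ P.obj x₀‖ ^ 2 + (M : ℝ)⁻¹ * S)) := by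
  have := hs.prob_big
  have hM := hs.M_pos
  refine ExpLE.map (hs.measurable_augInit x₀) (hs.measurable_potential c ν μ) ?_
  have h1 := IsNoise.expLE_norm_add_sum_sq (fun i => (hs.noise_big i x₀).smul (M : ℝ)⁻¹)
    (∇ P.obj x₀)
  have hn : ∑ _i : Fin M, (M : ℝ)⁻¹ ^ 2 * S = (M : ℝ)⁻¹ * S := by
    rw [Finset.sum_const, Finset.card_univ, Fintype.card_fin, nsmul_eq_mul]
    field_simp
  rw [hn] at h1
  refine ((ExpLE.const (P.obj x₀ - c)).add (h1.const_mul hν) measurable_const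
    (sub_nonneg.2 (hc x₀)) (mul_nonneg hν (add_nonneg (sq_nonneg _)
      (mul_nonneg (inv_nonneg.2 hM.le) hs.S_nonneg)))).mono (fun B => le_of_eq ?_) le_rfl
  have h2 : staleness (augInit P H x₀ B) = 0 := by
    simp [staleness, augInit, initState]
  have h3 : meanGrad (augInit P H x₀ B).1.2.1
      = ∇ P.obj x₀ + ∑ i, (M : ℝ)⁻¹ • (P.batchGrad i (B i) x₀ - ∇ (P.localObj i) x₀) := by
    rw [Problem.gradient_obj hs.smooth, ← Finset.smul_sum, ← smul_add, ← Finset.sum_add_distrib]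
    simp only [add_sub_cancel]
    rfl
  rw [potential, h2, h3, mul_zero, add_zero]
  rfl

/-- The gradient term stands on the left because extended nonnegative reals do not subtract well.
Splitting it off requires the potential to dominate it pointwise, which is `hD`. -/
theorem lintegral_potential_succ (hs : Setting P H L S) (hr : Rates M H L q m ν μ)
    (hc : ∀ x, c ≤ P.obj x) (x₀ : Vec d) (t : ℕ) :
    ∫⁻ a, ENNReal.ofReal (potential P c ν μ a) ∂(augLaw P H x₀ (t + 1))
        + ENNReal.ofReal (m * H.stepSize / 16) * gradSq P H x₀ t
      ≤ ∫⁻ a, ENNReal.ofReal (potential P c ν μ a) ∂(augLaw P H x₀ t)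
        + ENNReal.ofReal (m * H.stepSize * (27 * ((M : ℝ)⁻¹ * S))) := by
  have := hs.isProbabilityMeasure_augLaw x₀ t
  have := hs.isProbabilityMeasure_seedLaw
  have hM := hs.M_pos
  have hS := hs.S_nonneg
  have hk : 0 ≤ m * H.stepSize := mul_nonneg hr.m_pos.le hr.step_pos.le
  set k := m * H.stepSize with hkdef
  have hgm : Measurable fun a : AugState d M => ‖∇ P.obj a.1.1‖ ^ 2 := by
    have h1 := (Problem.measurable_gradient_obj hs.smooth hs.pos.le).comp
      (measurable_fst.fst : Measurable fun a : AugState d M => a.1.1)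
    exact h1.norm.pow_const 2
  let D : AugState d M → ℝ := fun a => potential P c ν μ a - k / 16 * ‖∇ P.obj a.1.1‖ ^ 2
  let W : AugState d M → ℝ := fun a => k * (15 * ((M : ℝ)⁻¹ ^ 2 * ‖∑ i, cacheError P a i‖ ^ 2)
          + 175 / 16 * ((M : ℝ)⁻¹ ^ 2 * ∑ i, ‖cacheError P a i‖ ^ 2)
          + 7 / 16 * ((M : ℝ)⁻¹ * S))
  have hD : ∀ a, 0 ≤ D a := fun a => by
    have h1 := hs.norm_gradient_obj_sq_le hc a.1.1
    have h2 : 0 ≤ P.obj a.1.1 - c := sub_nonneg.2 (hc _)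
    have h3 : k * L ≤ 1 := by
      calc k * L = m * (H.stepSize * L) := by rw [hkdef]; ring
        _ ≤ 1 * 1 := mul_le_mul hr.m_le_one hr.step_mul_le
          (mul_nonneg hr.step_pos.le hs.pos.le) zero_le_one
        _ = 1 := one_mul 1
    have h4 : k / 16 * ‖∇ P.obj a.1.1‖ ^ 2 ≤ k / 16 * (2 * L * (P.obj a.1.1 - c)) := by gcongr
    have h5 : k * L * (P.obj a.1.1 - c) ≤ 1 * (P.obj a.1.1 - c) := by gcongr
    have h6 : 0 ≤ ν * ‖meanGrad a.1.2.1‖ ^ 2 := mul_nonneg hr.ν_nonneg (sq_nonneg _)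
    have h7 : 0 ≤ μ * staleness a := mul_nonneg hr.μ_nonneg (mul_nonneg (inv_nonneg.2 hM.le)
      (Finset.sum_nonneg fun i _ => sq_nonneg _))
    simp only [D, potential]
    linarith
  have hW : ExpLE (augLaw P H x₀ t) W (k * (27 * ((M : ℝ)⁻¹ * S))) := by
    obtain ⟨hR, hQ⟩ := hs.expLE_augLaw_cacheError x₀ t
    have hMS : 0 ≤ (M : ℝ)⁻¹ ^ 2 * (M * S) := by positivity
    have hN : 0 ≤ (M : ℝ)⁻¹ * S := by positivity
    have hm1 := (hs.measurable_norm_sum_cacheError_sq.const_mul ((M : ℝ)⁻¹ ^ 2)).const_mul 15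
    have hm2 := (hs.measurable_sum_norm_cacheError_sq.const_mul ((M : ℝ)⁻¹ ^ 2)).const_mul
      (175 / 16)
    have hR' := (hR.const_mul (sq_nonneg (M : ℝ)⁻¹)).const_mul (k := 15) (by norm_num)
    have hQ' := (hQ.const_mul (sq_nonneg (M : ℝ)⁻¹)).const_mul (k := 175 / 16) (by norm_num)
    have h3 := ((hR'.add hQ' hm1 (by positivity) (by positivity)).add
      (ExpLE.const (7 / 16 * ((M : ℝ)⁻¹ * S))) (hm1.add hm2) (by positivity)
      (by positivity)).const_mul hk
    refine h3.mono (fun a => le_rfl) ?_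
    -- After this normalisation the noise constant is `15 + 175/16 + 7/16 = 211/8 ≤ 27`.
    have h4 : (M : ℝ)⁻¹ ^ 2 * (M * S) = (M : ℝ)⁻¹ * S := by field_simp
    rw [h4]
    gcongr
    linarith
  have h1 : ∫⁻ a, ENNReal.ofReal (potential P c ν μ a) ∂(augLaw P H x₀ (t + 1))
      ≤ ∫⁻ a, ENNReal.ofReal (D a + W a) ∂(augLaw P H x₀ t) := by
    have hmp := hs.measurable_potential c ν μ
    have hmp' : Measurable fun q : AugState d M × Seed Z M H =>
        ENNReal.ofReal (potential P c ν μ (augStep P H q.1 q.2)) :=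
      (hmp.comp hs.measurable_augStep).ennreal_ofReal
    rw [augLaw, lintegral_map hmp.ennreal_ofReal hs.measurable_augStep,
      lintegral_prod _ hmp'.aemeasurable]
    exact lintegral_mono fun a => hs.expLE_potential_augStep hr hc a
  have hDm : Measurable D := (hs.measurable_potential c ν μ).sub (hgm.const_mul _)
  have h2 : ∫⁻ a, ENNReal.ofReal (potential P c ν μ a) ∂(augLaw P H x₀ t)
      = ∫⁻ a, ENNReal.ofReal (D a) ∂(augLaw P H x₀ t)
        + ENNReal.ofReal (k / 16) * gradSq P H x₀ t := by
    have h3 : gradSq P H x₀ t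
        = ∫⁻ a, ENNReal.ofReal (‖∇ P.obj a.1.1‖ ^ 2) ∂(augLaw P H x₀ t) := by
      have h5 := (Problem.measurable_gradient_obj hs.smooth hs.pos.le).comp
        (measurable_fst : Measurable fun a : State d M => a.1)
      have h6 : Measurable fun st : State d M => ‖∇ P.obj st.1‖ₑ ^ 2 := h5.enorm.pow_const 2
      rw [gradSq, ← hs.map_fst_augLaw, lintegral_map h6 measurable_fst]
      refine lintegral_congr fun a => ?_
      rw [ENNReal.ofReal_pow (norm_nonneg _), ofReal_norm]
    rw [h3, ← lintegral_const_mul _ hgm.ennreal_ofReal, ← lintegral_add_left hDm.ennreal_ofReal]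
    refine lintegral_congr fun a => ?_
    rw [← ENNReal.ofReal_mul (by positivity), ← ENNReal.ofReal_add (hD a) (by positivity)]
    simp only [D, sub_add_cancel]
  have h4 : ∫⁻ a, ENNReal.ofReal (D a + W a) ∂(augLaw P H x₀ t)
      ≤ ∫⁻ a, ENNReal.ofReal (D a) ∂(augLaw P H x₀ t)
        + ENNReal.ofReal (k * (27 * ((M : ℝ)⁻¹ * S))) := by
    calc _ ≤ ∫⁻ a, ENNReal.ofReal (D a) + ENNReal.ofReal (W a) ∂(augLaw P H x₀ t) :=
          lintegral_mono fun a => ENNReal.ofReal_add_le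
      _ = ∫⁻ a, ENNReal.ofReal (D a) ∂(augLaw P H x₀ t)
          + ∫⁻ a, ENNReal.ofReal (W a) ∂(augLaw P H x₀ t) :=
          lintegral_add_left hDm.ennreal_ofReal _
      _ ≤ _ := by
        gcongr
        exact hW
  calc _ ≤ (∫⁻ a, ENNReal.ofReal (D a) ∂(augLaw P H x₀ t)
        + ENNReal.ofReal (k * (27 * ((M : ℝ)⁻¹ * S))))
        + ENNReal.ofReal (k / 16) * gradSq P H x₀ t := by
        gcongr
        exact h1.trans h4
    _ = _ := by rw [h2, add_right_comm]

theorem sum_gradSq_le (hs : Setting P H L S) (hr : Rates M H L q m ν μ)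
    (hc : ∀ x, c ≤ P.obj x) (x₀ : Vec d) (T : ℕ) :
    ENNReal.ofReal (m * H.stepSize / 16) * ∑ t ∈ Finset.range T, gradSq P H x₀ t
      ≤ ENNReal.ofReal ((P.obj x₀ - c) + ν * (‖∇ P.obj x₀‖ ^ 2 + (M : ℝ)⁻¹ * S)
        + T * (m * H.stepSize * (27 * ((M : ℝ)⁻¹ * S)))) := by
  have hk : 0 ≤ m * H.stepSize := mul_nonneg hr.m_pos.le hr.step_pos.le
  have hN : 0 ≤ (M : ℝ)⁻¹ * S := mul_nonneg (inv_nonneg.2 hs.M_pos.le) hs.S_nonneg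
  have h0 : 0 ≤ (P.obj x₀ - c) + ν * (‖∇ P.obj x₀‖ ^ 2 + (M : ℝ)⁻¹ * S) :=
    add_nonneg (sub_nonneg.2 (hc x₀)) (mul_nonneg hr.ν_nonneg (add_nonneg (sq_nonneg _) hN))
  have key : ∀ T : ℕ, ∫⁻ a, ENNReal.ofReal (potential P c ν μ a) ∂(augLaw P H x₀ T)
      + ENNReal.ofReal (m * H.stepSize / 16) * ∑ t ∈ Finset.range T, gradSq P H x₀ t
      ≤ ENNReal.ofReal ((P.obj x₀ - c) + ν * (‖∇ P.obj x₀‖ ^ 2 + (M : ℝ)⁻¹ * S)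
        + T * (m * H.stepSize * (27 * ((M : ℝ)⁻¹ * S)))) := by
    intro T
    induction T with
    | zero => simpa [ExpLE] using hs.expLE_augLaw_zero_potential (μ := μ) hc hr.ν_nonneg
    | succ T ih =>
      rw [Finset.sum_range_succ, mul_add, ← add_assoc, add_right_comm]
      calc _ ≤ (∫⁻ a, ENNReal.ofReal (potential P c ν μ a) ∂(augLaw P H x₀ T)
            + ENNReal.ofReal (m * H.stepSize * (27 * ((M : ℝ)⁻¹ * S))))
            + ENNReal.ofReal (m * H.stepSize / 16) * ∑ t ∈ Finset.range T, gradSq P H x₀ t :=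
            add_le_add (hs.lintegral_potential_succ hr hc x₀ T) le_rfl
        _ ≤ ENNReal.ofReal ((P.obj x₀ - c) + ν * (‖∇ P.obj x₀‖ ^ 2 + (M : ℝ)⁻¹ * S)
              + T * (m * H.stepSize * (27 * ((M : ℝ)⁻¹ * S))))
            + ENNReal.ofReal (m * H.stepSize * (27 * ((M : ℝ)⁻¹ * S))) := by
            rw [add_right_comm]
            gcongr
        _ = _ := by
            rw [← ENNReal.ofReal_add (by positivity) (by positivity)]
            congr 1
            push_cast
            ring
  exact le_trans le_add_self (key T)

theorem exists_gradSq_le (hs : Setting P H L S) (hr : Rates M H L q m ν μ)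
    (hc : ∀ x, c ≤ P.obj x) (x₀ : Vec d) {T : ℕ} (hT : 0 < T) {ε : ℝ}
    (hε : (P.obj x₀ - c) + ν * (‖∇ P.obj x₀‖ ^ 2 + (M : ℝ)⁻¹ * S)
        + T * (m * H.stepSize * (27 * ((M : ℝ)⁻¹ * S))) ≤ T * (m * H.stepSize / 16 * ε)) :
    ∃ t < T, gradSq P H x₀ t ≤ ENNReal.ofReal ε := by
  have hk : 0 < m * H.stepSize := mul_pos hr.m_pos hr.step_pos
  obtain ⟨t, ht, hmin⟩ := Finset.exists_min_image (Finset.range T) (gradSq P H x₀)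
    ⟨0, Finset.mem_range.2 hT⟩
  refine ⟨t, Finset.mem_range.1 ht, ?_⟩
  have hT' : (0 : ℝ) < T := by exact_mod_cast hT
  have h1 : ENNReal.ofReal (T * (m * H.stepSize / 16)) * gradSq P H x₀ t
      ≤ ENNReal.ofReal (T * (m * H.stepSize / 16)) * ENNReal.ofReal ε := by
    calc _ = ENNReal.ofReal (m * H.stepSize / 16) * (T * gradSq P H x₀ t) := by
          rw [mul_comm (T : ℝ), ENNReal.ofReal_mul (by positivity), ENNReal.ofReal_natCast,
            mul_assoc]
      _ ≤ ENNReal.ofReal (m * H.stepSize / 16) * ∑ t ∈ Finset.range T, gradSq P H x₀ t := by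
          gcongr
          have h2 := Finset.card_nsmul_le_sum (Finset.range T) (gradSq P H x₀) _ hmin
          rwa [Finset.card_range, nsmul_eq_mul] at h2
      _ ≤ ENNReal.ofReal (T * (m * H.stepSize / 16 * ε)) :=
          (hs.sum_gradSq_le hr hc x₀ T).trans (ENNReal.ofReal_le_ofReal hε)
      _ = _ := by rw [← mul_assoc, ENNReal.ofReal_mul (by positivity)]
  exact (ENNReal.mul_le_mul_iff_right (by positivity) ENNReal.ofReal_ne_top).1 h1

end Setting

end Chain

/-! ### The prescribed parameters satisfy the rate conditions -/

section ConstantParams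

variable {M A K b : ℕ} {c L : ℝ}

theorem stepSize_constantParams (hK : 1 ≤ K) (hL : 0 < L) :
    (constantParams M A K b c L).stepSize = A / ((A + 3 * M * c) * L) := by
  have h6 : √(6 : ℝ) ≠ 0 := by positivity
  have hK' : (K : ℝ) ≠ 0 := by positivity
  simp only [Params.stepSize, constantParams]
  field_simp

theorem constantParams_p_pos (hc : 1 ≤ c) : 0 < (constantParams M A K b c L).p := by
  simp only [constantParams]
  positivity

theorem mul_constantParams_p_pow (hc : 1 ≤ c) (hA : 1 ≤ A) :
    (c * (constantParams M A K b c L).p) ^ A = 2 / (A + 2) := by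
  have hA' : (A : ℝ) ≠ 0 := by positivity
  have h1 : c * (constantParams M A K b c L).p = (2 / ((A : ℝ) + 2)) ^ (1 / (A : ℝ)) := by
    simp only [constantParams]
    field_simp
  rw [h1, ← Real.rpow_natCast, ← Real.rpow_mul (by positivity), one_div_mul_cancel hA',
    Real.rpow_one]

/-- Bernoulli gives `(3/2)^A ≥ 1 + A/2`, that is `(2/3)^A ≤ 2/(A + 2) = (cp)^A`. This explains the
form of `p`. -/
theorem two_le_three_mul_constantParams_p (hc : 1 ≤ c) (hA : 1 ≤ A) :
    2 ≤ 3 * (c * (constantParams M A K b c L).p) := by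
  have h0 := constantParams_p_pos (M := M) (A := A) (K := K) (b := b) (L := L) hc
  have h1 : (2 / 3 : ℝ) ^ A ≤ (c * (constantParams M A K b c L).p) ^ A := by
    rw [mul_constantParams_p_pow hc hA]
    have h2 := one_add_mul_le_pow (a := (1 / 2 : ℝ)) (by norm_num) A
    have h3 : (2 / 3 : ℝ) ^ A * (1 + 1 / 2) ^ A = 1 := by
      rw [← mul_pow]
      norm_num
    rw [le_div_iff₀ (by positivity)]
    have h4 : (2 / 3 : ℝ) ^ A * (1 + A * (1 / 2)) ≤ (2 / 3 : ℝ) ^ A * (1 + 1 / 2) ^ A := by gcongr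
    linarith
  have := (pow_le_pow_iff_left₀ (by norm_num) (by positivity) (by omega)).1 h1
  linarith

theorem constantParams_p_pow_le (hc : 1 ≤ c) (hA : 1 ≤ A) :
    (constantParams M A K b c L).p ^ A ≤ 2 / 3 := by
  have h0 := constantParams_p_pos (M := M) (A := A) (K := K) (b := b) (L := L) hc
  have hA' : (1 : ℝ) ≤ A := by exact_mod_cast hA
  calc (constantParams M A K b c L).p ^ A ≤ (c * (constantParams M A K b c L).p) ^ A := by
        gcongr
        exact le_mul_of_one_le_left h0.le hc
    _ = 2 / (A + 2) := mul_constantParams_p_pow hc hA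
    _ ≤ 2 / (1 + 2) := by gcongr
    _ = 2 / 3 := by norm_num

theorem constantParams_p_le_one (hc : 1 ≤ c) (hA : 1 ≤ A) :
    (constantParams M A K b c L).p ≤ 1 := by
  have h0 := constantParams_p_pos (M := M) (A := A) (K := K) (b := b) (L := L) hc
  have h1 := constantParams_p_pow_le (M := M) (K := K) (b := b) (L := L) hc hA
  by_contra! h
  have := one_le_pow₀ h.le (n := A)
  linarith

/-- Needed for the bound `5/8` on the staleness weight. If the first factor exceeds one, then `s =
A(1 - p) ≤ 1`, Bernoulli bounds the second factor by `s`, and the product is at most `s + s(1 - s)/A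
≤ 1`. -/
theorem add_inv_mul_one_sub_pow_le_one {p : ℝ} (hp0 : 0 ≤ p) (hp1 : p ≤ 1) (hA : 1 ≤ A) :
    (p + (A : ℝ)⁻¹) * (1 - p ^ A) ≤ 1 := by
  have hA' : (1 : ℝ) ≤ A := by exact_mod_cast hA
  have hA0 : (0 : ℝ) < A := by linarith
  have hpow : 0 ≤ p ^ A := by positivity
  have hpow1 : p ^ A ≤ 1 := pow_le_one₀ hp0 hp1
  rcases le_total (p + (A : ℝ)⁻¹) 1 with h | h
  · exact mul_le_one₀ h (by linarith) (by linarith)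
  · have h1 := one_add_mul_le_pow (a := p - 1) (by linarith) A
    rw [add_sub_cancel] at h1
    set s := A * (1 - p) with hs
    have h2 : 1 - p ^ A ≤ s := by
      rw [hs]
      linarith
    have hs0 : 0 ≤ s := mul_nonneg hA0.le (by linarith)
    have hs1 : s ≤ 1 := by
      have h3 := mul_le_mul_of_nonneg_left h hA0.le
      rw [mul_add, mul_inv_cancel₀ hA0.ne'] at h3
      rw [hs]
      linarith
    calc (p + (A : ℝ)⁻¹) * (1 - p ^ A) ≤ (p + (A : ℝ)⁻¹) * s := by gcongr
      _ = s + (A : ℝ)⁻¹ * (s * (1 - s)) := by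
        rw [hs]
        field_simp
        ring
      _ ≤ s + 1 * (1 - s) := by
        gcongr s + ?_
        exact mul_le_mul (inv_le_one_of_one_le₀ hA') (by nlinarith) (by nlinarith) zero_le_one
      _ = 1 := by ring

/-- The staleness cost is at most `γ · l m · (2γL/q)²`. By `hγq` the square is at most `(1 - γL)² ≤
1 - γL`, so `5/8` of it exceeds the available `1/2` by at most `1/8`. -/
theorem coef_bound {γ L q m l : ℝ} (hγ : 0 < γ) (hL : 0 < L) (hq : 0 < q) (hm : 0 ≤ m) (hl : 0 ≤ l)
    (hlm : l * m ≤ 5 / 8) (hτ : γ * L ≤ 1) (hγq : 2 * (γ * L) ≤ (1 - γ * L) * q) :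
    m * γ * (L ^ 2 * l) * (2 / (q * (1 + q))) * ((1 + 2 / q) * γ ^ 2) - γ / 2 * (1 - γ * L)
      ≤ γ / 8 := by
  have h1 : (1 + 2 / q) / (1 + q) ≤ 2 / q := by
    rw [div_le_div_iff₀ (by positivity) hq, add_mul, div_mul_cancel₀ _ hq.ne']
    linarith
  have h2 : (2 * (γ * L) / q) ^ 2 ≤ (1 - γ * L) ^ 2 := by
    gcongr
    rwa [div_le_iff₀ hq]
  have h3 : (1 - γ * L) ^ 2 ≤ 1 - γ * L := by nlinarith [mul_pos hγ hL]
  have h4 : m * γ * (L ^ 2 * l) * (2 / (q * (1 + q))) * ((1 + 2 / q) * γ ^ 2)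
      = m * γ * (L ^ 2 * l) * γ ^ 2 * (2 / q) * ((1 + 2 / q) / (1 + q)) := by
    field_simp
  calc _ ≤ m * γ * (L ^ 2 * l) * γ ^ 2 * (2 / q) * (2 / q) - γ / 2 * (1 - γ * L) := by
        rw [h4]
        gcongr
    _ = γ * ((l * m) * (2 * (γ * L) / q) ^ 2) - γ / 2 * (1 - γ * L) := by
        field_simp
    _ ≤ γ * (5 / 8 * (1 - γ * L)) - γ / 2 * (1 - γ * L) := by
        gcongr γ * ?_ - _
        exact mul_le_mul hlm (h2.trans h3) (sq_nonneg _) (by norm_num)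
    _ ≤ γ / 8 := by nlinarith [mul_pos hγ (mul_pos hγ hL)]

theorem exists_rates (hc : 1 ≤ c) (hL : 0 < L) (hA : 1 ≤ A) (hAM : A ≤ M) (hK : 1 ≤ K) :
    ∃ q m ν μ : ℝ, Rates M (constantParams M A K b c L) L q m ν μ ∧ ν * L ≤ 7 / 32
      ∧ A ≤ 12 * M * c * L * (m * (constantParams M A K b c L).stepSize) := by
  have hp0 := constantParams_p_pos (M := M) (A := A) (K := K) (b := b) (L := L) hc
  have hp1 := constantParams_p_le_one (M := M) (K := K) (b := b) (L := L) hc hA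
  have hcp := two_le_three_mul_constantParams_p (M := M) (K := K) (b := b) (L := L) hc hA
  have hpA := constantParams_p_pow_le (M := M) (K := K) (b := b) (L := L) hc hA
  have hpA0 : 0 < (constantParams M A K b c L).p ^ A := pow_pos hp0 A
  have hφ := add_inv_mul_one_sub_pow_le_one hp0.le hp1 hA
  have hγ := stepSize_constantParams (M := M) (A := A) (b := b) (c := c) hK hL
  have hA' : (1 : ℝ) ≤ A := by exact_mod_cast hA
  have hAM' : (A : ℝ) ≤ M := by exact_mod_cast hAM
  have hA0 : (0 : ℝ) < A := by linarith
  have hM0 : (0 : ℝ) < M := by linarith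
  have hc0 : 0 < c := by linarith
  set p := (constantParams M A K b c L).p with hp
  set γ := (constantParams M A K b c L).stepSize with hγdef
  set m : ℝ := 1 - p ^ A with hm
  set q : ℝ := p * A / M with hq
  have hm0 : 1 / 3 ≤ m := by linarith
  have hm1 : m ≤ 1 := by linarith
  have hmpos : 0 < m := by linarith
  have hq0 : 0 < q := by positivity
  have hq1 : q ≤ 1 := by
    rw [hq, div_le_one hM0]
    calc p * A ≤ 1 * A := by gcongr
      _ ≤ M := by linarith
  have hγ0 : 0 < γ := by rw [hγ]; positivity
  have hγL : γ * L = A / (A + 3 * M * c) := by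
    rw [hγ]
    field_simp
  have hγL1 : γ * L ≤ 1 := by
    rw [hγL, div_le_one (by positivity)]
    have : 0 ≤ 3 * M * c := by positivity
    linarith
  have hγq : 2 * (γ * L) ≤ (1 - γ * L) * q := by
    -- Here the global learning rate enters: `γL = A/(A + 3Mc)` gives exactly the factor `3cp ≥ 2`.
    have h1 : (1 - γ * L) * q = 3 * (c * p) * (γ * L) := by
      rw [hγL, hq]
      field_simp
      ring
    rw [h1]
    gcongr
  have hγq' : γ * L ≤ 1 / 2 * q := by
    have : 0 < γ * L * q := by positivity
    linarith
  set l : ℝ := 25 / 24 * (3 / 5 + 7 / 16 * (q - 1 + (M : ℝ)⁻¹)) with hl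
  have hMinv : 0 < (M : ℝ)⁻¹ := by positivity
  have hl0 : 0 ≤ l := by
    rw [hl]
    linarith
  -- Once `(q + 1/M)m ≤ 1`, the two terms with `7/16` combine and `l m ≤ 25/24 · 3/5 = 5/8` because
  -- `m ≤ 1`.
  have hlm : l * m ≤ 5 / 8 := by
    have h1 : (q + (M : ℝ)⁻¹) * m ≤ 1 := by
      refine le_trans ?_ hφ
      gcongr ?_ * _
      rw [hq]
      have h2 : p * A / M ≤ p := by
        rw [div_le_iff₀ hM0]
        gcongr
      have h3 : (M : ℝ)⁻¹ ≤ (A : ℝ)⁻¹ := by gcongr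
      linarith
    rw [hl]
    linarith
  refine ⟨q, m, 7 / 16 * (m * γ) / q, m * γ * (L ^ 2 * l) * (2 / (q * (1 + q))),
    ⟨rfl, hq0, hq1, rfl, hmpos, hm1, by positivity, by positivity,
      div_mul_cancel₀ _ hq0.ne', ?_, hγ0, hγL1,
      coef_bound hγ0 hL hq0 hmpos.le hl0 hlm hγL1 hγq⟩, ?_, ?_⟩
  · rw [← hl, ← hγdef]
    field_simp
  · rw [div_mul_eq_mul_div, div_le_iff₀ hq0]
    calc 7 / 16 * (m * γ) * L = 7 / 16 * m * (γ * L) := by ring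
      _ ≤ 7 / 16 * 1 * (1 / 2 * q) := by gcongr
      _ = 7 / 32 * q := by ring
  · have h1 : (A + 3 * M * c) * (γ * L) = A := by
      rw [hγL]
      field_simp
    have h2 : (A : ℝ) ≤ M * c := hAM'.trans (le_mul_of_one_le_right hM0.le hc)
    calc (A : ℝ) = (A + 3 * M * c) * (γ * L) := h1.symm
      _ ≤ (M * c + 3 * M * c) * (γ * L) := by gcongr
      _ = 12 * M * c * L * (1 / 3 * γ) := by ring
      _ ≤ 12 * M * c * L * (m * γ) := by gcongr

end ConstantParams

/-! ### From the assumptions to the abstract setting -/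

section OracleSetting

variable {Z : Type*} [MeasurableSpace Z] {d M : ℕ} {P : Problem Z d M} {A K b : ℕ}
  {c L σ Lσ a : ℝ}

theorem LocalData.largeBatch_le_size (D : LocalData Z M) (a : ℝ) :
    (D.largeBatch a : ℕ∞) ≤ D.size := by
  cases D with
  | dataset n pts => exact Nat.cast_le.2 (min_le_right ⌈a⌉₊ n)
  | online D => exact le_top

/-- If the batch is not the whole dataset, the minimum is attained by the ceiling, so the variance
is as small as the target requires. -/
theorem LocalData.le_largeBatch (D : LocalData Z M) {a : ℝ}
    (h : (D.largeBatch a : ℕ∞) ≠ D.size) : a ≤ D.largeBatch a := by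
  cases D with
  | dataset n pts =>
    have h1 : min ⌈a⌉₊ n ≠ n := fun h2 => h (by simp only [largeBatch, size, h2])
    have h3 : min ⌈a⌉₊ n = ⌈a⌉₊ := by
      rcases min_choice ⌈a⌉₊ n with h | h
      · exact h
      · exact absurd h h1
    simp only [largeBatch, h3]
    exact Nat.le_ceil a
  | online D => exact Nat.le_ceil a

theorem setting_constantParams (hP : P.Regular) (hL : P.Smooth L) (hσ : P.BoundedNoise σ)
    (hLσ : P.AverageSmooth Lσ) (hL0 : 0 < L) (hc : 1 ≤ c) (hA : 1 ≤ A) (hAM : A ≤ M) (hK : 1 ≤ K)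
    (hKL : 2 * Lσ ^ 2 / L ^ 2 ≤ K) (hb : 1 ≤ b) (hsize : (b : ℕ∞) ≤ P.data.size) :
    Setting P (constantParams M A K b c L) L
      (if (b : ℕ∞) = P.data.size then 0 else σ ^ 2 / b) where
  smooth := hL
  pos := hL0
  measurable_big i := Problem.measurable_batchGrad hP i b
  measurable_small i := Problem.measurable_batchGrad hP i 1
  prob_big i := P.data.isProbabilityMeasure_batchLaw i hsize
  prob_small i := P.data.isProbabilityMeasure_batchLaw i
    (le_trans (by exact_mod_cast hb) hsize : ((1 : ℕ) : ℕ∞) ≤ P.data.size)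
  noise_big i v := by
    split_ifs with h
    · exact Problem.isNoise_batchGrad_full hP hL hσ hLσ i hb h v
    · exact Problem.isNoise_batchGrad hP hL hσ hLσ i hb hsize v
  noise_small := by
    refine ⟨Lσ ^ 2, sq_nonneg _, (div_le_iff₀ (by positivity)).1 hKL, fun i v w => ?_⟩
    have h := Problem.isNoise_batchGrad_sub hP hL hσ hLσ i le_rfl
      (le_trans (by exact_mod_cast hb) hsize : ((1 : ℕ) : ℕ∞) ≤ P.data.size) v w
    rw [Nat.cast_one, div_one] at h
    exact h
  one_le_A := hA
  A_le := hAM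
  one_le_K := hK
  p_nonneg := (constantParams_p_pos hc).le
  p_le_one := constantParams_p_le_one hc hA
  ηl_pos := by
    have : (0 : ℝ) < K := by exact_mod_cast hK
    simp only [constantParams]
    positivity
  ηl_sq := by
    have hK0 : (K : ℝ) ≠ 0 := by positivity
    have h6 : √(6 : ℝ) ^ 2 = 6 := Real.sq_sqrt (by norm_num)
    simp only [constantParams]
    rw [div_pow, mul_pow, mul_pow, mul_pow, h6]
    field_simp
    norm_num

end OracleSetting

/-! ### Counting samples -/

section Complexity

variable {Z : Type*} [MeasurableSpace Z] {d M : ℕ} {P : Problem Z d M} {H : Params} {L S : ℝ}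

/-- Crude count: anchors and miners are each bounded by all `A` participants. The order of magnitude
is not affected. -/
theorem step_count_le (st : State d M) (w : Seed Z M H)
    (hw : (Finset.univ.filter fun i => w.1 i = true).card = H.A) :
    (step P H st w).2.2 ≤ st.2.2 + H.A * (H.b + H.K * H.b') := by
  have h : ∀ e : Bool, (Finset.univ.filter fun i => w.1 i = true ∧ w.2.1 i = e).card ≤ H.A :=
    fun e => by
      rw [← hw]
      exact Finset.card_le_card (Finset.monotone_filter_right _ fun i _ hi => hi.1)
  have h1 := Nat.mul_le_mul_right H.b (h true)
  have h2 := Nat.mul_le_mul_right (H.K * H.b') (h false)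
  simp only [step]
  rw [mul_add]
  omega

namespace Setting

theorem isProbabilityMeasure_law (hs : Setting P H L S) (x₀ : Vec d) (t : ℕ) :
    IsProbabilityMeasure (law P H x₀ t) := by
  have := hs.isProbabilityMeasure_augLaw x₀ t
  rw [← hs.map_fst_augLaw]
  exact Measure.isProbabilityMeasure_map measurable_fst.aemeasurable

theorem ae_count_le (hs : Setting P H L S) (x₀ : Vec d) (t : ℕ) :
    ∀ᵐ st ∂(law P H x₀ t), st.2.2 ≤ M * H.b + t * (H.A * (H.b + H.K * H.b')) := by
  have := hs.isProbabilityMeasure_seedLaw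
  have := hs.prob_big
  have := hs.prob_small
  have := isProbabilityMeasure_participantLaw hs.A_le
  have := isProbabilityMeasure_coinLaw hs.p_nonneg hs.p_le_one
  have hset : ∀ n : ℕ, MeasurableSet {st : State d M | st.2.2 ≤ n} := fun n =>
    measurable_snd.snd measurableSet_Iic
  induction t with
  | zero =>
    have h1 : Measurable (initState P H x₀) := measurable_fst.comp (hs.measurable_augInit x₀)
    rw [law, ae_map_iff h1.aemeasurable (hset _)]
    exact Filter.Eventually.of_forall fun B => by simp [initState]
  | succ t ih =>
    have := hs.isProbabilityMeasure_law x₀ t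
    rw [law, ae_map_iff hs.measurable_step.aemeasurable (hset _)]
    have h1 : ∀ᵐ w ∂(seedLaw P H), (Finset.univ.filter fun i => w.1 i = true).card = H.A :=
      Measure.quasiMeasurePreserving_fst.ae ae_card_participantLaw
    have h2 : ∀ᵐ q ∂((law P H x₀ t).prod (seedLaw P H)),
        (Finset.univ.filter fun i => q.2.1 i = true).card = H.A :=
      Measure.quasiMeasurePreserving_snd.ae h1
    have h3 : ∀ᵐ q ∂((law P H x₀ t).prod (seedLaw P H)),
        q.1.2.2 ≤ M * H.b + t * (H.A * (H.b + H.K * H.b')) :=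
      Measure.quasiMeasurePreserving_fst.ae ih
    filter_upwards [h2, h3] with q hq hq'
    refine (step_count_le q.1 q.2 hq).trans ?_
    rw [add_mul, one_mul]
    omega

theorem gradSq_zero (hs : Setting P H L S) (x₀ : Vec d) :
    gradSq P H x₀ 0 = ENNReal.ofReal (‖∇ P.obj x₀‖ ^ 2) := by
  have := hs.prob_big
  have h1 : Measurable (initState P H x₀) := measurable_fst.comp (hs.measurable_augInit x₀)
  have h5 := (Problem.measurable_gradient_obj hs.smooth hs.pos.le).comp
    (measurable_fst : Measurable fun a : State d M => a.1)
  have h6 : Measurable fun st : State d M => ‖∇ P.obj st.1‖ₑ ^ 2 := h5.enorm.pow_const 2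
  rw [gradSq, law, lintegral_map h6 h1]
  simp only [initState, lintegral_const, measure_univ, mul_one]
  rw [ENNReal.ofReal_pow (norm_nonneg _), ofReal_norm]

end Setting

end Complexity

/-! ### Accuracy and complexity with explicit constants -/

section Corollary

variable {Z : Type*} [MeasurableSpace Z] {d M : ℕ} {P : Problem Z d M} {A K b : ℕ}
  {c L S Δ f ε ε' : ℝ}

/-- The accuracy after `T` rounds in terms of the variance `S` of the large batches. -/
theorem Setting.exists_gradSq_constantParams_le
    (hs : Setting P (constantParams M A K b c L) L S) (hc : 1 ≤ c) (x₀ : Vec d)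
    (hf : ∀ x, f ≤ P.obj x) (hΔ : P.obj x₀ - f ≤ Δ) (hΔ0 : 0 ≤ Δ) (hε : 0 < ε)
    (hε1 : ε ≤ ε') (hε2 : ε / 2 + 433 * ((M : ℝ)⁻¹ * S) ≤ ε') {T : ℕ}
    (hT : (768 * c * L * Δ + 1) * (M / (A * ε)) ≤ T) :
    ∃ t < T, gradSq P (constantParams M A K b c L) x₀ t ≤ ENNReal.ofReal ε' := by
  have hL := hs.pos
  have hM := hs.M_pos
  have hA : 1 ≤ A := hs.one_le_A
  have hA0 : (0 : ℝ) < A := by exact_mod_cast hA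
  have hc0 : 0 < c := by linarith
  have hT0 : (0 : ℝ) < T := lt_of_lt_of_le (by positivity) hT
  have hT1 : 0 < T := by exact_mod_cast hT0
  have hgrad : ‖∇ P.obj x₀‖ ^ 2 ≤ 2 * L * Δ := (hs.norm_gradient_obj_sq_le hf x₀).trans (by gcongr)
  -- If the initial gradient is already small, round `0` suffices. Otherwise `ε < 2LΔ` bounds the
  -- run length from below by `32 ≤ kTL`, which absorbs the noise in the initial potential.
  rcases le_or_gt (2 * L * Δ) ε with h | h
  · refine ⟨0, hT1, ?_⟩
    rw [hs.gradSq_zero]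
    exact ENNReal.ofReal_le_ofReal (hgrad.trans (h.trans hε1))
  obtain ⟨q, m, ν, μ, hr, hν, hstep⟩ := exists_rates (M := M) (K := K) (b := b) hc hL hA hs.A_le
    hs.one_le_K
  refine hs.exists_gradSq_le hr hf x₀ hT1 ?_
  have hk : 0 < m * (constantParams M A K b c L).stepSize := mul_pos hr.m_pos hr.step_pos
  set k := m * (constantParams M A K b c L).stepSize
  have hN : 0 ≤ (M : ℝ)⁻¹ * S := mul_nonneg (inv_nonneg.2 hM.le) hs.S_nonneg
  set N := (M : ℝ)⁻¹ * S
  have hW : (P.obj x₀ - f) + ν * (‖∇ P.obj x₀‖ ^ 2 + N) ≤ 2 * Δ + N / L := by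
    have h1 : ν ≤ 7 / 32 / L := (le_div_iff₀ hL).2 hν
    have h2 : ν * (‖∇ P.obj x₀‖ ^ 2 + N) ≤ 7 / 32 / L * (2 * L * Δ + N) := by gcongr
    have h3 : 7 / 32 / L * (2 * L * Δ + N) = 7 / 16 * Δ + 7 / 32 * (N / L) := by
      field_simp
      ring
    have h4 : 0 ≤ N / L := by positivity
    linarith
  -- the length of the run
  have hkT : (768 * c * L * Δ + 1) ≤ 12 * c * L * ε * (k * T) := by
    have h1 : (768 * c * L * Δ + 1) * M ≤ T * (A * ε) := by
      rwa [← mul_div_assoc, div_le_iff₀ (by positivity)] at hT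
    have h2 : T * (A * ε) ≤ T * (12 * M * c * L * k * ε) := by gcongr
    refine le_of_mul_le_mul_right ?_ hM
    calc _ ≤ T * (12 * M * c * L * k * ε) := h1.trans h2
      _ = _ := by ring
  -- The constant is `768 = 12 · 64`: it yields `64Δ ≤ εkT`, so the initial gap takes only half of
  -- the accuracy. The `+ 1` in the run length keeps `T` positive when `Δ = 0`.
  have h1 : 2 * Δ + N / L ≤ k * T * (ε / 32 + N / 32) := by
    have h3 : 768 * c * L * Δ ≤ 12 * c * L * (ε * (k * T)) := by linarith
    have h4 : 64 * Δ ≤ ε * (k * T) := by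
      refine le_of_mul_le_mul_left ?_ (show 0 < 12 * c * L by positivity)
      linarith
    have h5 : 32 * (N / L) ≤ N * (k * T) := by
      have h6 : 32 ≤ k * T * L := by
        refine le_of_mul_le_mul_left ?_ hε
        calc ε * 32 ≤ 64 * Δ * L := by linarith
          _ ≤ ε * (k * T) * L := by gcongr
          _ = _ := by ring
      rw [← mul_div_assoc, div_le_iff₀ hL]
      calc 32 * N ≤ k * T * L * N := by gcongr
        _ = _ := by ring
    linarith
  calc _ ≤ k * T * (ε / 32 + N / 32) + T * (k * (27 * N)) := by
        gcongr
        exact hW.trans h1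
    -- `16 · 27 = 432` from the rounds and `1/2` from the initial state.
    _ = k * T / 16 * (ε / 2 + 432.5 * N) := by ring
    _ ≤ k * T / 16 * (ε / 2 + 433 * N) := by gcongr; norm_num
    _ ≤ k * T / 16 * ε' := by gcongr
    _ = _ := by ring

/-- Rounding `T` up costs one extra round, that is `A ≤ M ≤ ε₀ M/ε`; only here is the bounded range
of `ε` used. -/
theorem count_bound {σ θ ε ε₀ C a T n : ℝ} {M A K : ℕ} (hθ : 1 ≤ θ) (hε : 0 < ε) (hεε₀ : ε ≤ ε₀)
    (hC : 0 < C) (hA : 1 ≤ A) (hAM : A ≤ M) (hT0 : 0 ≤ T) (hT : T ≤ C * (M / (A * ε)) + 1)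
    (ha : a ≤ 2 * (θ * σ ^ 2 / (M * ε))) (hn : n ≤ M * a + T * (A * (a + K))) :
    n ≤ 2 * θ * (C + 2 * ε₀) * (σ ^ 2 / ε ^ 2 + M * K / ε) := by
  have hA0 : (0 : ℝ) < A := by exact_mod_cast hA
  have hAM' : (A : ℝ) ≤ M := by exact_mod_cast hAM
  have hM0 : (0 : ℝ) < M := by linarith
  have hε₀ : 0 < ε₀ := by linarith
  have hMa : M * a ≤ 2 * θ * ε₀ * (σ ^ 2 / ε ^ 2) := by
    calc M * a ≤ M * (2 * (θ * σ ^ 2 / (M * ε))) := by gcongr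
      _ = 2 * θ * ε * (σ ^ 2 / ε ^ 2) := by field_simp
      _ ≤ _ := by gcongr
  have hTA : T * A ≤ (C + ε₀) * (M / ε) := by
    calc T * A ≤ (C * (M / (A * ε)) + 1) * A := by gcongr
      _ = C * (M / ε) + A := by field_simp
      _ ≤ C * (M / ε) + ε₀ * (M / ε) := by
        gcongr
        calc (A : ℝ) ≤ M := hAM'
          _ = ε * (M / ε) := by field_simp
          _ ≤ _ := by gcongr
      _ = _ := by ring
  have h1 : T * (A * (a + K)) ≤ (C + ε₀) * (2 * θ) * (σ ^ 2 / ε ^ 2)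
      + (C + ε₀) * (M * K / ε) := by
    calc T * (A * (a + K)) ≤ T * (A * (2 * (θ * σ ^ 2 / (M * ε)) + K)) := by gcongr
      _ = T * A * (2 * (θ * σ ^ 2 / (M * ε)) + K) := by ring
      _ ≤ (C + ε₀) * (M / ε) * (2 * (θ * σ ^ 2 / (M * ε)) + K) := by gcongr
      _ = _ := by field_simp
  have h2 : (C + ε₀) * (M * K / ε) ≤ 2 * θ * (C + 2 * ε₀) * (M * K / ε) := by
    gcongr ?_ * _
    nlinarith
  linarith

end Corollary

end FedAMD

/-! ### The main theorem -/

theorem corollary3 :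
    ∃ κ : ℝ, 1 ≤ κ ∧
    ∀ c L Δ₀ θ : ℝ, 1 ≤ c → 0 < L → 0 ≤ Δ₀ → 1 ≤ θ →
    ∃ C₁ : ℝ, 0 < C₁ ∧
    ∀ ε₀ : ℝ, 0 < ε₀ →
    ∃ C₂ : ℝ, 0 < C₂ ∧
    ∀ (Z : Type*) [MeasurableSpace Z] (d M A K b : ℕ) (P : FedAMD.Problem Z d M)
      (x₀ : FedAMD.Vec d) (σ Lσ ε : ℝ),
      P.Regular → P.Smooth L → 0 ≤ σ → P.BoundedNoise σ → 0 ≤ Lσ → P.AverageSmooth Lσ →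
      BddBelow (Set.range P.obj) → P.obj x₀ - (⨅ x, P.obj x) ≤ Δ₀ →
      1 ≤ A → A ≤ M → 1 ≤ K → 2 * Lσ ^ 2 / L ^ 2 ≤ K → 0 < ε →
      b = P.data.largeBatch (θ * σ ^ 2 / (M * ε)) → 1 < b →
      (∀ T : ℕ, C₁ * (M / (A * ε)) ≤ T →
        ∃ t < T, FedAMD.gradSq P (FedAMD.constantParams M A K b c L) x₀ t
          ≤ ENNReal.ofReal ((if (b : ℕ∞) = P.data.size then 1 else max 1 (κ / θ)) * ε)) ∧
      (P.data.IsOnline → ε ≤ ε₀ →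
        ∀ᵐ st ∂(FedAMD.law P (FedAMD.constantParams M A K b c L) x₀
            ⌈C₁ * (M / (A * ε))⌉₊),
          (st.2.2 : ℝ) ≤ C₂ * (σ ^ 2 / ε ^ 2 + M * K / ε)) := by
  -- `866 = 2 · 433`: for `b < n` the accuracy is at most `ε/2 + 433 ε/θ`, the average of `ε` and
  -- `866 ε/θ`, hence at most their maximum.
  refine ⟨866, by norm_num, fun c L Δ₀ θ hc hL hΔ₀ hθ => ?_⟩
  have hc0 : 0 < c := by linarith
  refine ⟨768 * c * L * Δ₀ + 1, by positivity, fun ε₀ hε₀ => ?_⟩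
  refine ⟨2 * θ * ((768 * c * L * Δ₀ + 1) + 2 * ε₀), by positivity, ?_⟩
  intro Z _ d M A K b P x₀ σ Lσ ε hP hsmooth hσ hnoise hLσ havg hbdd hΔ hA hAM hK hKL hε hb hb1
  have hM0 : (0 : ℝ) < M := by exact_mod_cast lt_of_lt_of_le hA hAM
  have hb0 : (0 : ℝ) < b := by positivity
  have hsize : (b : ℕ∞) ≤ P.data.size := hb ▸ P.data.largeBatch_le_size _
  have hs := FedAMD.setting_constantParams hP hsmooth hnoise havg hL hc hA hAM hK hKL hb1.le hsize
  refine ⟨fun T hT => ?_, fun honline hεε₀ => ?_⟩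
  · refine hs.exists_gradSq_constantParams_le hc x₀ (fun x => ciInf_le hbdd x) hΔ hΔ₀ hε ?_ ?_ hT
    · refine le_mul_of_one_le_left hε.le ?_
      split_ifs
      exacts [le_rfl, le_max_left _ _]
    · split_ifs with h
      · linarith
      · have h1 : θ * σ ^ 2 / (M * ε) ≤ b := by
          rw [hb] at h ⊢
          exact P.data.le_largeBatch h
        have h2 : (M : ℝ)⁻¹ * (σ ^ 2 / b) ≤ ε / θ := by
          rw [div_le_iff₀ (by positivity)] at h1
          rw [inv_mul_eq_div, div_div, div_le_div_iff₀ (by positivity) (by positivity)]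
          linarith
        have h3 : 1 * ε ≤ max 1 (866 / θ) * ε := by
          gcongr
          exact le_max_left _ _
        have h4 : 866 / θ * ε ≤ max 1 (866 / θ) * ε := by
          gcongr
          exact le_max_right _ _
        have h5 : 866 / θ * ε = 866 * (ε / θ) := by ring
        linarith
  · filter_upwards [hs.ae_count_le x₀ ⌈(768 * c * L * Δ₀ + 1) * (M / (A * ε))⌉₊] with st hst
    -- Since `b > 1`, the number under the ceiling exceeds one, so rounding up at most doubles it.
    have ha : (b : ℝ) ≤ 2 * (θ * σ ^ 2 / (M * ε)) := by
      have h1 : b = ⌈θ * σ ^ 2 / (M * ε)⌉₊ := by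
        rw [hb]
        cases hD : P.data with
        | dataset n pts => simp [hD, FedAMD.LocalData.IsOnline] at honline
        | online D => rfl
      have h2 : (1 : ℝ) < θ * σ ^ 2 / (M * ε) := by
        rw [h1, Nat.lt_ceil] at hb1
        exact_mod_cast hb1
      have h3 := Nat.ceil_lt_add_one (show 0 ≤ θ * σ ^ 2 / (M * ε) by linarith)
      rw [← h1] at h3
      linarith
    refine FedAMD.count_bound hθ hε hεε₀ (by positivity) hA hAM (Nat.cast_nonneg _)
      (Nat.ceil_lt_add_one (by positivity)).le ha ?_
    have h4 : (st.2.2 : ℝ) ≤ ((M * b + ⌈(768 * c * L * Δ₀ + 1) * (M / (A * ε))⌉₊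
        * (A * (b + K * 1)) : ℕ) : ℝ) := by exact_mod_cast hst
    push_cast at h4
    rwa [mul_one] at h4
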